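/- Let $k$ be an algebraically closed field of characteristic $0$, let $A$ and $B$ be $k$-vector spaces of dimensions $a$ and $b$, and let $V=H^0(\mathbb P^3_k,\mathcal O(1))$. Let $\mathcal M=\mathrm{Hom}(B,A\otimes V)$, seen as an affine space over $k$. A point $m$ of $\mathcal M$ induces, over its residue field $\kappa(m)$, linear maps $m(d):B\otimes S^dV\to A\otimes S^{d+1}V$ ($d\ge 0$) and a morphism of sheaves $\underline m:B\otimes\mathcal O\to A\otimes\mathcal O(1)$ on $\mathbb P^3_{\kappa(m)}$ with kernel $E_m$. Let $M\subset\mathcal M$ be the open set where $\underline m$ is surjective, and, for $f\ge 1$, let $W^{f-1}[d]\subset M$ be the locus where the corank of $m(d)$ (the minimum of the dimensions of its kernel and its cokernel) is at least $f$. Put $W=W^{f-1}[1]$, and let $W^\circ\subset W$ be the open part where $\mathrm{Im}\,m(1)$ has codimension exactly $f$ in $A\otimes S^2V$. Let $W_P$ be the open subset of $W$ consisting of the points of $W^\circ$ at which the morphism $m\mapsto\mathrm{Im}\,m(1)$ to the Grassmannian of subspaces of codimension $f$ of $A\otimes S^2V$ is dominant, i.e. all irreducible components of $W^\circ$ through the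 point dominate the Grassmannian. For a subspace $Z\subset A\otimes S^2V$ let $Z^*\subset A\otimes V$ be the subspace of those $y$ with $y\cdot v\in Z$ for all $v\in V$. Assume $5a/2\le b\le 4a$ and $f>0$. (I) If $f>a-b/4$, then $W_P\subset W^0[0]$; moreover, for every $m\in W_P$ the sheaf $\mathcal O$ is a direct summand of $E_m$. (II) If $f\le a-b/4$, then $W_P$ is irreducible and not contained in $W^0[0]$, and it is contained in a unique irreducible component $PW$ of $W$. The codimension of $PW$ in $M$ is the expected one, $f(4b-10a+f)$, and the generic point $\mu$ of $PW$ has the following properties. 1. $\mu$ represents the generic morphism from $B$ to the subspace $Z^*$ of $A\otimes V$, of codimension $4f$, where $Z$ is the generic subspace of codimension $f$ of $A\otimes S^2V$; that is, $\mu$ is the image in $\mathcal M$ of the generic point of $\mathrm{Hom}(B,Z^*)$, for $Z$ the generic subspace taken over any extension of $k$ over which it is defined. The image of $\mu(1)$ is $Z$. 2. For every $d>1$ the map $\mu(d):B\otimes S^dV\to A\otimes S^{d+1}V$ is surjective; $\underline\mu$ is surjective and its kernel $E_\mu$ is locally free of rank $b-a$. 3. $E_\mu$ has the expected cohomology: for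 every integer $t\ne 1$ at most one of the groups $H^i(E_\mu(t))$ is nonzero, and $h^1(E_\mu(1))=f$, $h^0(E_\mu(1))=4b-10a+f$, $h^2(E_\mu(1))=h^3(E_\mu(1))=0$. -/

import Mathlib

universe u

noncomputable section

namespace Steiner

/-! ## Graded pieces of localized polynomial rings in four variables -/

/-- Laurent polynomials `K[x₀^±, …, x₃^±]`. -/
abbrev Laurent (K : Type u) [Field K] : Type u := AddMonoidAlgebra K (Fin 4 → ℤ)

section Field

variable (K : Type u) [Field K]

/-- The degree `d` part of `K[x₀, …, x₃][x_p⁻¹ : p ∈ I]`, inside the Laurent polynomials.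
For `I = ∅` this is `S^d V`, where `V` is the space of linear forms on `ℙ³`; for `I ≠ ∅` it is the
space of sections of `𝒪(d)` over the affine open set `D₊(∏_{p ∈ I} x_p)` of `ℙ³`. -/
def sec (I : Finset (Fin 4)) (d : ℤ) : Submodule K (Laurent K) where
  carrier := {s | ∀ e, s.coeff e ≠ 0 → ∑ p, e p = d ∧ ∀ p ∉ I, 0 ≤ e p}
  zero_mem' := by
    intro e he
    simp at he
  add_mem' := by
    intro s t hs ht e he
    by_cases h : s.coeff e = 0
    · refine ht e fun h' => he ?_
      simp [h, h']
    · exact hs e h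
  smul_mem' := by
    intro c s hs e he
    refine hs e fun h => he ?_
    simp [h]

variable {K}

theorem single_mem_sec {I : Finset (Fin 4)} {d : ℤ} {e : Fin 4 → ℤ} (c : K)
    (h1 : ∑ p, e p = d) (h2 : ∀ p ∉ I, 0 ≤ e p) :
    (AddMonoidAlgebra.single e c : Laurent K) ∈ sec K I d := by
  intro e' he'
  have h : e = e' := by
    by_contra hne
    apply he'
    simp [AddMonoidAlgebra.coeff_single, hne]
  subst h
  exact ⟨h1, h2⟩

theorem sec_mono {I J : Finset (Fin 4)} (h : I ⊆ J) (d : ℤ) : sec K I d ≤ sec K J d :=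
  fun _ hs e he => ⟨(hs e he).1, fun p hp => (hs e he).2 p fun hI => hp (h hI)⟩

theorem mul_mem_sec {I : Finset (Fin 4)} {d d' : ℤ} {s t : Laurent K}
    (hs : s ∈ sec K I d) (ht : t ∈ sec K I d') : s * t ∈ sec K I (d + d') := by
  classical
  intro e he
  have h1 : e ∈ (s * t).coeff.support := Finsupp.mem_support_iff.mpr he
  obtain ⟨e1, he1, e2, he2, rfl⟩ := Finset.mem_add.mp (AddMonoidAlgebra.support_coeff_mul_subset s t h1)
  have k1 := hs e1 (Finsupp.mem_support_iff.mp he1)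
  have k2 := ht e2 (Finsupp.mem_support_iff.mp he2)
  refine ⟨?_, fun p hp => ?_⟩
  · simp [Finset.sum_add_distrib, k1.1, k2.1]
  · exact add_nonneg (k1.2 p hp) (k2.2 p hp)

variable (K)

/-- The coordinate ring of the affine open set `D₊(∏_{p ∈ I} x_p)` of `ℙ³` (for `I ≠ ∅`). -/
def coordRing (I : Finset (Fin 4)) : Subalgebra K (Laurent K) where
  carrier := sec K I 0
  mul_mem' := by
    intro s t hs ht
    have h := mul_mem_sec hs ht
    rw [add_zero] at h
    exact h
  add_mem' := fun hs ht => (sec K I 0).add_mem hs ht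
  algebraMap_mem' := fun c => by
    have h : (algebraMap K (Laurent K)) c = AddMonoidAlgebra.single 0 c := by
      simp [AddMonoidAlgebra.coe_algebraMap]
    rw [h]
    exact single_mem_sec c (by simp) (by simp)

/-- `n`-tuples of elements of `sec K I d`. For `I = ∅` this is `A ⊗ S^d V` with `A = K^n`. -/
def vecSec (n : ℕ) (I : Finset (Fin 4)) (d : ℤ) : Submodule K (Fin n → Laurent K) :=
  Submodule.pi Set.univ fun _ => sec K I d

/-! ## Matrices of linear forms -/

/-- The coefficients of an `a × b` matrix of linear forms in four variables, that is, the
coordinates on `Hom(B, A ⊗ V)` for `A = K^a`, `B = K^b`. -/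
abbrev Idx (a b : ℕ) : Type := Fin a × Fin b × Fin 4

variable {K} {a b : ℕ}

/-- The `(i, j)` entry `∑_p m_{i j p} x_p` of the matrix of linear forms `m`. -/
def linForm (m : Idx a b → K) (i : Fin a) (j : Fin b) : Laurent K :=
  ∑ p : Fin 4, AddMonoidAlgebra.single (Pi.single p 1) (m (i, j, p))

theorem linForm_mem (m : Idx a b → K) (i : Fin a) (j : Fin b) (I : Finset (Fin 4)) :
    linForm m i j ∈ sec K I 1 :=
  Submodule.sum_mem _ fun p _ => single_mem_sec _ (by simp) fun q _ => by
    by_cases h : q = p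
    · subst h; simp
    · simp [h]

/-- Multiplication of column vectors by the matrix of linear forms `m`. -/
def mulMap (m : Idx a b → K) : (Fin b → Laurent K) →ₗ[Laurent K] (Fin a → Laurent K) :=
  Matrix.mulVecLin (Matrix.of fun i j => linForm m i j)

theorem mulMap_apply (m : Idx a b → K) (v : Fin b → Laurent K) (i : Fin a) :
    mulMap m v i = ∑ j, linForm m i j * v j := rfl

theorem mulMap_mem (m : Idx a b → K) (I : Finset (Fin 4)) (d : ℤ) :
    ∀ v ∈ vecSec K b I d, ((mulMap m).restrictScalars K) v ∈ vecSec K a I (d + 1) := by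
  intro v hv i _
  change mulMap m v i ∈ sec K I (d + 1)
  rw [mulMap_apply]
  refine Submodule.sum_mem _ fun j _ => ?_
  rw [add_comm d 1]
  exact mul_mem_sec (linForm_mem m i j I) (hv j trivial)

/-- The map induced by `m` from `b`-tuples of degree `d` to `a`-tuples of degree `d + 1`, over
`K[x₀, …, x₃][x_p⁻¹ : p ∈ I]`. -/
def mulOn (m : Idx a b → K) (I : Finset (Fin 4)) (d : ℤ) :
    vecSec K b I d →ₗ[K] vecSec K a I (d + 1) :=
  ((mulMap m).restrictScalars K).restrict (mulMap_mem m I d)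

/-- The map `m(d) : B ⊗ S^d V → A ⊗ S^{d+1} V`. -/
abbrev mDeg (m : Idx a b → K) (d : ℕ) : vecSec K b ∅ (d : ℤ) →ₗ[K] vecSec K a ∅ ((d : ℤ) + 1) :=
  mulOn m ∅ d

/-- The image of `m(d)`, as a subspace of the space of `a`-tuples of polynomials. -/
def image (m : Idx a b → K) (d : ℕ) : Submodule K (Fin a → Laurent K) :=
  (LinearMap.range (mDeg m d)).map (vecSec K a ∅ ((d : ℤ) + 1)).subtype

/-- The dimension of the cokernel of `m(d)`. -/
def cokerDim (m : Idx a b → K) (d : ℕ) : ℕ :=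
  Module.finrank K (vecSec K a ∅ ((d : ℤ) + 1) ⧸ LinearMap.range (mDeg m d))

/-- The corank of `m(d)`: the minimum of the dimensions of its kernel and its cokernel. -/
def corank (m : Idx a b → K) (d : ℕ) : ℕ :=
  min (Module.finrank K (LinearMap.ker (mDeg m d))) (cokerDim m d)

/-- The morphism of sheaves `b.𝒪 → a.𝒪(1)` on `ℙ³` defined by `m` is surjective: it is so on each
of the standard affine open sets `D₊(x_p)`. -/
def SheafSurjective (m : Idx a b → K) : Prop :=
  ∀ p : Fin 4, Function.Surjective (mulOn m {p} 0)

/-! ## The kernel sheaf and its cohomology -/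

/-- The sections of `E_m(t)` over `D₊(∏_{p ∈ I} x_p)` (for `I ≠ ∅`), where `E_m` is the kernel of
`b.𝒪 → a.𝒪(1)`, as a module over the coordinate ring of this open set. The restriction maps are the
inclusions. -/
def kerSec (m : Idx a b → K) (I : Finset (Fin 4)) (t : ℤ) :
    Submodule (coordRing K I) (Fin b → Laurent K) where
  carrier := {v | v ∈ vecSec K b I t ∧ mulMap m v = 0}
  zero_mem' := ⟨Submodule.zero_mem _, map_zero _⟩
  add_mem' := fun hv hw => ⟨Submodule.add_mem _ hv.1 hw.1, by rw [map_add, hv.2, hw.2, add_zero]⟩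
  smul_mem' := by
    intro c v hv
    refine ⟨fun i _ => ?_, ?_⟩
    · have h := mul_mem_sec (show (c : Laurent K) ∈ sec K I 0 from c.2) (hv.1 i trivial)
      rw [zero_add] at h
      exact h
    · have h : c • v = (c : Laurent K) • v := rfl
      rw [h, map_smul, hv.2, smul_zero]

/-- `E_m` is locally free of rank `r`: over each `D₊(x_p)` it is given by a finitely generated
projective module of constant rank `r`. -/
def LocallyFreeOfRank (m : Idx a b → K) (r : ℕ) : Prop :=
  ∀ p : Fin 4, Module.Finite (coordRing K {p}) (kerSec m {p} 0) ∧
    Module.Projective (coordRing K {p}) (kerSec m {p} 0) ∧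
    ∀ x : PrimeSpectrum (coordRing K {p}), Module.rankAtStalk (kerSec m {p} 0) x = r

/-- `E_m` has `𝒪` as a direct summand: there are morphisms `𝒪 → E_m`, given by a global section
`s`, and `E_m → 𝒪`, given by a compatible family of linear maps `r` over the standard open sets,
with composite the identity of `𝒪`. -/
def HasTrivialSummand (m : Idx a b → K) : Prop :=
  ∃ (s : Fin b → Laurent K) (hs : ∀ I : Finset (Fin 4), I.Nonempty → s ∈ kerSec m I 0)
    (r : ∀ I : Finset (Fin 4), kerSec m I 0 →ₗ[coordRing K I] coordRing K I),
    (∀ (I J : Finset (Fin 4)), I.Nonempty → I ⊆ J →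
      ∀ (v : Fin b → Laurent K) (hI : v ∈ kerSec m I 0) (hJ : v ∈ kerSec m J 0),
        (r J ⟨v, hJ⟩ : Laurent K) = (r I ⟨v, hI⟩ : Laurent K)) ∧
    ∀ (I : Finset (Fin 4)) (hI : I.Nonempty), r I ⟨s, hs I hI⟩ = 1

/-- The alternating Čech `i`-cochains of `E_m(t)` for the covering of `ℙ³` by the `D₊(x_p)`:
families of sections of `E_m(t)` over the `(i + 1)`-fold intersections. -/
def cochains (m : Idx a b → K) (t : ℤ) (i : ℕ) :
    Submodule K (Finset (Fin 4) → Fin b → Laurent K) where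
  carrier := {s | ∀ I : Finset (Fin 4), (I.card = i + 1 → s I ∈ kerSec m I t) ∧ (I.card ≠ i + 1 → s I = 0)}
  zero_mem' := fun I => ⟨fun _ => Submodule.zero_mem _, fun _ => rfl⟩
  add_mem' := fun hs hs' I => ⟨fun h => Submodule.add_mem _ ((hs I).1 h) ((hs' I).1 h),
    fun h => by rw [Pi.add_apply, (hs I).2 h, (hs' I).2 h, add_zero]⟩
  smul_mem' := fun c s hs I => ⟨fun h =>
      ((kerSec m I t).restrictScalars K).smul_mem c ((hs I).1 h),
    fun h => by rw [Pi.smul_apply, (hs I).2 h, smul_zero]⟩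

variable (K b) in
/-- The Čech differential: `(δ s)_J = ∑_{j ∈ J} ± s_{J ∖ j}`, with the sign `(-1)^n` if `j` is the
`n`-th element of `J`, counted from `0`. -/
def cechDiff : (Finset (Fin 4) → Fin b → Laurent K) →ₗ[K] (Finset (Fin 4) → Fin b → Laurent K) :=
  LinearMap.pi fun J => ∑ j ∈ J, ((-1 : K) ^ (J.filter (· < j)).card) •
    LinearMap.proj (J.erase j)

/-- Čech cocycles. -/
def cocycles (m : Idx a b → K) (t : ℤ) (i : ℕ) :
    Submodule K (Finset (Fin 4) → Fin b → Laurent K) :=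
  cochains m t i ⊓ LinearMap.ker (cechDiff K b)

/-- Čech coboundaries. -/
def coboundaries (m : Idx a b → K) (t : ℤ) :
    ℕ → Submodule K (Finset (Fin 4) → Fin b → Laurent K)
  | 0 => ⊥
  | i + 1 => (cochains m t i).map (cechDiff K b)

/-- The cohomology group `H^i(ℙ³, E_m(t))`, computed by the Čech complex of the standard affine
covering of `ℙ³`. -/
abbrev H (m : Idx a b → K) (t : ℤ) (i : ℕ) : Type u :=
  cocycles m t i ⧸ (coboundaries m t i).submoduleOf (cocycles m t i)

/-! ## Subspaces of `A ⊗ S² V` and of `A ⊗ V` -/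

/-- The codimension of `Z` in `U`, for subspaces `Z ≤ U`. -/
def codimIn {n : ℕ} (Z U : Submodule K (Fin n → Laurent K)) : ℕ :=
  Module.finrank K (U ⧸ Z.submoduleOf U)

/-- The index set of the basis `e_i ⊗ x_p x_q` (`p ≤ q`) of `A ⊗ S² V`. -/
abbrev QuadIdx (a : ℕ) : Type := Fin a × {pq : Fin 4 × Fin 4 // pq.1 ≤ pq.2}

/-- The coordinates on `A ⊗ S² V` in the basis `e_i ⊗ x_p x_q`. -/
def quadCoord (v : Fin a → Laurent K) (t : QuadIdx a) : K :=
  (v t.1).coeff (Pi.single t.2.1.1 1 + Pi.single t.2.1.2 1)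

/-- The subspace `Z` of `A ⊗ S² V ⊗ K`, seen as a `K`-valued point of the Grassmannian over `k` of
subspaces of codimension `f` of `A ⊗ S² V`, lies over the generic point of this Grassmannian: it
belongs to one of the standard affine charts of the Grassmannian (the chart attached to a set `I` of
`f` basis vectors consists of the subspaces complementary to the span of `I`, which are given by the
equations `v_i = ∑_{j ∉ I} c_{ij} v_j` for `i ∈ I`, with coordinates `c`), and its coordinates in
this chart are algebraically independent over `k`. -/
def IsGenericSubspace (k : Type u) [Field k] [Algebra k K] (f : ℕ)
    (Z : Submodule K (Fin a → Laurent K)) : Prop :=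
  Z ≤ vecSec K a ∅ 2 ∧
  ∃ I : Finset (QuadIdx a), I.card = f ∧ ∃ c : {t // t ∈ I} × {t // t ∉ I} → K,
    AlgebraicIndependent k c ∧
    ∀ v ∈ vecSec K a ∅ 2, v ∈ Z ↔
      ∀ i : {t // t ∈ I}, quadCoord v i = ∑ j : {t // t ∉ I}, c (i, j) * quadCoord v j

/-- For `Z ⊆ A ⊗ S² V` with quotient `F`, the subspace `Z^*` of `A ⊗ V`: the kernel of the map
`A ⊗ V → Hom(V, F)` sending `y` to `l ↦ l y mod Z`. -/
def star (Z : Submodule K (Fin a → Laurent K)) : Submodule K (Fin a → Laurent K) where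
  carrier := {y | y ∈ vecSec K a ∅ 1 ∧ ∀ l ∈ sec K ∅ 1, l • y ∈ Z}
  zero_mem' := ⟨Submodule.zero_mem _, fun l _ => by rw [smul_zero]; exact Z.zero_mem⟩
  add_mem' := fun hy hz => ⟨Submodule.add_mem _ hy.1 hz.1, fun l hl => by
    rw [smul_add]; exact Z.add_mem (hy.2 l hl) (hz.2 l hl)⟩
  smul_mem' := fun c y hy => ⟨Submodule.smul_mem _ c hy.1, fun l hl => by
    rw [smul_comm]; exact Z.smul_mem c (hy.2 l hl)⟩

/-- Extension of scalars of a subspace from `K` to `L`. -/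
def extend (L : Type u) [Field L] [Algebra K L] (Z : Submodule K (Fin a → Laurent K)) :
    Submodule L (Fin a → Laurent L) :=
  Submodule.span L
    ((fun v i => AddMonoidAlgebra.mapRingHom (Fin 4 → ℤ) (algebraMap K L) (v i)) ''
      (Z : Set (Fin a → Laurent K)))

end Field

/-! ## The space of matrices and the Brill–Noether loci -/

section Loci

/-- The affine space `ℳ = Hom(B, A ⊗ V)` over `k`, as the spectrum of the polynomial ring in the
coefficients. -/
abbrev Space (k : Type u) [Field k] (a b : ℕ) : Type u := PrimeSpectrum (MvPolynomial (Idx a b) k)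

variable {k : Type u} [Field k] {a b : ℕ}

/-- The residue field of a point of `ℳ`. -/
abbrev kappa (x : Space k a b) : Type u := x.asIdeal.ResidueField

/-- The matrix of linear forms over the residue field `κ(x)` that corresponds to the point `x`. -/
def mat (x : Space k a b) : Idx a b → kappa x :=
  fun i => algebraMap (MvPolynomial (Idx a b) k) (kappa x) (MvPolynomial.X i)

variable (k a b) in
/-- The open set `M` of `ℳ` where `b.𝒪 → a.𝒪(1)` is surjective. -/
def locusM : Set (Space k a b) := {x | SheafSurjective (mat x)}

variable (k a b) in
/-- `corankLocus k a b f d` is the locus `W^{f-1}[d]` in `M` where `m(d)` has corank at least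
`f`. -/
def corankLocus (f d : ℕ) : Set (Space k a b) := {x ∈ locusM k a b | f ≤ corank (mat x) d}

variable (k a b) in
/-- The open part of `W = W^{f-1}[1]` where the image of `m(1)` has codimension exactly `f`. -/
def locusExact (f : ℕ) : Set (Space k a b) :=
  {x ∈ corankLocus k a b f 1 | cokerDim (mat x) 1 = f}

/-- `C` is an irreducible component of the subspace `S` of `X`. -/
def IsComponent {X : Type u} [TopologicalSpace X] (C S : Set X) : Prop :=
  Maximal (fun T : Set X => IsIrreducible T ∧ T ⊆ S) C

/-- The morphism `m ↦ Im m(1)` from `C` to the Grassmannian of subspaces of codimension `f` of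
`A ⊗ S² V` is dominant, for an irreducible subset `C` of `locusExact k a b f`: the generic point of
the Grassmannian is in its image. -/
def Dominates (f : ℕ) (C : Set (Space k a b)) : Prop :=
  ∃ x ∈ C, IsGenericSubspace k f (image (mat x) 1)

variable (k a b) in
/-- The open subset `W_P` of `W`: the points where the image of `m(1)` has codimension exactly `f`
and where the morphism `m ↦ Im m(1)` to the Grassmannian is dominant, that is, which lie only on
components of `locusExact k a b f` that dominate the Grassmannian. -/
def locusWP (f : ℕ) : Set (Space k a b) :=
  {x ∈ locusExact k a b f | ∀ C, IsComponent C (locusExact k a b f) → x ∈ C → Dominates f C}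

variable (b) in
/-- For a subspace `Y` of `A ⊗ V` over `k`, the linear subvariety `Hom(B, Y)` of
`ℳ = Hom(B, A ⊗ V)`. -/
def homLocus (Y : Submodule k (Fin a → Laurent k)) : Set (Space k a b) :=
  {x | image (mat x) 0 ≤ extend (kappa x) Y}

/-- The map `ℳ_L → ℳ_k` for a field extension `L / k`. -/
def toBase (k : Type u) [Field k] {L : Type u} [Field L] [Algebra k L] (x : Space L a b) :
    Space k a b :=
  PrimeSpectrum.comap (MvPolynomial.map (algebraMap k L)) x

/-- `μ` represents the generic morphism from `B` to the subspace `Z^*`, of codimension `4 f`, of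
`A ⊗ V` that is attached to the generic subspace `Z` of codimension `f` of `A ⊗ S² V`, and the image
of `μ(1)` is `Z`. Here `Z` may be taken over any extension `L` of `k` over which the generic subspace
is defined; the generic morphism is then the generic point `ν` of the variety `Hom(B, Z^*)` over
`L`. -/
def IsGenericMorphism (f : ℕ) (μ : Space k a b) : Prop :=
  IsGenericSubspace k f (image (mat μ) 1) ∧
  ∀ (L : Type u) [Field L] [Algebra k L] (Z : Submodule L (Fin a → Laurent L)),
    IsGenericSubspace k f Z →
      codimIn (star Z) (vecSec L a ∅ 1) = 4 * f ∧
      ∃ ν : Space L a b, IsGenericPoint ν (homLocus b (star Z)) ∧ toBase k ν = μ ∧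
        image (mat ν) 1 = extend (kappa ν) Z

end Loci

end Steiner

end

set_option linter.unusedSectionVars false

noncomputable section

namespace Steiner

/-! ### Ranks of matrices and minors. -/

section Rank

variable {K : Type*} [Field K] {m n : Type*} [Fintype m] [Fintype n]

/-! The key is that annihilation is linear. Functionals `φ_1, …, φ_f` on `A ⊗ S²V` annihilate `Im
m(1)` if and only if their `4f` contractions `y ↦ φ_l(x_q y)` annihilate `Im m(0) ⊂ A ⊗ V`
(`mul_quadMat_eq_zero_iff`). If `Z` is the common kernel of the `φ_l`, the contractions cut out
`Z^*`, and the solutions `m` form `Hom(B, Z^*)`. When a maximal minor `J` of the matrix of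
contractions is nonzero, Cramer's rule parametrizes these solutions polynomially in `φ` and in free
coordinates `w` (`param`). Taking `φ` and `w` indeterminate gives a point `μ = genPoint` of `ℳ`. Its
ideal can be computed in any chart of the Grassmannian, because changing the basis of the
functionals only rescales `w` (`aeval_param_eq_zero_iff`).

A point whose `Im m(1)` is a generic subspace is annihilated by functionals with algebraically
independent chart coordinates, so the minor is nonzero there and the point is a specialization of
`μ` (`genPoint_le`). Genericity of the image also passes to generizations within `W`
(`isGenericSubspace_of_specializes`): chart coordinates lift to the local ring, and a relation
between the lifts would specialize. Hence every point of `W_P` specializes from `μ`, and an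
irreducible subset of `W` containing `μ` lies in the closure of `μ`. So `W_P` is irreducible and the
closure of `μ` in `W` is the only component containing it, provided that `μ` lies in `M` and `μ(1)`
has corank exactly `f`.

By semicontinuity of rank, this and all rank properties of `μ` follow from one morphism `m₀` over
`k`, annihilated by functionals with a nonzero minor, with `m₀(0)` injective, `m₀(1)` of corank at
most `f` and `m₀(2)` surjective (`exists_good_morphism`). It is built from a labelling of the cells
`(i, p)`: the annihilator of `Im m₀(0)` is spanned by sums of coordinates with equal label, and a
rigidity condition, checked on five small tables, says that the only quadratic functionals with all
contractions in this span are the expected `f` ones. Direct sums of the tables cover all the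
required `a` and `f`, and `5a ≤ 2b` is exactly the room needed.

The codimension is a transcendence degree count: `f(10a − f)` chart coordinates and `(4a − 4f)b`
coordinates `w` form a transcendence basis of `κ(μ)` (`height_genPoint`). The cohomology follows
from `0 → E → b.𝒪 → a.𝒪(1) → 0` and an explicit contraction of the Čech complex of `𝒪(t)`.

If `f > a − b/4`, the contractions of generic functionals have rank at least `4 min(f, a)`, which
forces `rank m(0) < b` on `W_P`; a constant vector in the kernel then splits off a copy of `𝒪`. -/

theorem exists_linearIndependent_col (M : Matrix m n K) {r : ℕ} (hr : r ≤ M.rank) :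
    ∃ t : Fin r → n, LinearIndependent K fun i => M.col (t i) := by
  obtain ⟨g, hg, -, hli⟩ := Submodule.exists_fun_fin_finrank_span_eq K (Set.range M.col)
  rw [Matrix.rank_eq_finrank_span_cols] at hr
  choose t ht using hg
  refine ⟨fun i => t (Fin.castLE hr i), ?_⟩
  rw [show (fun i => M.col (t (Fin.castLE hr i))) = g ∘ Fin.castLE hr from funext fun i => ht _]
  exact hli.comp (Fin.castLE hr) (Fin.castLE_injective hr)

/-- Choose `r` independent columns, then `r` independent rows of the resulting matrix of full column
rank. -/
theorem exists_det_submatrix_ne_zero_of_le_rank (M : Matrix m n K) {r : ℕ} (hr : r ≤ M.rank) :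
    ∃ (s : Fin r → m) (t : Fin r → n), (M.submatrix s t).det ≠ 0 := by
  classical
  obtain ⟨t, ht⟩ := exists_linearIndependent_col M hr
  have h1 : LinearIndependent K (M.submatrix id t).transpose.row := ht
  have h2 := h1.rank_matrix
  obtain ⟨s, hs⟩ := exists_linearIndependent_col (M.submatrix id t).transpose
    (r := r) (by rw [h2]; simp)
  refine ⟨s, t, ?_⟩
  have h3 : LinearIndependent K (M.submatrix s t).row := hs
  rw [Matrix.linearIndependent_rows_iff_isUnit, Matrix.isUnit_iff_isUnit_det] at h3
  exact h3.ne_zero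

theorem le_rank_of_det_submatrix_ne_zero (M : Matrix m n K) {ι : Type*} [Fintype ι] [DecidableEq ι]
    (s : ι → m) (t : ι → n) (h : (M.submatrix s t).det ≠ 0) : Fintype.card ι ≤ M.rank := by
  rw [← Matrix.rank_of_det_ne_zero h]
  exact Matrix.rank_submatrix_le M s t

theorem le_rank_iff (M : Matrix m n K) {r : ℕ} :
    r ≤ M.rank ↔ ∃ (s : Fin r → m) (t : Fin r → n), (M.submatrix s t).det ≠ 0 :=
  ⟨exists_det_submatrix_ne_zero_of_le_rank M, fun ⟨s, t, h⟩ => by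
    simpa using le_rank_of_det_submatrix_ne_zero M s t h⟩

/-- A homomorphism of fields preserves the nonvanishing of minors, so ranks can be compared after
any field extension. -/
theorem rank_map_ringHom {L : Type*} [Field L] (g : K →+* L) (M : Matrix m n K) :
    (M.map g).rank = M.rank := by
  have key : ∀ r, r ≤ (M.map g).rank ↔ r ≤ M.rank := fun r => by
    simp_rw [le_rank_iff, Matrix.submatrix_map]
    refine exists_congr fun s => exists_congr fun t => ?_
    rw [show ((M.submatrix s t).map g).det = g (M.submatrix s t).det from
      (RingHom.map_det g _).symm, map_ne_zero]
  exact le_antisymm ((key _).1 le_rfl) ((key _).2 le_rfl)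

/-- A matrix with linearly independent rows has a nonzero maximal minor. -/
theorem exists_det_cols_ne_zero [DecidableEq m] (M : Matrix m n K) (h : M.rank = Fintype.card m) :
    ∃ t : m → n, Function.Injective t ∧ (M.submatrix id t).det ≠ 0 := by
  obtain ⟨t, ht⟩ := exists_linearIndependent_col M h.ge
  let e := Fintype.equivFin m
  refine ⟨t ∘ e, ?_, ?_⟩
  · exact (Function.Injective.of_comp (f := M.col) ht.injective).comp e.injective
  · have h3 : LinearIndependent K (M.submatrix id (t ∘ e)).col := ht.comp e e.injective
    rw [Matrix.linearIndependent_cols_iff_isUnit, Matrix.isUnit_iff_isUnit_det] at h3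
    exact h3.ne_zero

theorem rank_eq_card_of_mulVec_surjective [DecidableEq m] (M : Matrix m n K)
    (h : ∀ v, ∃ w, M.mulVec w = v) : M.rank = Fintype.card m := by
  have h' : Function.Surjective M.mulVecLin := h
  rw [Matrix.rank, LinearMap.range_eq_top.2 h', finrank_top, Module.finrank_fintype_fun_eq_card]

end Rank

/-! ### Semicontinuity of rank on a spectrum. -/

section Open

variable {R : Type*} [CommRing R] {m n : Type*} [Fintype m] [Fintype n]

theorem isOpen_le_rank (M : Matrix m n R) (r : ℕ) :
    IsOpen {x : PrimeSpectrum R | r ≤ (M.map (algebraMap R x.asIdeal.ResidueField)).rank} := by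
  have : {x : PrimeSpectrum R | r ≤ (M.map (algebraMap R x.asIdeal.ResidueField)).rank} =
      ⋃ (s : Fin r → m) (t : Fin r → n),
        (PrimeSpectrum.basicOpen (M.submatrix s t).det : Set (PrimeSpectrum R)) := by
    ext x
    simp only [Set.mem_ofPred_eq, le_rank_iff, Set.mem_iUnion]
    refine exists_congr fun s => exists_congr fun t => ?_
    rw [Matrix.submatrix_map, SetLike.mem_coe, PrimeSpectrum.mem_basicOpen,
      show ((M.submatrix s t).map (algebraMap R x.asIdeal.ResidueField)).det =
        algebraMap R x.asIdeal.ResidueField (M.submatrix s t).det from (RingHom.map_det _ _).symm,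
      ne_eq, Ideal.algebraMap_residueField_eq_zero]
  rw [this]
  exact isOpen_iUnion fun s => isOpen_iUnion fun t => (PrimeSpectrum.basicOpen _).2

theorem rank_le_of_specializes (M : Matrix m n R) {x y : PrimeSpectrum R} (h : x ⤳ y) :
    (M.map (algebraMap R y.asIdeal.ResidueField)).rank ≤
      (M.map (algebraMap R x.asIdeal.ResidueField)).rank :=
  h.mem_open (isOpen_le_rank M _) (Set.mem_ofPred.2 le_rfl)

end Open

end Steiner

end

noncomputable section

namespace Steiner

/-! ## Monomial coordinates -/

/-- The exponents of the monomials of degree `t` in four variables. -/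
abbrev Mon (t : ℤ) : Type := {e : Fin 4 → ℤ // ∑ p, e p = t ∧ ∀ p, 0 ≤ e p}

instance (t : ℤ) : Finite (Mon t) := by
  refine Set.Finite.to_subtype (Set.Finite.subset (Set.finite_Icc (0 : Fin 4 → ℤ) fun _ => t) ?_)
  rintro e ⟨h1, h2⟩
  refine ⟨h2, fun p => ?_⟩
  rw [← h1]
  exact Finset.single_le_sum (f := e) (fun q _ => h2 q) (Finset.mem_univ p)

instance (t : ℤ) : Fintype (Mon t) := Fintype.ofFinite _

section Field

variable {K : Type u} [Field K] {a b : ℕ}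

theorem coeff_eq_zero_of_mem_sec {t : ℤ} {s : Laurent K} (hs : s ∈ sec K ∅ t) (e : Fin 4 → ℤ)
    (he : ¬ (∑ p, e p = t ∧ ∀ p, 0 ≤ e p)) : s.coeff e = 0 := by
  by_contra h
  have := hs e h
  exact he ⟨this.1, fun p => this.2 p (by simp)⟩

theorem sum_coeff_mon {t : ℤ} {s : Laurent K} (hs : s ∈ sec K ∅ t) (e : Fin 4 → ℤ) :
    (∑ e' : Mon t, if e = e'.1 then s.coeff e'.1 else 0) = s.coeff e := by
  by_cases he : ∑ p, e p = t ∧ ∀ p, 0 ≤ e p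
  · rw [Finset.sum_eq_single (⟨e, he⟩ : Mon t)]
    · simp
    · intro e' _ hne
      rw [if_neg]
      rintro rfl
      exact hne rfl
    · simp
  · rw [coeff_eq_zero_of_mem_sec hs e he]
    refine Finset.sum_eq_zero fun e' _ => if_neg ?_
    rintro rfl
    exact he e'.2

variable (K) in
/-- The coordinates on the space of `n`-tuples of forms of degree `t`. -/
def vecEquiv (n : ℕ) (t : ℤ) : vecSec K n ∅ t ≃ₗ[K] (Fin n × Mon t → K) where
  toFun v x := (v.1 x.1).coeff x.2.1
  map_add' _ _ := rfl
  map_smul' _ _ := rfl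
  invFun g := ⟨fun i => ∑ e : Mon t, AddMonoidAlgebra.single e.1 (g (i, e)), fun i _ =>
    Submodule.sum_mem _ fun e _ => single_mem_sec _ e.2.1 fun p _ => e.2.2 p⟩
  left_inv v := by
    ext i e
    have h := sum_coeff_mon (v.2 i trivial) e
    simp only [AddMonoidAlgebra.coeff_sum, AddMonoidAlgebra.coeff_single, Finsupp.coe_finsetSum,
      Finset.sum_apply, Finsupp.single_apply]
    rw [← h]
    exact Finset.sum_congr rfl fun e' _ => by simp only [eq_comm]
  right_inv g := by
    ext ⟨i, e⟩
    simp only [AddMonoidAlgebra.coeff_sum, AddMonoidAlgebra.coeff_single, Finsupp.coe_finsetSum,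
      Finset.sum_apply, Finsupp.single_apply]
    simp [Subtype.val_inj]

theorem vecEquiv_apply (n : ℕ) (t : ℤ) (v : vecSec K n ∅ t) (i : Fin n) (e : Mon t) :
    vecEquiv K n t v (i, e) = (v.1 i).coeff e.1 := rfl

instance (n : ℕ) (t : ℤ) : Module.Finite K (vecSec K n ∅ t) :=
  Module.Finite.equiv (vecEquiv K n t).symm

theorem finrank_vecSec (n : ℕ) (t : ℤ) :
    Module.finrank K (vecSec K n ∅ t) = n * Fintype.card (Mon t) := by
  rw [(vecEquiv K n t).finrank_eq, Module.finrank_fintype_fun_eq_card]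
  simp

/-- The matrix, in monomial coordinates, of the multiplication by the matrix of linear forms `m` on
tuples of forms of degree `t`. -/
def degMat {R : Type*} [CommRing R] (m : Idx a b → R) (t : ℤ) :
    Matrix (Fin a × Mon (t + 1)) (Fin b × Mon t) R :=
  fun x y => ∑ p : Fin 4, if x.2.1 = y.2.1 + Pi.single p 1 then m (x.1, y.1, p) else 0

theorem degMat_map {R S : Type*} [CommRing R] [CommRing S] (g : R →+* S) (m : Idx a b → R) (t : ℤ) :
    (degMat m t).map g = degMat (fun i => g (m i)) t := by
  ext x y
  simp [degMat, apply_ite g]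

theorem coeff_linForm_mul (m : Idx a b → K) (i : Fin a) (j : Fin b) (s : Laurent K)
    (e : Fin 4 → ℤ) :
    (linForm m i j * s).coeff e = ∑ p, m (i, j, p) * s.coeff (e - Pi.single p 1) := by
  simp only [linForm, Finset.sum_mul, AddMonoidAlgebra.coeff_sum, Finsupp.coe_finsetSum,
    Finset.sum_apply]
  refine Finset.sum_congr rfl fun p _ => ?_
  rw [AddMonoidAlgebra.coeff_single_mul_apply, neg_add_eq_sub]

theorem coeff_mulMap (m : Idx a b → K) (v : Fin b → Laurent K) (i : Fin a) (e : Fin 4 → ℤ) :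
    (mulMap m v i).coeff e = ∑ j, ∑ p, m (i, j, p) * (v j).coeff (e - Pi.single p 1) := by
  rw [mulMap_apply]
  simp only [AddMonoidAlgebra.coeff_sum, Finsupp.coe_finsetSum, Finset.sum_apply, coeff_linForm_mul]

theorem vecEquiv_mulOn (m : Idx a b → K) (t : ℤ) (v : vecSec K b ∅ t) :
    vecEquiv K a (t + 1) (mulOn m ∅ t v) = (degMat m t).mulVec (vecEquiv K b t v) := by
  ext ⟨i, e⟩
  rw [vecEquiv_apply]
  change (mulMap m v.1 i).coeff e.1 = _
  rw [coeff_mulMap, Matrix.mulVec, dotProduct, Fintype.sum_prod_type]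
  refine Finset.sum_congr rfl fun j _ => ?_
  simp only [degMat, Finset.sum_mul]
  rw [Finset.sum_comm]
  refine Finset.sum_congr rfl fun p _ => ?_
  rw [← sum_coeff_mon (v.2 j trivial) (e.1 - Pi.single p 1), Finset.mul_sum]
  refine Finset.sum_congr rfl fun e' _ => ?_
  rw [vecEquiv_apply, if_congr (sub_eq_iff_eq_add (c := e'.1)) rfl rfl]
  split_ifs <;> simp

theorem finrank_range_mulOn (m : Idx a b → K) (t : ℤ) :
    Module.finrank K (LinearMap.range (mulOn m ∅ t)) = (degMat m t).rank := by
  rw [Matrix.rank, ← LinearEquiv.finrank_map_eq (vecEquiv K a (t + 1))]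
  have : Submodule.map (vecEquiv K a (t + 1)).toLinearMap (LinearMap.range (mulOn m ∅ t)) =
      LinearMap.range (degMat m t).mulVecLin := by
    rw [← LinearMap.range_comp, show (vecEquiv K a (t + 1)).toLinearMap ∘ₗ mulOn m ∅ t =
      (degMat m t).mulVecLin ∘ₗ (vecEquiv K b t).toLinearMap from
        LinearMap.ext fun v => vecEquiv_mulOn m t v, LinearMap.range_comp,
      LinearEquiv.range, Submodule.map_top]
  exact congrArg (fun S : Submodule K _ => Module.finrank K S) this

/-- Stated through rank because rank is what passes to generizations and field extensions. -/
theorem surjective_mulOn_iff (m : Idx a b → K) (t : ℤ) :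
    Function.Surjective (mulOn m ∅ t) ↔ (degMat m t).rank = Fintype.card (Fin a × Mon (t + 1)) := by
  rw [← finrank_range_mulOn, ← LinearMap.range_eq_top]
  constructor
  · intro h
    rw [h, finrank_top, finrank_vecSec, Fintype.card_prod, Fintype.card_fin]
  · intro h
    apply Submodule.eq_top_of_finrank_eq
    rw [h, finrank_vecSec, Fintype.card_prod, Fintype.card_fin]

theorem injective_mulOn_iff (m : Idx a b → K) (t : ℤ) :
    Function.Injective (mulOn m ∅ t) ↔ (degMat m t).rank = Fintype.card (Fin b × Mon t) := by
  have h1 := LinearMap.finrank_range_add_finrank_ker (mulOn m ∅ t)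
  rw [finrank_range_mulOn, finrank_vecSec] at h1
  rw [← LinearMap.ker_eq_bot, ← Submodule.finrank_eq_zero, Fintype.card_prod, Fintype.card_fin]
  omega

theorem finrank_ker_add_rank (m : Idx a b → K) (d : ℕ) :
    Module.finrank K (LinearMap.ker (mDeg m d)) + (degMat m (d : ℤ)).rank =
      b * Fintype.card (Mon (d : ℤ)) := by
  rw [← finrank_range_mulOn, add_comm, LinearMap.finrank_range_add_finrank_ker, finrank_vecSec]

theorem cokerDim_add_rank (m : Idx a b → K) (d : ℕ) :
    cokerDim m d + (degMat m (d : ℤ)).rank = a * Fintype.card (Mon ((d : ℤ) + 1)) := by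
  rw [cokerDim, ← finrank_range_mulOn, Submodule.finrank_quotient_add_finrank, finrank_vecSec]

/-! ### Forms of degree zero, one and two -/

/-- The monomial of degree one given by a variable. -/
def monOne (p : Fin 4) : Mon 1 := ⟨Pi.single p 1, by simp, fun q => by
  by_cases h : q = p
  · subst h; simp
  · simp [h]⟩

theorem exists_eq_add_single {t : ℤ} (e : Mon (t + 1)) (ht : 0 ≤ t) :
    ∃ (p : Fin 4) (e' : Mon t), e.1 = e'.1 + Pi.single p 1 := by
  have : ∃ p, e.1 p ≠ 0 := by
    by_contra! h
    have := e.2.1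
    simp [h] at this
    omega
  obtain ⟨p, hp⟩ := this
  have hp' : 1 ≤ e.1 p := by have := e.2.2 p; omega
  refine ⟨p, ⟨e.1 - Pi.single p 1, ?_, fun q => ?_⟩, by simp⟩
  · simp [Finset.sum_sub_distrib, e.2.1]
  · by_cases h : q = p
    · subst h; simpa using hp'
    · simpa [h] using e.2.2 q

instance : Unique (Mon 0) where
  default := ⟨0, by simp⟩
  uniq e := by
    ext p
    have := (Finset.sum_eq_zero_iff_of_nonneg fun q _ => e.2.2 q).1 e.2.1 p (Finset.mem_univ p)
    simpa using this

theorem monOne_bijective : Function.Bijective monOne := by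
  constructor
  · intro p q h
    by_contra hne
    have := congrFun (congrArg Subtype.val h) p
    simp [monOne, hne] at this
  · intro e
    obtain ⟨p, e', h⟩ := exists_eq_add_single (t := 0) e le_rfl
    refine ⟨p, Subtype.ext ?_⟩
    have : e'.1 = 0 := congrArg Subtype.val (Subsingleton.elim e' default)
    change e.1 = _ at h
    rw [h, this, zero_add]
    rfl

/-- Two variables, in increasing order. -/
def sortPair (p q : Fin 4) : {pq : Fin 4 × Fin 4 // pq.1 ≤ pq.2} :=
  if h : p ≤ q then ⟨(p, q), h⟩ else ⟨(q, p), (not_le.1 h).le⟩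

theorem sortPair_comm (p q : Fin 4) : sortPair p q = sortPair q p := by
  revert p q; decide

theorem sortPair_of_le (x : {pq : Fin 4 × Fin 4 // pq.1 ≤ pq.2}) : sortPair x.1.1 x.1.2 = x := by
  simp [sortPair, x.2]

/-- The monomial of degree two given by two variables. -/
def monTwo (x : {pq : Fin 4 × Fin 4 // pq.1 ≤ pq.2}) : Mon 2 :=
  ⟨Pi.single x.1.1 1 + Pi.single x.1.2 1, by simp [Finset.sum_add_distrib],
    fun q => add_nonneg ((monOne _).2.2 q) ((monOne _).2.2 q)⟩

theorem monTwo_sortPair (p q : Fin 4) :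
    (monTwo (sortPair p q)).1 = Pi.single p 1 + Pi.single q 1 := by
  unfold sortPair
  split_ifs
  · rfl
  · exact add_comm _ _

theorem monTwo_bijective : Function.Bijective monTwo := by
  constructor
  · have : ∀ x y : {pq : Fin 4 × Fin 4 // pq.1 ≤ pq.2},
        (∀ r, (Pi.single x.1.1 1 + Pi.single x.1.2 1 : Fin 4 → ℤ) r =
          (Pi.single y.1.1 1 + Pi.single y.1.2 1 : Fin 4 → ℤ) r) → x = y := by decide
    intro x y h
    exact this x y fun r => congrFun (congrArg Subtype.val h) r
  · intro e
    obtain ⟨p, e', h⟩ := exists_eq_add_single (t := 1) e zero_le_one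
    obtain ⟨q, rfl⟩ := monOne_bijective.2 e'
    refine ⟨sortPair q p, Subtype.ext ?_⟩
    rw [monTwo_sortPair]
    exact h.symm

theorem card_mon_zero : Fintype.card (Mon 0) = 1 := Fintype.card_unique

theorem card_mon_one : Fintype.card (Mon 1) = 4 := by
  rw [← Fintype.card_of_bijective monOne_bijective, Fintype.card_fin]

theorem card_mon_two : Fintype.card (Mon 2) = 10 := by
  rw [← Fintype.card_of_bijective monTwo_bijective]
  decide

theorem isEmpty_mon {t : ℤ} (ht : t < 0) : IsEmpty (Mon t) :=
  ⟨fun e => by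
    have := Finset.sum_nonneg fun p (_ : p ∈ Finset.univ) => e.2.2 p
    rw [e.2.1] at this
    omega⟩

theorem card_quadIdx : Fintype.card (QuadIdx a) = 10 * a := by
  rw [Fintype.card_prod, Fintype.card_fin, Fintype.card_of_bijective monTwo_bijective, card_mon_two,
    mul_comm]

theorem cokerDim_zero_add_rank (m : Idx a b → K) : cokerDim m 0 + (degMat m 0).rank = 4 * a := by
  have : cokerDim m 0 + (degMat m 0).rank = a * Fintype.card (Mon 1) := cokerDim_add_rank m 0
  rw [card_mon_one] at this
  omega

theorem finrank_ker_zero_add_rank (m : Idx a b → K) :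
    Module.finrank K (LinearMap.ker (mDeg m 0)) + (degMat m 0).rank = b := by
  have : Module.finrank K (LinearMap.ker (mDeg m 0)) + (degMat m 0).rank =
    b * Fintype.card (Mon 0) := finrank_ker_add_rank m 0
  rw [card_mon_zero] at this
  omega

theorem cokerDim_one_add_rank (m : Idx a b → K) : cokerDim m 1 + (degMat m 1).rank = 10 * a := by
  have : cokerDim m 1 + (degMat m 1).rank = a * Fintype.card (Mon 2) := cokerDim_add_rank m 1
  rw [card_mon_two] at this
  omega

theorem finrank_ker_one_add_rank (m : Idx a b → K) :
    Module.finrank K (LinearMap.ker (mDeg m 1)) + (degMat m 1).rank = 4 * b := by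
  have : Module.finrank K (LinearMap.ker (mDeg m 1)) + (degMat m 1).rank =
    b * Fintype.card (Mon 1) := finrank_ker_add_rank m 1
  rw [card_mon_one] at this
  omega

/-- For `5a ≤ 2b` the corank of `m(1)` is the dimension of its cokernel. -/
theorem corank_one_eq (hab : 5 * a ≤ 2 * b) (m : Idx a b → K) : corank m 1 = cokerDim m 1 := by
  have h1 := cokerDim_one_add_rank m
  have h2 := finrank_ker_one_add_rank m
  -- The kernel exceeds the cokernel in dimension by `4b − 10a ≥ 0`.
  rw [corank, min_eq_right]
  omega

/-! ### Quadratic coordinates of the image of `m(1)` -/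

/-- The matrix of `m(1)` in the bases `e_j ⊗ x_q` and `e_i ⊗ x_p x_q`. -/
def quadMat {R : Type*} [CommRing R] (m : Idx a b → R) : Matrix (QuadIdx a) (Fin b × Fin 4) R :=
  fun t y => ∑ p : Fin 4, if t.2 = sortPair p y.2 then m (t.1, y.1, p) else 0

theorem quadMat_map {R S : Type*} [CommRing R] [CommRing S] (g : R →+* S) (m : Idx a b → R) :
    (quadMat m).map g = quadMat fun i => g (m i) := by
  ext x y
  simp [quadMat, apply_ite g]

/-- Ties the matrix indexed as the charts of the Grassmannian are to the one that is uniform in the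
degree. -/
theorem quadMat_eq_submatrix {R : Type*} [CommRing R] (m : Idx a b → R) :
    quadMat m = (degMat m 1).submatrix
      (Equiv.prodCongr (Equiv.refl _) (Equiv.ofBijective _ monTwo_bijective))
      (Equiv.prodCongr (Equiv.refl _) (Equiv.ofBijective _ monOne_bijective)) := by
  ext x y
  simp only [quadMat, degMat, Matrix.submatrix_apply]
  refine Finset.sum_congr rfl fun p _ => ?_
  have : x.2 = sortPair p y.2 ↔ (monTwo x.2).1 = (monOne y.2).1 + Pi.single p 1 := by
    rw [← monTwo_bijective.1.eq_iff, ← Subtype.val_inj, monTwo_sortPair, add_comm (Pi.single p 1)]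
    rfl
  exact if_congr this rfl rfl

theorem rank_quadMat (m : Idx a b → K) : (quadMat m).rank = (degMat m 1).rank := by
  rw [quadMat_eq_submatrix, Matrix.rank_submatrix]

variable (K a) in
/-- The coordinates on `A ⊗ S² V`. -/
def quadEquiv : vecSec K a ∅ 2 ≃ₗ[K] (QuadIdx a → K) :=
  vecEquiv K a 2 ≪≫ₗ LinearEquiv.funCongrLeft K K
    (Equiv.prodCongr (Equiv.refl _) (Equiv.ofBijective _ monTwo_bijective))

variable (K) in
/-- The coordinates on `A ⊗ V`. -/
def linEquiv (n : ℕ) : vecSec K n ∅ 1 ≃ₗ[K] (Fin n × Fin 4 → K) :=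
  vecEquiv K n 1 ≪≫ₗ LinearEquiv.funCongrLeft K K
    (Equiv.prodCongr (Equiv.refl _) (Equiv.ofBijective _ monOne_bijective))

theorem quadCoord_mulMap (m : Idx a b → K) (v : vecSec K b ∅ 1) :
    quadCoord (mulMap m v.1) = (quadMat m).mulVec (linEquiv K b v) := by
  have h := vecEquiv_mulOn m 1 v
  ext t
  have h1 := congrFun h (t.1, monTwo t.2)
  rw [show quadCoord (mulMap m v.1) t =
    vecEquiv K a (1 + 1) (mulOn m ∅ 1 v) (t.1, monTwo t.2) from rfl, h1, quadMat_eq_submatrix,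
    Matrix.submatrix_mulVec_equiv]
  simp only [Function.comp_apply]
  congr 2
  ext x
  simp only [linEquiv, LinearEquiv.trans_apply, LinearEquiv.funCongrLeft_apply, LinearMap.funLeft_apply,
    Function.comp_apply, Equiv.apply_symm_apply]

theorem image_le (m : Idx a b → K) (d : ℕ) : image m d ≤ vecSec K a ∅ ((d : ℤ) + 1) :=
  Submodule.map_subtype_le _ _

theorem mem_image_iff (m : Idx a b → K) (d : ℕ) (v : Fin a → Laurent K) :
    v ∈ image m d ↔ ∃ w ∈ vecSec K b ∅ (d : ℤ), mulMap m w = v := by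
  simp only [image, Submodule.mem_map, LinearMap.mem_range]
  constructor
  · rintro ⟨_, ⟨w, rfl⟩, rfl⟩
    exact ⟨w.1, w.2, rfl⟩
  · rintro ⟨w, hw, rfl⟩
    exact ⟨_, ⟨⟨w, hw⟩, rfl⟩, rfl⟩

/-- The image of `m(1)` in coordinates. -/
theorem mem_image_one_iff (m : Idx a b → K) {v : Fin a → Laurent K} (hv : v ∈ vecSec K a ∅ 2) :
    v ∈ image m 1 ↔ ∃ w, (quadMat m).mulVec w = quadCoord v := by
  rw [mem_image_iff]
  constructor
  · rintro ⟨w, hw, rfl⟩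
    exact ⟨linEquiv K b ⟨w, hw⟩, (quadCoord_mulMap m ⟨w, hw⟩).symm⟩
  · rintro ⟨w, hw⟩
    refine ⟨((linEquiv K b).symm w).1, ((linEquiv K b).symm w).2, ?_⟩
    have h1 : mulMap m ((linEquiv K b).symm w).1 ∈ vecSec K a ∅ 2 :=
      mulMap_mem m ∅ 1 _ ((linEquiv K b).symm w).2
    have h2 := quadCoord_mulMap m ((linEquiv K b).symm w)
    rw [LinearEquiv.apply_symm_apply, hw] at h2
    have h3 : quadEquiv K a ⟨_, h1⟩ = quadEquiv K a ⟨v, hv⟩ := h2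
    exact congrArg Subtype.val ((quadEquiv K a).injective h3)

end Field

end Steiner

end

noncomputable section

namespace Steiner

variable {K : Type u} [Field K] {a b n : ℕ}

/-! ## The Čech complex of `n.𝒪(t)` -/

theorem cechDiff_apply (s : Finset (Fin 4) → Fin n → Laurent K) (J : Finset (Fin 4)) :
    cechDiff K n s J = ∑ j ∈ J, ((-1 : K) ^ (J.filter (· < j)).card) • s (J.erase j) := by
  simp [cechDiff, LinearMap.sum_apply]

/-- `s` is a family of sections of `n.𝒪(t)` over the intersections of `c` of the standard affine open
sets, where the intersection for `c = 0` is understood to give the global sections. -/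
def IsCochain (t : ℤ) (c : ℕ) (s : Finset (Fin 4) → Fin n → Laurent K) : Prop :=
  ∀ I : Finset (Fin 4), (I.card = c → s I ∈ vecSec K n I t) ∧ (I.card ≠ c → s I = 0)

/-- The part of a Laurent polynomial consisting of the monomials for which `x_q` is the first
variable with a nonnegative exponent. -/
def firstNonnegPart (K : Type u) [Field K] (q : Fin 4) : Laurent K →ₗ[K] Laurent K where
  toFun x := .ofCoeff (x.coeff.filter fun e => 0 ≤ e q ∧ ∀ p < q, e p < 0)
  map_add' x y := by
    ext e
    simp [Finsupp.filter_add]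
  map_smul' c x := by
    ext e
    simp [Finsupp.filter_smul]

theorem coeff_firstNonnegPart (q : Fin 4) (x : Laurent K) (e : Fin 4 → ℤ) :
    (firstNonnegPart K q x).coeff e =
      if 0 ≤ e q ∧ ∀ p < q, e p < 0 then x.coeff e else 0 := by
  simp [firstNonnegPart, Finsupp.filter_apply]

theorem exists_firstNonneg (e : Fin 4 → ℤ) (h : ∃ p, 0 ≤ e p) :
    ∃ q, 0 ≤ e q ∧ ∀ p < q, e p < 0 := by
  obtain ⟨q, hq, hmin⟩ := WellFounded.has_min (wellFounded_lt (α := Fin 4)) {p | 0 ≤ e p} h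
  exact ⟨q, hq, fun p hp => not_le.1 fun h' => hmin p h' hp⟩

theorem firstNonneg_unique {e : Fin 4 → ℤ} {q q' : Fin 4} (h : 0 ≤ e q ∧ ∀ p < q, e p < 0)
    (h' : 0 ≤ e q' ∧ ∀ p < q', e p < 0) : q = q' := by
  rcases lt_trichotomy q q' with hlt | heq | hlt
  · exact absurd h.1 (not_le.2 (h'.2 q hlt))
  · exact heq
  · exact absurd h'.1 (not_le.2 (h.2 q' hlt))

/-- The sign rule that makes inserting `q` a contracting homotopy; only finitely many cases occur.
-/
theorem cech_sign (J : Finset (Fin 4)) (q j : Fin 4) (hq : q ∉ J) (hj : j ∈ J) :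
    (-1 : ℤ) ^ (J.filter (· < j)).card *
        (-1) ^ ((insert q (J.erase j)).filter (· < q)).card =
      -((-1) ^ ((insert q J).filter (· < q)).card * (-1) ^ ((insert q J).filter (· < j)).card) := by
  revert J q j
  decide

theorem cech_sign' (J : Finset (Fin 4)) (q j : Fin 4) (hq : q ∉ J) (hj : j ∈ J) :
    (-1 : K) ^ (J.filter (· < j)).card *
        (-1) ^ ((insert q (J.erase j)).filter (· < q)).card =
      -((-1) ^ ((insert q J).filter (· < q)).card * (-1) ^ ((insert q J).filter (· < j)).card) := by
  exact_mod_cast congrArg (Int.cast : ℤ → K) (cech_sign J q j hq hj)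

theorem cech_sign_swap (J : Finset (Fin 4)) (i j : Fin 4) (hi : i ∈ J) (hj : j ∈ J) (hij : i ≠ j) :
    (-1 : ℤ) ^ (J.filter (· < j)).card * (-1) ^ ((J.erase j).filter (· < i)).card +
      (-1) ^ (J.filter (· < i)).card * (-1) ^ ((J.erase i).filter (· < j)).card = 0 := by
  revert J i j
  decide

theorem neg_one_pow_mul_self (c : ℕ) : (-1 : K) ^ c * (-1) ^ c = 1 := by
  rw [← mul_pow]; simp

theorem cechDiff_cechDiff (s : Finset (Fin 4) → Fin n → Laurent K) :
    cechDiff K n (cechDiff K n s) = 0 := by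
  ext1 J
  simp only [cechDiff_apply, Finset.smul_sum, smul_smul, Pi.zero_apply]
  rw [Finset.sum_sigma']
  -- Removing `j` then `i` cancels against removing `i` then `j`.
  refine Finset.sum_involution (fun x _ => ⟨x.2, x.1⟩) ?_ ?_ ?_ ?_
  · rintro ⟨j, i⟩ h
    simp only [Finset.mem_sigma, Finset.mem_erase] at h
    have hs := congrArg (Int.cast : ℤ → K) (cech_sign_swap J i j h.2.2 h.1 h.2.1)
    push_cast at hs
    rw [Finset.erase_right_comm, ← add_smul, hs, zero_smul]
  · rintro ⟨j, i⟩ h _ heq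
    simp only [Finset.mem_sigma, Finset.mem_erase] at h
    simp only [Sigma.mk.injEq] at heq
    exact h.2.1 heq.1
  · rintro ⟨j, i⟩ h
    simp only [Finset.mem_sigma, Finset.mem_erase] at h ⊢
    exact ⟨h.2.2, h.2.1.symm, h.1⟩
  · rintro ⟨j, i⟩ h
    rfl

/-- The Čech complex of `n.𝒪(t)`, augmented by the global sections, is exact except in the highest
degree, and there it is exact if `-3 ≤ t`. -/
theorem exists_cechDiff_eq {t : ℤ} {c : ℕ} (hc : c ≤ 2 ∨ -3 ≤ t)
    {s : Finset (Fin 4) → Fin n → Laurent K} (hs : IsCochain t (c + 1) s)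
    (hd : cechDiff K n s = 0) : ∃ u, IsCochain t c u ∧ cechDiff K n u = s := by
  classical
  -- The contracting homotopy, monomial by monomial. The monomial `e` occurs over `I` exactly when
  -- `I` contains all `p` with `e p < 0`. If `q` is the first index with `e q ≥ 0`, membership of
  -- `q` in `I` is irrelevant, so this part of the complex is a cone and inserting `q` contracts it.
  let u : Finset (Fin 4) → Fin n → Laurent K := fun I i => ∑ q ∈ Iᶜ,
    ((-1 : K) ^ ((insert q I).filter (· < q)).card) • firstNonnegPart K q (s (insert q I) i)
  have hu0 : ∀ I : Finset (Fin 4), I.card ≠ c → u I = 0 := by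
    intro I hI
    ext1 i
    refine Finset.sum_eq_zero fun q hq => ?_
    have : (insert q I).card ≠ c + 1 := by
      rw [Finset.card_insert_of_notMem (Finset.mem_compl.1 hq)]
      omega
    rw [(hs _).2 this]
    simp
  have hcoeff : ∀ (I : Finset (Fin 4)) (i : Fin n) (e : Fin 4 → ℤ) (q : Fin 4),
      (0 ≤ e q ∧ ∀ p < q, e p < 0) → (u I i).coeff e = if q ∈ I then 0 else
        (-1 : K) ^ ((insert q I).filter (· < q)).card * (s (insert q I) i).coeff e := by
    intro I i e q hq
    simp only [u, AddMonoidAlgebra.coeff_sum, Finsupp.coe_finsetSum, Finset.sum_apply,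
      AddMonoidAlgebra.coeff_smul_apply, coeff_firstNonnegPart, smul_eq_mul]
    split_ifs with hqI
    · refine Finset.sum_eq_zero fun q' hq' => ?_
      rw [if_neg, mul_zero]
      intro h
      rw [firstNonneg_unique hq h] at hqI
      exact Finset.mem_compl.1 hq' hqI
    · rw [Finset.sum_eq_single q]
      · rw [if_pos hq]
      · intro q' _ hne
        rw [if_neg, mul_zero]
        intro h
        exact hne (firstNonneg_unique h hq)
      · intro h
        exact absurd (Finset.mem_compl.2 hqI) h
  refine ⟨u, fun I => ⟨fun hI i _ => ?_, hu0 I⟩, ?_⟩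
  · refine Submodule.sum_mem _ fun q hq => Submodule.smul_mem _ _ fun e he => ?_
    rw [coeff_firstNonnegPart] at he
    have h1 : 0 ≤ e q ∧ ∀ p < q, e p < 0 := by
      by_contra h
      rw [if_neg h] at he
      exact he rfl
    rw [if_pos h1] at he
    have hcard : (insert q I).card = c + 1 := by
      rw [Finset.card_insert_of_notMem (Finset.mem_compl.1 hq), hI]
    have h2 := (hs _).1 hcard i trivial e he
    refine ⟨h2.1, fun p hp => ?_⟩
    by_cases hpq : p = q
    · rw [hpq]; exact h1.1
    · exact h2.2 p (by simp [hpq, hp])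
  · ext1 J
    by_cases hJ : J.card = c + 1
    · ext i e
      rw [cechDiff_apply]
      simp only [Finset.sum_apply, Pi.smul_apply, AddMonoidAlgebra.coeff_sum,
        AddMonoidAlgebra.coeff_smul_apply, Finsupp.coe_finsetSum, smul_eq_mul]
      by_cases hq : ∃ p, 0 ≤ e p
      · obtain ⟨q, hq⟩ := exists_firstNonneg e hq
        by_cases hqJ : q ∈ J
        · rw [Finset.sum_eq_single q]
          · rw [hcoeff _ _ _ q hq, if_neg (Finset.notMem_erase q J), Finset.insert_erase hqJ,
              ← mul_assoc, neg_one_pow_mul_self, one_mul]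
          · intro j _ hj
            rw [hcoeff _ _ _ q hq, if_pos (Finset.mem_erase.2 ⟨hj.symm, hqJ⟩), mul_zero]
          · exact fun h => absurd hqJ h
        -- For `q ∉ J` the coefficient of `s J` is recovered from the cocycle condition on `insert q
        -- J`.
        · have h0 := congrArg (fun x => ((x : Finset (Fin 4) → Fin n → Laurent K)
            (insert q J) i).coeff e) hd
          simp only [cechDiff_apply, Finset.sum_apply, Pi.smul_apply, AddMonoidAlgebra.coeff_sum,
            AddMonoidAlgebra.coeff_smul_apply, Finsupp.coe_finsetSum, smul_eq_mul, Pi.zero_apply,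
            AddMonoidAlgebra.coeff_zero, Finsupp.coe_zero] at h0
          rw [Finset.sum_insert hqJ, Finset.erase_insert hqJ] at h0
          have h1 : ∀ j ∈ J, (-1 : K) ^ (J.filter (· < j)).card * (u (J.erase j) i).coeff e =
              -((-1) ^ ((insert q J).filter (· < q)).card) *
                ((-1) ^ ((insert q J).filter (· < j)).card *
                  (s ((insert q J).erase j) i).coeff e) := by
            intro j hj
            have hjq : j ≠ q := fun h => hqJ (h ▸ hj)
            rw [hcoeff _ _ _ q hq, if_neg (fun h => hqJ (Finset.mem_of_mem_erase h)),
              ← mul_assoc, cech_sign' J q j hqJ hj, Finset.erase_insert_of_ne hjq.symm]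
            ring
          rw [Finset.sum_congr rfl h1, ← Finset.mul_sum, eq_neg_of_add_eq_zero_right h0]
          linear_combination (s J i).coeff e *
            neg_one_pow_mul_self (K := K) ((insert q J).filter (· < q)).card
      -- If all exponents are negative, the monomial lives only over the intersection of all four
      -- open sets, in degree at most `-4`; both alternatives of `hc` exclude it.
      · push Not at hq
        have hz : ∀ I : Finset (Fin 4), (s I i).coeff e = 0 := by
          intro I
          by_cases hI : I.card = c + 1
          · by_contra h
            have h2 := (hs I).1 hI i trivial e h
            have hIuniv : I = Finset.univ := by
              ext p
              simp only [Finset.mem_univ, iff_true]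
              by_contra hp
              exact absurd (h2.2 p hp) (not_le.2 (hq p))
            rcases hc with hc | hc
            · rw [hIuniv] at hI
              simp at hI
              omega
            · have h3 := h2.1
              rw [Fin.sum_univ_four] at h3
              have := hq 0; have := hq 1; have := hq 2; have := hq 3
              omega
          · rw [(hs I).2 hI]; simp
        rw [hz]
        refine Finset.sum_eq_zero fun j _ => ?_
        simp only [u, AddMonoidAlgebra.coeff_sum, Finsupp.coe_finsetSum, Finset.sum_apply,
          AddMonoidAlgebra.coeff_smul_apply, coeff_firstNonnegPart, hz]
        simp
    · rw [(hs J).2 hJ, cechDiff_apply]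
      refine Finset.sum_eq_zero fun j hj => ?_
      rw [hu0, smul_zero]
      rw [Finset.card_erase_of_mem hj]
      have := Finset.card_pos.2 ⟨j, hj⟩
      omega

theorem IsCochain.cechDiff {t : ℤ} {c : ℕ} {s : Finset (Fin 4) → Fin n → Laurent K}
    (hs : IsCochain t c s) : IsCochain t (c + 1) (cechDiff K n s) := by
  intro I
  rw [cechDiff_apply]
  refine ⟨fun hI => Submodule.sum_mem _ fun j hj => Submodule.smul_mem _ _ ?_, fun hI => ?_⟩
  · have : (I.erase j).card = c := by rw [Finset.card_erase_of_mem hj]; omega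
    have h := (hs _).1 this
    exact fun i _ => sec_mono (Finset.erase_subset j I) t (h i trivial)
  · refine Finset.sum_eq_zero fun j hj => ?_
    rw [(hs _).2, smul_zero]
    rw [Finset.card_erase_of_mem hj]
    have := Finset.card_pos.2 ⟨j, hj⟩
    omega

theorem IsCochain.mulMap {t : ℤ} {c : ℕ} (m : Idx a b → K)
    {s : Finset (Fin 4) → Fin b → Laurent K} (hs : IsCochain t c s) :
    IsCochain (t + 1) c fun I => mulMap m (s I) := fun I =>
  ⟨fun h => mulMap_mem m I t _ ((hs I).1 h), fun h => by simp only [(hs I).2 h, map_zero]⟩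

theorem cechDiff_mulMap (m : Idx a b → K) (s : Finset (Fin 4) → Fin b → Laurent K) :
    cechDiff K a (fun I => mulMap m (s I)) = fun I => mulMap m (cechDiff K b s I) := by
  ext1 J
  simp only [cechDiff_apply, map_sum]
  refine Finset.sum_congr rfl fun j _ => ?_
  exact (((mulMap m).restrictScalars K).map_smul _ _).symm

theorem mem_cochains_iff (m : Idx a b → K) (t : ℤ) (i : ℕ)
    (s : Finset (Fin 4) → Fin b → Laurent K) :
    s ∈ cochains m t i ↔ IsCochain t (i + 1) s ∧ ∀ I, mulMap m (s I) = 0 := by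
  constructor
  · intro h
    refine ⟨fun I => ⟨fun hI => ((h I).1 hI).1, (h I).2⟩, fun I => ?_⟩
    by_cases hI : I.card = i + 1
    · exact ((h I).1 hI).2
    · rw [(h I).2 hI, map_zero]
  · rintro ⟨h1, h2⟩ I
    exact ⟨fun hI => ⟨(h1 I).1 hI, h2 I⟩, (h1 I).2⟩

/-! ## Surjectivity on the standard open sets -/

/-- The tuple with the single nonzero entry `x_p`, in position `i`. -/
theorem single_var_mem (I : Finset (Fin 4)) (p : Fin 4) (i : Fin n) :
    (Pi.single i (AddMonoidAlgebra.single (Pi.single p 1) 1) : Fin n → Laurent K) ∈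
      vecSec K n I 1 := by
  intro i' _
  by_cases h : i' = i
  · subst h
    rw [Pi.single_eq_same]
    exact single_mem_sec _ (by simp) fun q _ => (monOne p).2.2 q
  · rw [Pi.single_eq_of_ne h]
    exact Submodule.zero_mem _

theorem inv_var_mem {I : Finset (Fin 4)} {p : Fin 4} (hp : p ∈ I) :
    (AddMonoidAlgebra.single (-Pi.single p 1) 1 : Laurent K) ∈ sec K I (-1) :=
  single_mem_sec _ (by simp) fun q hq => by
    have : q ≠ p := fun h => hq (h ▸ hp)
    simp [this]

/-- Preimages of the vectors `x_p e_i` over one `D₊(x_p)` suffice: combine them linearly with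
coefficients divided by `x_p`. This gives surjectivity in all twists and on all intersections. -/
theorem SheafSurjective.exists_mulMap_eq {m : Idx a b → K} (hm : SheafSurjective m)
    {I : Finset (Fin 4)} (hI : I.Nonempty) {t : ℤ} {w : Fin a → Laurent K}
    (hw : w ∈ vecSec K a I (t + 1)) : ∃ v ∈ vecSec K b I t, mulMap m v = w := by
  obtain ⟨p, hp⟩ := hI
  choose v hv using fun i => hm p ⟨_, single_var_mem {p} p i⟩
  have hv' : ∀ i, mulMap m (v i).1 =
      Pi.single i (AddMonoidAlgebra.single (Pi.single p 1) 1) := fun i => congrArg Subtype.val (hv i)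
  refine ⟨∑ i, (w i * AddMonoidAlgebra.single (-Pi.single p 1) 1) • (v i).1, ?_, ?_⟩
  · refine Submodule.sum_mem _ fun i _ j _ => ?_
    have h1 := mul_mem_sec (mul_mem_sec (hw i trivial) (inv_var_mem (K := K) hp))
      (sec_mono (Finset.singleton_subset_iff.2 hp) 0 ((v i).2 j trivial))
    simpa using h1
  · rw [map_sum]
    simp only [map_smul, hv']
    ext1 i
    rw [Finset.sum_apply, Finset.sum_eq_single i]
    · simp only [Pi.smul_apply, Pi.single_eq_same, smul_eq_mul, mul_assoc,
        AddMonoidAlgebra.single_mul_single, neg_add_cancel, mul_one]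
      rw [← AddMonoidAlgebra.one_def, mul_one]
    · intro j _ hj
      simp [Pi.single_eq_of_ne hj.symm]
    · simp

theorem SheafSurjective.exists_cochain {m : Idx a b → K} (hm : SheafSurjective m) {t : ℤ} {c : ℕ}
    {w : Finset (Fin 4) → Fin a → Laurent K} (hw : IsCochain (t + 1) (c + 1) w) :
    ∃ v : Finset (Fin 4) → Fin b → Laurent K, IsCochain t (c + 1) v ∧
      (fun I => mulMap m (v I)) = w := by
  have : ∀ I : Finset (Fin 4), ∃ v : Fin b → Laurent K,
      (I.card = c + 1 → v ∈ vecSec K b I t) ∧ (I.card ≠ c + 1 → v = 0) ∧ mulMap m v = w I := by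
    intro I
    by_cases hI : I.card = c + 1
    · obtain ⟨v, hv, h⟩ := hm.exists_mulMap_eq
        (Finset.card_pos.1 (by omega : 0 < I.card)) ((hw I).1 hI)
      exact ⟨v, fun _ => hv, fun h' => absurd hI h', h⟩
    · exact ⟨0, fun h' => absurd h' hI, fun _ => rfl, by rw [(hw I).2 hI, map_zero]⟩
  choose v hv using this
  exact ⟨v, fun I => ⟨(hv I).1, (hv I).2.1⟩, funext fun I => (hv I).2.2⟩

/-! ## Cohomology of the kernel sheaf -/

theorem subsingleton_H_of_le (m : Idx a b → K) (t : ℤ) (i : ℕ)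
    (h : cocycles m t i ≤ coboundaries m t i) : Subsingleton (H m t i) :=
  Submodule.Quotient.subsingleton_iff.2 (Submodule.submoduleOf_eq_top.2 h)

theorem subsingleton_H_of_four_le (m : Idx a b → K) (t : ℤ) {i : ℕ} (hi : 4 ≤ i) :
    Subsingleton (H m t i) := by
  refine subsingleton_H_of_le m t i fun s hs => ?_
  have : s = 0 := by
    ext1 I
    refine (hs.1 I).2 ?_
    have := I.card_le_univ
    simp at this
    omega
  rw [this]
  exact Submodule.zero_mem _

/-- The diagram chase of the long exact sequence: a cocycle of `E(t)` is `δu` in `b.𝒪(t)`; the image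
of `u` is a cocycle of `a.𝒪(t + 1)`, hence `δw`; correcting `u` by a lift of `w` brings it into
`E(t)`. The hypothesis on `t` is needed only for `H³`. -/
theorem subsingleton_H_add_two {m : Idx a b → K} (hm : SheafSurjective m) (t : ℤ) (i : ℕ)
    (hi : i = 0 ∨ -3 ≤ t) : Subsingleton (H m t (i + 2)) := by
  rcases Nat.lt_or_ge i 2 with hi2 | hi2
  swap
  · exact subsingleton_H_of_four_le m t (by omega)
  refine subsingleton_H_of_le m t (i + 2) fun s hs => ?_
  obtain ⟨h1, h2⟩ := (mem_cochains_iff m t _ s).1 hs.1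
  obtain ⟨u, hu, hus⟩ := exists_cechDiff_eq (c := i + 2)
    (hi.imp (fun h => by omega) id) h1 (LinearMap.mem_ker.1 hs.2)
  have h3 : cechDiff K a (fun I => mulMap m (u I)) = 0 := by
    rw [cechDiff_mulMap, hus]
    exact funext h2
  obtain ⟨w, hw, hwu⟩ := exists_cechDiff_eq (c := i + 1) (Or.inl (by omega)) (hu.mulMap m) h3
  obtain ⟨v, hv, hvw⟩ := hm.exists_cochain hw
  refine ⟨u - cechDiff K b v, (mem_cochains_iff m t _ _).2 ⟨fun I => ⟨fun hI => ?_, fun hI => ?_⟩,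
    fun I => ?_⟩, ?_⟩
  · exact Submodule.sub_mem _ ((hu I).1 hI) ((hv.cechDiff I).1 hI)
  · rw [Pi.sub_apply, (hu I).2 hI, (hv.cechDiff I).2 hI, sub_zero]
  · have h4 := congrFun (cechDiff_mulMap m v) I
    rw [hvw, hwu] at h4
    rw [Pi.sub_apply, map_sub, ← h4, sub_self]
  · rw [map_sub, cechDiff_cechDiff, sub_zero, hus]

/-- The family of sections over the standard open sets defined by a global section. -/
def augment (K : Type u) [Field K] (n : ℕ) :
    (Fin n → Laurent K) →ₗ[K] (Finset (Fin 4) → Fin n → Laurent K) :=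
  LinearMap.pi fun I => if I.card = 1 then LinearMap.id else 0

theorem augment_apply (v : Fin n → Laurent K) (I : Finset (Fin 4)) :
    augment K n v I = if I.card = 1 then v else 0 := by
  simp only [augment, LinearMap.pi_apply]
  split_ifs <;> rfl

theorem isCochain_augment {t : ℤ} {v : Fin n → Laurent K} (hv : v ∈ vecSec K n ∅ t) :
    IsCochain t 1 (augment K n v) := fun I =>
  ⟨fun h => by
    rw [augment_apply, if_pos h]
    exact fun i _ => sec_mono (Finset.empty_subset I) t (hv i trivial),
  fun h => by rw [augment_apply, if_neg h]⟩

theorem cechDiff_of_isCochain_zero {t : ℤ} {u : Finset (Fin 4) → Fin n → Laurent K}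
    (hu : IsCochain t 0 u) : cechDiff K n u = augment K n (u ∅) := by
  ext1 J
  rw [cechDiff_apply, augment_apply]
  split_ifs with h
  · obtain ⟨p, rfl⟩ := Finset.card_eq_one.1 h
    simp [Finset.filter_singleton]
  · refine Finset.sum_eq_zero fun j hj => ?_
    rw [(hu _).2, smul_zero]
    rw [Finset.card_erase_of_mem hj]
    have := Finset.card_pos.2 ⟨j, hj⟩
    omega

/-- A constant family is the coboundary of a cochain supported on `∅`, so this is `δ² = 0` in the
augmented complex. -/
theorem cechDiff_augment (v : Fin n → Laurent K) : cechDiff K n (augment K n v) = 0 := by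
  let u : Finset (Fin 4) → Fin n → Laurent K := fun I => if I = ∅ then v else 0
  have : cechDiff K n u = augment K n v := by
    ext1 J
    rw [cechDiff_apply, augment_apply]
    split_ifs with h
    · obtain ⟨p, rfl⟩ := Finset.card_eq_one.1 h
      simp [Finset.filter_singleton, u]
    · refine Finset.sum_eq_zero fun j hj => ?_
      have : J.erase j ≠ ∅ := by
        intro h'
        have h2 := Finset.card_erase_of_mem hj
        have := Finset.card_pos.2 ⟨j, hj⟩
        rw [h', Finset.card_empty] at h2
        omega
      simp [u, this]
  rw [← this, cechDiff_cechDiff]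

theorem exists_augment_eq {t : ℤ} {s : Finset (Fin 4) → Fin n → Laurent K} (hs : IsCochain t 1 s)
    (hd : cechDiff K n s = 0) : ∃ v ∈ vecSec K n ∅ t, augment K n v = s := by
  obtain ⟨u, hu, rfl⟩ := exists_cechDiff_eq (c := 0) (Or.inl (by omega)) hs hd
  exact ⟨u ∅, (hu ∅).1 rfl, (cechDiff_of_isCochain_zero hu).symm⟩

theorem augment_injective : Function.Injective (augment K n) := by
  intro v w h
  have := congrFun h {0}
  simpa [augment_apply] using this

theorem cocycles_zero_eq (m : Idx a b → K) (t : ℤ) :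
    cocycles m t 0 = ((LinearMap.ker (mulOn m ∅ t)).map (vecSec K b ∅ t).subtype).map
      (augment K b) := by
  ext s
  constructor
  · intro hs
    obtain ⟨h1, h2⟩ := (mem_cochains_iff m t _ s).1 hs.1
    obtain ⟨v, hv, rfl⟩ := exists_augment_eq h1 (LinearMap.mem_ker.1 hs.2)
    refine ⟨v, ⟨⟨v, hv⟩, ?_, rfl⟩, rfl⟩
    have := h2 {0}
    rw [augment_apply, if_pos (by simp)] at this
    exact Subtype.ext this
  · rintro ⟨_, ⟨v, hv, rfl⟩, rfl⟩
    refine ⟨(mem_cochains_iff m t _ _).2 ⟨isCochain_augment v.2, fun I => ?_⟩,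
      LinearMap.mem_ker.2 (cechDiff_augment _)⟩
    rw [augment_apply]
    split_ifs
    · exact congrArg Subtype.val (LinearMap.mem_ker.1 hv)
    · exact map_zero _

theorem finrank_H_zero (m : Idx a b → K) (t : ℤ) :
    Module.finrank K (H m t 0) = Module.finrank K (LinearMap.ker (mulOn m ∅ t)) := by
  have h1 : (coboundaries m t 0).submoduleOf (cocycles m t 0) = ⊥ := by
    change (⊥ : Submodule K _).submoduleOf (cocycles m t 0) = ⊥
    rw [Submodule.submoduleOf, Submodule.comap_bot, Submodule.ker_subtype]
  rw [(Submodule.quotEquivOfEqBot _ h1).finrank_eq, cocycles_zero_eq,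
    ← (Submodule.equivMapOfInjective _ augment_injective _).finrank_eq,
    ← (Submodule.equivMapOfInjective _ (Submodule.injective_subtype _) _).finrank_eq]

theorem subsingleton_H_zero {m : Idx a b → K} {t : ℤ} (h : Function.Injective (mulOn m ∅ t)) :
    Subsingleton (H m t 0) := by
  refine subsingleton_H_of_le m t 0 ?_
  rw [cocycles_zero_eq, LinearMap.ker_eq_bot.2 h, Submodule.map_bot, Submodule.map_bot]
  exact bot_le

/-- The cochains of degree zero of `b.𝒪(t)` whose image in `a.𝒪(t + 1)` is a global section. -/
def liftCochains (m : Idx a b → K) (t : ℤ) : Submodule K (Finset (Fin 4) → Fin b → Laurent K) where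
  carrier := {u | IsCochain t 1 u ∧ cechDiff K a (fun I => mulMap m (u I)) = 0}
  zero_mem' := ⟨fun I => ⟨fun _ => Submodule.zero_mem _, fun _ => rfl⟩, by
    simp only [Pi.zero_apply, map_zero]
    exact map_zero _⟩
  add_mem' := fun {u v} hu hv =>
    ⟨fun I => ⟨fun h => Submodule.add_mem _ ((hu.1 I).1 h) ((hv.1 I).1 h),
      fun h => by rw [Pi.add_apply, (hu.1 I).2 h, (hv.1 I).2 h, add_zero]⟩, by
      have h1 : (fun I => mulMap m ((u + v) I)) =
        (fun I => mulMap m (u I)) + fun I => mulMap m (v I) := funext fun I => map_add _ _ _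
      rw [h1, map_add, hu.2, hv.2, add_zero]⟩
  smul_mem' := fun c u hu =>
    ⟨fun I => ⟨fun h => Submodule.smul_mem _ c ((hu.1 I).1 h),
      fun h => by rw [Pi.smul_apply, (hu.1 I).2 h, smul_zero]⟩, by
      have h1 : (fun I => mulMap m ((c • u) I)) = c • (fun I => mulMap m (u I)) :=
        funext fun I => ((mulMap m).restrictScalars K).map_smul c (u I)
      rw [h1, map_smul, hu.2, smul_zero]⟩

theorem exists_augment_eq_mulMap {m : Idx a b → K} {t : ℤ}
    {u : Finset (Fin 4) → Fin b → Laurent K} (hu : u ∈ liftCochains m t) :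
    ∃ w ∈ vecSec K a ∅ (t + 1), augment K a w = fun I => mulMap m (u I) :=
  exists_augment_eq (hu.1.mulMap m) hu.2

/-- The global section of `a.𝒪(t + 1)` attached to an element of `liftCochains m t`. -/
def liftCochains.toSec (m : Idx a b → K) (t : ℤ) :
    liftCochains m t →ₗ[K] vecSec K a ∅ (t + 1) :=
  LinearMap.codRestrict _ (((mulMap m).restrictScalars K ∘ₗ LinearMap.proj {0}) ∘ₗ
    (liftCochains m t).subtype) fun u => by
      obtain ⟨w, hw, h⟩ := exists_augment_eq_mulMap u.2
      have := congrFun h {0}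
      rw [augment_apply, if_pos (by simp)] at this
      change mulMap m (u.1 {0}) ∈ _
      rwa [← this]

theorem liftCochains.augment_toSec (m : Idx a b → K) (t : ℤ) (u : liftCochains m t) :
    augment K a (liftCochains.toSec m t u).1 = fun I => mulMap m (u.1 I) := by
  obtain ⟨w, hw, h⟩ := exists_augment_eq_mulMap u.2
  have := congrFun h {0}
  rw [augment_apply, if_pos (by simp)] at this
  have h2 : (liftCochains.toSec m t u).1 = w := this.symm
  rw [h2, h]

theorem cechDiff_mem_cocycles {m : Idx a b → K} {t : ℤ}
    {u : Finset (Fin 4) → Fin b → Laurent K} (hu : u ∈ liftCochains m t) :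
    cechDiff K b u ∈ cocycles m t 1 := by
  refine ⟨(mem_cochains_iff m t _ _).2 ⟨hu.1.cechDiff, fun I => ?_⟩,
    LinearMap.mem_ker.2 (cechDiff_cechDiff u)⟩
  have := congrFun (cechDiff_mulMap m u) I
  rw [hu.2] at this
  exact this.symm

/-- The connecting map as a correspondence: `liftCochains` maps onto `H¹(E(t))` because `H¹(b.𝒪(t))
= 0`, and onto the cokernel of `m(t)` because `m` is surjective on the standard open sets. The two
kernels agree: both consist of the sums of a cochain of `E(t)` and a global section of `b.𝒪(t)`. -/
theorem finrank_H_one {m : Idx a b → K} (hm : SheafSurjective m) (t : ℤ) :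
    Module.finrank K (H m t 1) =
      Module.finrank K (vecSec K a ∅ (t + 1) ⧸ LinearMap.range (mulOn m ∅ t)) := by
  let f : liftCochains m t →ₗ[K] H m t 1 := Submodule.mkQ _ ∘ₗ
    (cechDiff K b).restrict (p := liftCochains m t) (q := cocycles m t 1)
      fun u hu => cechDiff_mem_cocycles hu
  let g : liftCochains m t →ₗ[K] (vecSec K a ∅ (t + 1) ⧸ LinearMap.range (mulOn m ∅ t)) :=
    Submodule.mkQ _ ∘ₗ liftCochains.toSec m t
  have hf : Function.Surjective f := by
    refine (Submodule.mkQ_surjective _).comp fun s => ?_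
    obtain ⟨h1, h2⟩ := (mem_cochains_iff m t _ s.1).1 s.2.1
    obtain ⟨u, hu, hus⟩ := exists_cechDiff_eq (c := 1) (Or.inl (by omega)) h1
      (LinearMap.mem_ker.1 s.2.2)
    refine ⟨⟨u, hu, ?_⟩, Subtype.ext hus⟩
    rw [cechDiff_mulMap, hus]
    exact funext h2
  have hg : Function.Surjective g := by
    refine (Submodule.mkQ_surjective _).comp fun w => ?_
    obtain ⟨v, hv, hvw⟩ := hm.exists_cochain (c := 0) (isCochain_augment w.2)
    have hmem : v ∈ liftCochains m t := ⟨hv, by rw [hvw, cechDiff_augment]⟩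
    refine ⟨⟨v, hmem⟩, Subtype.ext (augment_injective ?_)⟩
    rw [liftCochains.augment_toSec, ← hvw]
  have hker : LinearMap.ker f = LinearMap.ker g := by
    ext u
    have e1 : u ∈ LinearMap.ker f ↔ ∃ u' ∈ cochains m t 0, cechDiff K b u' = cechDiff K b u.1 := by
      rw [LinearMap.mem_ker]
      change (Submodule.mkQ _) _ = 0 ↔ _
      rw [Submodule.mkQ_apply, Submodule.Quotient.mk_eq_zero]
      exact Iff.rfl
    have e2 : u ∈ LinearMap.ker g ↔ ∃ v : vecSec K b ∅ t, mulMap m v.1 =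
        (liftCochains.toSec m t u).1 := by
      rw [LinearMap.mem_ker]
      change (Submodule.mkQ _) _ = 0 ↔ _
      rw [Submodule.mkQ_apply, Submodule.Quotient.mk_eq_zero, LinearMap.mem_range]
      exact exists_congr fun v => Subtype.ext_iff
    have e3 : ∀ v : Fin b → Laurent K, (fun I => mulMap m (augment K b v I)) =
        augment K a (mulMap m v) := by
      intro v
      ext1 I
      simp only [augment_apply]
      split_ifs
      · rfl
      · exact map_zero _
    rw [e1, e2]
    constructor
    · rintro ⟨u', hu', h⟩
      obtain ⟨h1, h2⟩ := (mem_cochains_iff m t _ u').1 hu'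
      have hc : IsCochain t 1 (u.1 - u') := fun I =>
        ⟨fun hI => Submodule.sub_mem _ ((u.2.1 I).1 hI) ((h1 I).1 hI),
          fun hI => by rw [Pi.sub_apply, (u.2.1 I).2 hI, (h1 I).2 hI, sub_zero]⟩
      obtain ⟨v, hv, hvu⟩ := exists_augment_eq hc (by rw [map_sub, h, sub_self])
      refine ⟨⟨v, hv⟩, augment_injective ?_⟩
      rw [liftCochains.augment_toSec, ← e3, hvu]
      ext1 I
      rw [Pi.sub_apply, map_sub, h2, sub_zero]
    · rintro ⟨v, hv⟩
      refine ⟨u.1 - augment K b v.1, (mem_cochains_iff m t _ _).2 ⟨fun I => ⟨fun hI => ?_,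
        fun hI => ?_⟩, fun I => ?_⟩, ?_⟩
      · exact Submodule.sub_mem _ ((u.2.1 I).1 hI) ((isCochain_augment v.2 I).1 hI)
      · rw [Pi.sub_apply, (u.2.1 I).2 hI, (isCochain_augment v.2 I).2 hI, sub_zero]
      · have h1 := congrFun (liftCochains.augment_toSec m t u) I
        have h2 := congrFun (e3 v.1) I
        rw [hv, h1] at h2
        rw [Pi.sub_apply, map_sub, h2, sub_self]
      · rw [map_sub, cechDiff_augment, sub_zero]
  exact ((f.quotKerEquivOfSurjective hf).symm ≪≫ₗ Submodule.quotEquivOfEq _ _ hker ≪≫ₗ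
    g.quotKerEquivOfSurjective hg).finrank_eq

/-- Not read off from `finrank_H_one`, since `finrank` also vanishes on infinite-dimensional spaces;
the same chase works without surjectivity of the sheaf morphism. -/
theorem subsingleton_H_one {m : Idx a b → K} {t : ℤ}
    (h : Function.Surjective (mulOn m ∅ t)) : Subsingleton (H m t 1) := by
  refine subsingleton_H_of_le m t 1 fun s hs => ?_
  obtain ⟨h1, h2⟩ := (mem_cochains_iff m t _ s).1 hs.1
  obtain ⟨u, hu, hus⟩ := exists_cechDiff_eq (c := 1) (Or.inl (by omega)) h1
    (LinearMap.mem_ker.1 hs.2)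
  have h3 : cechDiff K a (fun I => mulMap m (u I)) = 0 := by
    rw [cechDiff_mulMap, hus]
    exact funext h2
  obtain ⟨w, hw, hwu⟩ := exists_augment_eq (hu.mulMap m) h3
  obtain ⟨v, hv⟩ := h ⟨w, hw⟩
  have hv' : mulMap m v.1 = w := congrArg Subtype.val hv
  refine ⟨u - augment K b v.1, (mem_cochains_iff m t _ _).2 ⟨fun I => ⟨fun hI => ?_, fun hI => ?_⟩,
    fun I => ?_⟩, ?_⟩
  · exact Submodule.sub_mem _ ((hu I).1 hI) ((isCochain_augment v.2 I).1 hI)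
  · rw [Pi.sub_apply, (hu I).2 hI, (isCochain_augment v.2 I).2 hI, sub_zero]
  · have h4 := congrFun hwu I
    rw [augment_apply] at h4
    rw [Pi.sub_apply, map_sub, ← h4, augment_apply]
    split_ifs
    · rw [hv', sub_self]
    · rw [map_zero, sub_self]
  · rw [map_sub, cechDiff_augment, sub_zero, hus]

end Steiner

end

noncomputable section

namespace Steiner

variable {K : Type u} [Field K] {a b n : ℕ}

/-! ## Surjectivity of the sheaf morphism and of `m(d)` for large `d` -/

theorem single_mem_vecSec {I : Finset (Fin 4)} {t : ℤ} {x : Laurent K} (hx : x ∈ sec K I t)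
    (i : Fin n) : (Pi.single i x : Fin n → Laurent K) ∈ vecSec K n I t := by
  intro i' _
  by_cases h : i' = i
  · subst h
    rwa [Pi.single_eq_same]
  · rw [Pi.single_eq_of_ne h]
    exact Submodule.zero_mem _

theorem var_pow_mem (I : Finset (Fin 4)) (p : Fin 4) (d : ℕ) :
    (AddMonoidAlgebra.single (Pi.single p (d : ℤ)) 1 : Laurent K) ∈ sec K I d :=
  single_mem_sec _ (by simp) fun q _ => by
    by_cases h : q = p
    · subst h; simp
    · simp [h]

theorem var_pow_inv_mem {I : Finset (Fin 4)} {p : Fin 4} (hp : p ∈ I) (d : ℕ) :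
    (AddMonoidAlgebra.single (-Pi.single p (d : ℤ)) 1 : Laurent K) ∈ sec K I (-d) :=
  single_mem_sec _ (by simp) fun q hq => by
    have : q ≠ p := fun h => hq (h ▸ hp)
    simp [this]

/-- On `D₊(x_p)`, divide preimages of `x_p^{d+1} e_i` by `x_p^{d+1}`. -/
theorem sheafSurjective_of_surjective {m : Idx a b → K} {d : ℕ}
    (hm : Function.Surjective (mDeg m d)) : SheafSurjective m := by
  intro p w
  have hmem (i : Fin a) : (Pi.single i (AddMonoidAlgebra.single (Pi.single p ((d + 1 : ℕ) : ℤ)) 1) :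
      Fin a → Laurent K) ∈ vecSec K a ∅ ((d : ℤ) + 1) := by
    have := single_mem_vecSec (var_pow_mem (K := K) ∅ p (d + 1)) i
    rwa [Nat.cast_succ] at this
  choose v hv using fun i => hm ⟨_, hmem i⟩
  have hv' : ∀ i, mulMap m (v i).1 =
      Pi.single i (AddMonoidAlgebra.single (Pi.single p ((d + 1 : ℕ) : ℤ)) 1) :=
    fun i => congrArg Subtype.val (hv i)
  refine ⟨⟨∑ i, (w.1 i * AddMonoidAlgebra.single (-Pi.single p ((d + 1 : ℕ) : ℤ)) 1) • (v i).1,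
    ?_⟩, Subtype.ext ?_⟩
  · refine Submodule.sum_mem _ fun i _ j _ => ?_
    have h1 := mul_mem_sec (mul_mem_sec (w.2 i trivial)
      (var_pow_inv_mem (K := K) (Finset.mem_singleton_self p) (d + 1)))
      (sec_mono (Finset.empty_subset _) _ ((v i).2 j trivial))
    have h2 : (0 : ℤ) + 1 + -((d + 1 : ℕ) : ℤ) + d = 0 := by push_cast; ring
    rw [h2] at h1
    exact h1
  · change mulMap m _ = w.1
    rw [Submodule.subtype_apply, map_sum]
    simp only [map_smul, hv']
    ext1 i
    rw [Finset.sum_apply, Finset.sum_eq_single i]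
    · simp only [Pi.smul_apply, Pi.single_eq_same, smul_eq_mul, mul_assoc,
        AddMonoidAlgebra.single_mul_single, neg_add_cancel, mul_one]
      rw [← AddMonoidAlgebra.one_def, mul_one]
    · intro j _ hj
      simp [Pi.single_eq_of_ne hj.symm]
    · simp

theorem exists_pow_mul_mem {p : Fin 4} {s : Laurent K} (hs : s ∈ sec K {p} 0) :
    ∃ N : ℕ, ∀ d : ℕ, N ≤ d →
      AddMonoidAlgebra.single (Pi.single p (d : ℤ)) 1 * s ∈ sec K ∅ (d : ℤ) := by
  -- A crude bound on the pole order along `x_p`. The claim for every larger exponent allows a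
  -- common exponent to be taken later.
  refine ⟨∑ e ∈ s.coeff.support, (e p).natAbs, fun d hd e he => ?_⟩
  have h1 := mul_mem_sec (var_pow_mem (K := K) {p} p d) hs e he
  rw [add_zero] at h1
  refine ⟨h1.1, fun q _ => ?_⟩
  by_cases hq : q = p
  · subst hq
    rw [AddMonoidAlgebra.coeff_single_mul_apply, one_mul] at he
    have h2 := Finset.single_le_sum (f := fun e : Fin 4 → ℤ => (e q).natAbs)
      (fun _ _ => Nat.zero_le _) (Finsupp.mem_support_iff.2 he)
    simp only [Pi.add_apply, Pi.neg_apply, Pi.single_eq_same] at h2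
    omega
  · exact h1.2 q (by simpa using hq)

theorem surjective_mulOn_of_monomials {m : Idx a b → K} {t : ℤ}
    (hm : ∀ (i : Fin a) (e : Mon (t + 1)), ∃ u ∈ vecSec K b ∅ t,
      mulMap m u = Pi.single i (AddMonoidAlgebra.single e.1 1)) :
    Function.Surjective (mulOn m ∅ t) := by
  choose u hu hmu using hm
  refine fun w => ⟨⟨∑ x : Fin a × Mon (t + 1),
    ((w.1 x.1).coeff x.2.1) • u x.1 x.2, Submodule.sum_mem _ fun x _ =>
      Submodule.smul_mem _ _ (hu x.1 x.2)⟩, Subtype.ext ?_⟩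
  change ((mulMap m).restrictScalars K) _ = w.1
  rw [Submodule.subtype_apply, map_sum]
  simp only [map_smul, LinearMap.restrictScalars_apply, hmu]
  ext i e
  rw [← sum_coeff_mon (w.2 i trivial) e, Fintype.sum_prod_type, Finset.sum_apply,
    Finset.sum_eq_single i]
  · simp only [Finset.sum_apply, Pi.smul_apply, Pi.single_eq_same, AddMonoidAlgebra.coeff_sum,
      Finsupp.coe_finsetSum, AddMonoidAlgebra.coeff_smul_apply, AddMonoidAlgebra.coeff_single,
      Finsupp.single_apply, smul_eq_mul, mul_ite, mul_one, mul_zero]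
    exact Finset.sum_congr rfl fun e' _ => by simp only [eq_comm]
  · intro i' _ hi'
    simp [Finset.sum_apply, Pi.single_eq_of_ne hi'.symm]
  · simp

/-- After clearing denominators with one exponent `D`, every `x_p^{D+1} e_i` has a polynomial
preimage. Together with the converse above, this turns surjectivity of the sheaf morphism into a
rank condition, which passes to generizations. -/
theorem SheafSurjective.exists_surjective {m : Idx a b → K} (hm : SheafSurjective m) :
    ∃ d : ℕ, Function.Surjective (mDeg m d) := by
  choose v hv using fun (p : Fin 4) (i : Fin a) => hm p ⟨_, single_var_mem {p} p i⟩
  have hv' : ∀ p i, mulMap m (v p i).1 =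
      Pi.single i (AddMonoidAlgebra.single (Pi.single p 1) 1) :=
    fun p i => congrArg Subtype.val (hv p i)
  choose N hN using fun (p : Fin 4) (i : Fin a) (j : Fin b) =>
    exists_pow_mul_mem ((v p i).2 j trivial)
  obtain ⟨D, hD⟩ : ∃ D, ∀ p i j, N p i j ≤ D :=
    ⟨∑ p, ∑ i, ∑ j, N p i j, fun p i j =>
      (Finset.single_le_sum (f := fun j => N p i j) (fun _ _ => Nat.zero_le _)
        (Finset.mem_univ j)).trans <|
      (Finset.single_le_sum (f := fun i => ∑ j, N p i j) (fun _ _ => Nat.zero_le _)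
        (Finset.mem_univ i)).trans <|
      Finset.single_le_sum (f := fun p => ∑ i, ∑ j, N p i j) (fun _ _ => Nat.zero_le _)
        (Finset.mem_univ p)⟩
  have key : ∀ (i : Fin a) (e : Mon (((4 * D : ℕ) : ℤ) + 1)), ∃ u ∈ vecSec K b ∅ ((4 * D : ℕ) : ℤ),
      mulMap m u = Pi.single i (AddMonoidAlgebra.single e.1 1) := by
    intro i e
    -- Pigeonhole: four exponents with sum `4D + 1` cannot all be at most `D`.
    have : ∃ p, (D : ℤ) + 1 ≤ e.1 p := by
      by_contra! h
      have h0 := e.2.1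
      rw [Fin.sum_univ_four] at h0
      have := h 0; have := h 1; have := h 2; have := h 3
      push_cast at h0
      omega
    obtain ⟨p, hp⟩ := this
    have hmono : (AddMonoidAlgebra.single (e.1 - Pi.single p ((D : ℤ) + 1)) 1 : Laurent K) ∈
        sec K ∅ (3 * (D : ℤ)) := by
      refine single_mem_sec _ ?_ fun q _ => ?_
      · simp only [Pi.sub_apply, Finset.sum_sub_distrib, e.2.1]
        simp
        ring
      · by_cases h : q = p
        · subst h; simpa using hp
        · simpa [h] using e.2.2 q
    refine ⟨(AddMonoidAlgebra.single (e.1 - Pi.single p ((D : ℤ) + 1)) 1 : Laurent K) •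
      (AddMonoidAlgebra.single (Pi.single p (D : ℤ)) 1 : Laurent K) • (v p i).1, fun j _ => ?_, ?_⟩
    · have := mul_mem_sec hmono (hN p i j D (hD p i j))
      rw [show 3 * (D : ℤ) + D = ((4 * D : ℕ) : ℤ) by push_cast; ring] at this
      exact this
    · rw [map_smul, map_smul, hv']
      ext1 i'
      by_cases h : i' = i
      · subst h
        simp only [Pi.smul_apply, Pi.single_eq_same, smul_eq_mul,
          AddMonoidAlgebra.single_mul_single, mul_one]
        congr 1
        rw [← Pi.single_add, sub_add_cancel]
      · simp [Pi.single_eq_of_ne h]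
  exact ⟨4 * D, surjective_mulOn_of_monomials key⟩

/-- If `m(d)` is surjective for some `d ≥ 0`, so is `m(d + 1)`. -/
theorem surjective_mulOn_succ {m : Idx a b → K} {t : ℤ} (ht : 0 ≤ t)
    (hm : Function.Surjective (mulOn m ∅ t)) : Function.Surjective (mulOn m ∅ (t + 1)) := by
  have key : ∀ (i : Fin a) (e : Mon (t + 1 + 1)), ∃ u ∈ vecSec K b ∅ (t + 1),
      mulMap m u = Pi.single i (AddMonoidAlgebra.single e.1 1) := by
    intro i e
    obtain ⟨p, e', he⟩ := exists_eq_add_single e (by omega)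
    obtain ⟨v, hv⟩ := hm ⟨Pi.single i (AddMonoidAlgebra.single e'.1 1),
      single_mem_vecSec (single_mem_sec _ e'.2.1 fun p _ => e'.2.2 p) i⟩
    have hv' : mulMap m v.1 = Pi.single i (AddMonoidAlgebra.single e'.1 1) := congrArg Subtype.val hv
    refine ⟨(AddMonoidAlgebra.single (Pi.single p 1) 1 : Laurent K) • v.1, fun j _ => ?_, ?_⟩
    · have := mul_mem_sec (single_mem_sec (K := K) (I := ∅) 1 (monOne p).2.1
        fun q _ => (monOne p).2.2 q) (v.2 j trivial)
      rw [add_comm] at this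
      exact this
    · rw [map_smul, hv']
      ext1 i'
      by_cases h : i' = i
      · subst h
        simp only [Pi.smul_apply, Pi.single_eq_same, smul_eq_mul,
          AddMonoidAlgebra.single_mul_single, mul_one]
        rw [he, add_comm]
      · simp [Pi.single_eq_of_ne h]
  exact surjective_mulOn_of_monomials key

theorem surjective_mDeg_of_le {m : Idx a b → K} {d d' : ℕ} (h : d ≤ d')
    (hm : Function.Surjective (mDeg m d)) : Function.Surjective (mDeg m d') := by
  induction d', h using Nat.le_induction with
  | base => exact hm
  | succ n _ ih =>
    have := surjective_mulOn_succ (Int.natCast_nonneg n) ih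
    rwa [← Nat.cast_succ] at this

/-! ## Local freeness -/

/-- The map `coordRing^b → coordRing^a` given by `m` and the trivialization of `𝒪(1)` by `x_p`. -/
def localMap (m : Idx a b → K) (p : Fin 4) :
    (Fin b → coordRing K {p}) →ₗ[coordRing K {p}] (Fin a → coordRing K {p}) where
  toFun v i := ⟨mulMap m (fun j => (v j : Laurent K)) i *
    AddMonoidAlgebra.single (-Pi.single p 1) 1, by
      have h := mul_mem_sec (mulMap_mem m {p} 0 _ (fun j _ => (v j).2) i trivial)
        (inv_var_mem (K := K) (Finset.mem_singleton_self p))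
      rwa [show (0 : ℤ) + 1 + -1 = 0 by norm_num] at h⟩
  map_add' v w := by
    ext1 i
    refine Subtype.ext ?_
    change mulMap m ((fun j => (v j : Laurent K)) + fun j => (w j : Laurent K)) i * _ =
      mulMap m _ i * _ + mulMap m _ i * _
    rw [map_add, Pi.add_apply, add_mul]
  map_smul' c v := by
    ext1 i
    refine Subtype.ext ?_
    change mulMap m ((c : Laurent K) • fun j => (v j : Laurent K)) i * _ =
      (c : Laurent K) * (mulMap m _ i * _)
    rw [map_smul, Pi.smul_apply, smul_eq_mul, mul_assoc]

theorem localMap_apply (m : Idx a b → K) (p : Fin 4) (v : Fin b → coordRing K {p}) (i : Fin a) :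
    (localMap m p v i : Laurent K) = mulMap m (fun j => (v j : Laurent K)) i *
      AddMonoidAlgebra.single (-Pi.single p 1) 1 := rfl

theorem var_mul_inv (p : Fin 4) : (AddMonoidAlgebra.single (Pi.single p 1) 1 : Laurent K) *
    AddMonoidAlgebra.single (-Pi.single p 1) 1 = 1 := by
  rw [AddMonoidAlgebra.single_mul_single, add_neg_cancel, mul_one, AddMonoidAlgebra.one_def]

theorem localMap_surjective {m : Idx a b → K} (hm : SheafSurjective m) (p : Fin 4) :
    Function.Surjective (localMap m p) := by
  intro w
  obtain ⟨v, hv⟩ := hm p ⟨fun i => (w i : Laurent K) * AddMonoidAlgebra.single (Pi.single p 1) 1,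
    fun i _ => mul_mem_sec (w i).2 (single_mem_sec (K := K) 1 (monOne p).2.1
      fun q _ => (monOne p).2.2 q)⟩
  have hv' : mulMap m v.1 = fun i => (w i : Laurent K) *
    AddMonoidAlgebra.single (Pi.single p 1) 1 := congrArg Subtype.val hv
  refine ⟨fun j => ⟨v.1 j, v.2 j trivial⟩, ?_⟩
  ext1 i
  refine Subtype.ext ?_
  rw [localMap_apply]
  change mulMap m v.1 i * _ = _
  rw [hv', mul_assoc, var_mul_inv, mul_one]

/-- The inclusion of the sections of the kernel sheaf over `D₊(x_p)` in `coordRing^b`. -/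
def kerSecIncl (m : Idx a b → K) (p : Fin 4) :
    kerSec m {p} 0 →ₗ[coordRing K {p}] (Fin b → coordRing K {p}) where
  toFun v j := ⟨v.1 j, v.2.1 j trivial⟩
  map_add' _ _ := rfl
  map_smul' _ _ := rfl

theorem exact_kerSecIncl (m : Idx a b → K) (p : Fin 4) :
    Function.Exact (kerSecIncl m p) (localMap m p) := by
  intro v
  constructor
  · intro hv
    refine ⟨⟨fun j => (v j : Laurent K), fun j _ => (v j).2, ?_⟩, rfl⟩
    ext1 i
    have h := congrArg Subtype.val (congrFun hv i)
    rw [localMap_apply] at h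
    change _ = (0 : Laurent K) at h
    have h2 := congrArg (· * (AddMonoidAlgebra.single (Pi.single p 1) 1 : Laurent K)) h
    simp only [mul_assoc] at h2
    rw [mul_comm (AddMonoidAlgebra.single (-Pi.single p 1) 1), var_mul_inv, mul_one, zero_mul] at h2
    exact h2
  · rintro ⟨v, rfl⟩
    ext1 i
    refine Subtype.ext ?_
    rw [localMap_apply]
    change mulMap m v.1 i * _ = 0
    rw [v.2.2, Pi.zero_apply, zero_mul]

/-- The surjection onto a free module splits, so the kernel is a complement of `R^a` in `R^b`. -/
theorem projective_of_exact_pi {R M : Type*} [CommRing R] [Nontrivial R] [AddCommGroup M]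
    [Module R M] {f : M →ₗ[R] (Fin b → R)} {g : (Fin b → R) →ₗ[R] (Fin a → R)}
    (hf : Function.Injective f) (hg : Function.Surjective g) (h : Function.Exact f g) :
    Module.Finite R M ∧ Module.Projective R M ∧
      ∀ x : PrimeSpectrum R, Module.rankAtStalk M x = b - a := by
  obtain ⟨l, hl⟩ := Module.projective_lifting_property g LinearMap.id hg
  let e : (Fin b → R) ≃ₗ[R] M × (Fin a → R) := (h.splitSurjectiveEquiv hf ⟨l, hl⟩).1
  have hfin : Module.Finite R M :=
    Module.Finite.of_surjective (LinearMap.fst _ _ _ ∘ₗ e.toLinearMap)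
      (Prod.fst_surjective.comp e.surjective)
  have hproj : Module.Projective R M :=
    Module.Projective.of_split (e.symm.toLinearMap ∘ₗ LinearMap.inl _ _ _)
      (LinearMap.fst _ _ _ ∘ₗ e.toLinearMap) (LinearMap.ext fun x => by simp)
  refine ⟨hfin, hproj, fun x => ?_⟩
  have h1 := congrFun (Module.rankAtStalk_eq_of_equiv e) x
  rw [Module.rankAtStalk_prod, Module.rankAtStalk_eq_finrank_of_free (M := Fin b → R),
    Module.rankAtStalk_eq_finrank_of_free (M := Fin a → R)] at h1
  simp only [Module.finrank_fintype_fun_eq_card, Fintype.card_fin, Pi.add_apply, Pi.natCast_apply,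
    Nat.cast_id] at h1
  omega

theorem kerSecIncl_injective (m : Idx a b → K) (p : Fin 4) :
    Function.Injective (kerSecIncl m p) := fun _ _ h =>
  Subtype.ext (funext fun j => congrArg Subtype.val (congrFun h j))

theorem SheafSurjective.locallyFreeOfRank {m : Idx a b → K} (hm : SheafSurjective m) :
    LocallyFreeOfRank m (b - a) := fun p =>
  @projective_of_exact_pi a b (coordRing K {p}) (kerSec m {p} 0) _ _ _ _ (kerSecIncl m p)
    (localMap m p) (kerSecIncl_injective m p) (localMap_surjective hm p) (exact_kerSecIncl m p)

/-! ## Trivial summands -/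

/-- The functional on the kernel sheaf given by a multiple of a coordinate. -/
def kerSecCoord (m : Idx a b → K) (c : K) (j : Fin b) (I : Finset (Fin 4)) :
    kerSec m I 0 →ₗ[coordRing K I] coordRing K I where
  toFun w := ⟨c • w.1 j, (sec K I 0).smul_mem c (w.2.1 j trivial)⟩
  map_add' w w' := Subtype.ext (smul_add c (w.1 j) (w'.1 j))
  map_smul' x w := Subtype.ext (mul_smul_comm c (x : Laurent K) (w.1 j)).symm

/-- A kernel vector of `m(0)` is constant, hence a section of `E`; a coordinate in which it is
nonzero, rescaled, is a retraction onto `𝒪`. -/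
theorem hasTrivialSummand_of_not_injective {m : Idx a b → K}
    (hm : ¬ Function.Injective (mulOn m ∅ 0)) : HasTrivialSummand m := by
  rw [← LinearMap.ker_eq_bot, Submodule.eq_bot_iff] at hm
  push Not at hm
  obtain ⟨v, hv, hne⟩ := hm
  have hmv : mulMap m v.1 = 0 := congrArg Subtype.val (LinearMap.mem_ker.1 hv)
  have hmem : ∀ I : Finset (Fin 4), v.1 ∈ vecSec K b I 0 := fun I i _ =>
    sec_mono (Finset.empty_subset I) 0 (v.2 i trivial)
  have hconst : ∀ j, v.1 j = algebraMap K (Laurent K) ((v.1 j).coeff 0) := by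
    intro j
    ext e
    simp only [AddMonoidAlgebra.coe_algebraMap, Function.comp_apply, Algebra.algebraMap_self,
      RingHom.id_apply, AddMonoidAlgebra.coeff_single, Finsupp.single_apply]
    split_ifs with h
    · rw [h]
    · refine coeff_eq_zero_of_mem_sec (v.2 j trivial) e fun he => h ?_
      exact (congrArg Subtype.val (Subsingleton.elim (⟨e, he⟩ : Mon 0) default)).symm
  obtain ⟨j, hj⟩ : ∃ j, v.1 j ≠ 0 := by
    by_contra! h
    exact hne (Subtype.ext (funext h))
  have hc : (v.1 j).coeff 0 ≠ 0 := fun h => hj (by rw [hconst, h, map_zero])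
  refine ⟨v.1, fun I _ => ⟨hmem I, hmv⟩, kerSecCoord m ((v.1 j).coeff 0)⁻¹ j, ?_, ?_⟩
  · intro I J _ _ w hI hJ
    rfl
  · intro I hI
    refine Subtype.ext ?_
    change ((v.1 j).coeff 0)⁻¹ • v.1 j = 1
    nth_rewrite 2 [hconst j]
    rw [Algebra.smul_def, ← map_mul, inv_mul_cancel₀ hc, map_one]

end Steiner

end

noncomputable section

namespace Steiner

variable {a b f : ℕ}

/-! ## Functionals on `A ⊗ S² V` and the morphisms they annihilate -/

section Ring

variable {R S : Type*} [CommRing R] [CommRing S]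

/-- The contractions of `f` functionals on `A ⊗ S² V`, given as the rows of `φ`: the functionals
`y ↦ φ_l (x_q y)` on `A ⊗ V`. -/
def contr (φ : Matrix (Fin f) (QuadIdx a) R) : Matrix (Fin f × Fin 4) (Fin a × Fin 4) R :=
  fun x z => φ x.1 (z.1, sortPair z.2 x.2)

/-- The matrix of `m(0)`. -/
def cellMat (m : Idx a b → R) : Matrix (Fin a × Fin 4) (Fin b) R := fun z j => m (z.1, j, z.2)

theorem contr_map (g : R →+* S) (φ : Matrix (Fin f) (QuadIdx a) R) :
    (contr φ).map g = contr (φ.map g) := rfl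

/-- Both sides are `φ_l(x_q · m(e_j))`. Thus annihilation of `Im m(1)` by `φ` becomes a linear
condition on the columns of `m(0)`. -/
theorem mul_quadMat_apply (φ : Matrix (Fin f) (QuadIdx a) R) (m : Idx a b → R) (l : Fin f)
    (j : Fin b) (q : Fin 4) :
    (φ * quadMat m) l (j, q) = (contr φ * cellMat m) (l, q) j := by
  simp only [Matrix.mul_apply, quadMat, contr, cellMat, Fintype.sum_prod_type, Finset.mul_sum]
  refine Finset.sum_congr rfl fun i _ => ?_
  rw [Finset.sum_comm]
  refine Finset.sum_congr rfl fun p _ => ?_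
  simp

theorem mul_quadMat_eq_zero_iff (φ : Matrix (Fin f) (QuadIdx a) R) (m : Idx a b → R) :
    φ * quadMat m = 0 ↔ contr φ * cellMat m = 0 := by
  constructor
  · intro h
    ext ⟨l, q⟩ j
    rw [← mul_quadMat_apply, h]; rfl
  · intro h
    ext l ⟨j, q⟩
    rw [mul_quadMat_apply, h]; rfl

theorem contr_mul (G : Matrix (Fin f) (Fin f) R) (φ : Matrix (Fin f) (QuadIdx a) R) :
    contr (G * φ) = Matrix.kronecker G (1 : Matrix (Fin 4) (Fin 4) R) * contr φ := by
  ext ⟨l, q⟩ z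
  simp only [contr, Matrix.mul_apply, Matrix.kronecker, Matrix.kroneckerMap_apply,
    Fintype.sum_prod_type]
  refine Finset.sum_congr rfl fun l' _ => ?_
  rw [Finset.sum_eq_single q]
  · simp
  · intro q' _ hq'
    rw [Matrix.one_apply_ne hq'.symm, mul_zero, zero_mul]
  · simp

variable (J : Fin f × Fin 4 → Fin a × Fin 4)

/-- The maximal minor of the matrix of contractions given by the columns `J`. -/
abbrev contrSub (φ : Matrix (Fin f) (QuadIdx a) R) : Matrix (Fin f × Fin 4) (Fin f × Fin 4) R :=
  (contr φ).submatrix id J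

/-- The matrix of the inclusion of the coordinates `J`. -/
def inclMat (R : Type*) [CommRing R] : Matrix (Fin a × Fin 4) (Fin f × Fin 4) R :=
  fun z y => if z = J y then 1 else 0

theorem mul_inclMat {n : Type*} (N : Matrix n (Fin a × Fin 4) R) :
    N * inclMat J R = N.submatrix id J := by
  ext x y
  simp [Matrix.mul_apply, inclMat]

/-- The coordinates of the parametrization of the morphisms annihilated by `φ`. -/
abbrev Wdx (b : ℕ) : Type := {z : Fin a × Fin 4 // z ∉ Set.range J} × Fin b

open Classical in
/-- The extension by zero to all the coordinates. -/
def extMat (w : Wdx J b → R) : Matrix (Fin a × Fin 4) (Fin b) R :=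
  fun z j => if h : z ∉ Set.range J then w (⟨z, h⟩, j) else 0

/-- The parametrization of the morphisms annihilated by `φ`, in matrix form. -/
def paramMat (φ : Matrix (Fin f) (QuadIdx a) R) (w : Wdx J b → R) :
    Matrix (Fin a × Fin 4) (Fin b) R :=
  (contrSub J φ).det • extMat J w -
    inclMat J R * ((contrSub J φ).adjugate * (contr φ * extMat J w))

/-- The parametrization of the morphisms annihilated by `φ`. -/
def param (φ : Matrix (Fin f) (QuadIdx a) R) (w : Wdx J b → R) : Idx a b → R :=
  fun x => paramMat J φ w (x.1, x.2.2) x.2.1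

theorem cellMat_param (φ : Matrix (Fin f) (QuadIdx a) R) (w : Wdx J b → R) :
    cellMat (param J φ w) = paramMat J φ w := rfl

theorem extMat_map (g : R →+* S) (w : Wdx J b → R) :
    (extMat J w).map g = extMat J fun x => g (w x) := by
  ext z j
  simp only [extMat, Matrix.map_apply]
  split_ifs <;> simp

theorem det_contrSub_map (g : R →+* S) (φ : Matrix (Fin f) (QuadIdx a) R) :
    g (contrSub J φ).det = (contrSub J (φ.map g)).det := by
  rw [RingHom.map_det]
  rfl

theorem param_map (g : R →+* S) (φ : Matrix (Fin f) (QuadIdx a) R) (w : Wdx J b → R) (x : Idx a b) :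
    g (param J φ w x) = param J (φ.map g) (fun y => g (w y)) x := by
  have : (paramMat J φ w).map g = paramMat J (φ.map g) fun y => g (w y) := by
    have h1 : (inclMat J R).map g = inclMat J S := by
      ext z y
      simp [inclMat, apply_ite g]
    have h2 : ((contrSub J φ).adjugate).map g = (contrSub J (φ.map g)).adjugate :=
      RingHom.map_adjugate g _
    rw [paramMat, paramMat, ← det_contrSub_map, ← extMat_map, ← h1, ← h2, ← contr_map,
      ← Matrix.map_mul, ← Matrix.map_mul, ← Matrix.map_mul]
    ext z j
    simp only [Matrix.map_apply, Matrix.sub_apply, Matrix.smul_apply, smul_eq_mul, map_sub, map_mul]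
  exact congrFun (congrFun this (x.1, x.2.2)) x.2.1

/-- Write `C` for the contractions and `C_J` for the minor. The parametrization is the solution of
`C y = 0` by Cramer's rule, with the coordinates off `J` free and the denominator `det C_J` cleared;
the identity is `C_J · adj C_J = det C_J`. Clearing it makes the formula meaningful for
indeterminate `φ`. -/
theorem contr_mul_param (φ : Matrix (Fin f) (QuadIdx a) R) (w : Wdx J b → R) :
    contr φ * cellMat (param J φ w) = 0 := by
  rw [cellMat_param, paramMat, Matrix.mul_sub, ← Matrix.mul_assoc, mul_inclMat, ← Matrix.mul_assoc,
    Matrix.mul_adjugate, Matrix.mul_smul, Matrix.smul_mul, Matrix.one_mul, sub_self]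

theorem param_apply_of_notMem (φ : Matrix (Fin f) (QuadIdx a) R) (w : Wdx J b → R)
    (z : Fin a × Fin 4) (hz : z ∉ Set.range J) (j : Fin b) :
    param J φ w (z.1, j, z.2) = (contrSub J φ).det * w (⟨z, hz⟩, j) := by
  change paramMat J φ w z j = _
  have : ∀ y, inclMat J R z y = 0 := fun y => if_neg fun h => hz ⟨y, h.symm⟩
  simp only [paramMat, Matrix.sub_apply, Matrix.smul_apply, Matrix.mul_apply (M := inclMat J R),
    this, zero_mul, Finset.sum_const_zero, sub_zero, extMat, dif_pos hz, smul_eq_mul]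

/-- The family depends on the span of the functionals only: a change of basis `G` rescales the free
coordinates. This allows the universal `φ` to be compared with the normalized functionals of a
chart. -/
theorem param_mul (G : Matrix (Fin f) (Fin f) R) (φ : Matrix (Fin f) (QuadIdx a) R)
    (w : Wdx J b → R) :
    param J (G * φ) w =
      param J φ fun x => (Matrix.kronecker G (1 : Matrix (Fin 4) (Fin 4) R)).det * w x := by
  have h0 : contrSub J (G * φ) = Matrix.kronecker G (1 : Matrix (Fin 4) (Fin 4) R) *
      contrSub J φ := by
    rw [contrSub, contr_mul, ← mul_inclMat, Matrix.mul_assoc, mul_inclMat]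
  have h1 : extMat J (fun x => (Matrix.kronecker G (1 : Matrix (Fin 4) (Fin 4) R)).det * w x) =
      (Matrix.kronecker G (1 : Matrix (Fin 4) (Fin 4) R)).det • extMat J w := by
    ext z j
    simp only [extMat, Matrix.smul_apply, smul_eq_mul]
    split_ifs <;> simp
  have : paramMat J (G * φ) w = paramMat J φ fun x =>
      (Matrix.kronecker G (1 : Matrix (Fin 4) (Fin 4) R)).det * w x := by
    rw [paramMat, paramMat, h0, h1, contr_mul, Matrix.det_mul, Matrix.adjugate_mul_distrib,
      Matrix.mul_assoc (Matrix.adjugate (contrSub J φ)),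
      Matrix.mul_assoc (Matrix.kronecker G 1), ← Matrix.mul_assoc
      (Matrix.kronecker G (1 : Matrix (Fin 4) (Fin 4) R)).adjugate, Matrix.adjugate_mul,
      Matrix.smul_mul, Matrix.one_mul, Matrix.mul_smul, Matrix.mul_smul, Matrix.mul_smul,
      Matrix.mul_smul, Matrix.mul_smul, smul_smul, mul_comm]
  funext x
  exact congrFun (congrFun this (x.1, x.2.2)) x.2.1

theorem det_contrSub_mul (G : Matrix (Fin f) (Fin f) R) (φ : Matrix (Fin f) (QuadIdx a) R) :
    (contrSub J (G * φ)).det =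
      (Matrix.kronecker G (1 : Matrix (Fin 4) (Fin 4) R)).det * (contrSub J φ).det := by
  rw [contrSub, contr_mul, ← mul_inclMat, Matrix.mul_assoc, mul_inclMat, Matrix.det_mul]

/-- A morphism annihilated by `φ` is in the image of the parametrization. -/
theorem smul_eq_param (hJ : Function.Injective J) {φ : Matrix (Fin f) (QuadIdx a) R}
    {m : Idx a b → R} (hm : contr φ * cellMat m = 0) (x : Idx a b) :
    (contrSub J φ).det * m x = param J φ (fun y => m (y.1.1.1, y.2, y.1.1.2)) x := by
  classical
  set w : Wdx J b → R := fun y => m (y.1.1.1, y.2, y.1.1.2)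
  let u : Matrix (Fin f × Fin 4) (Fin b) R := fun y j => cellMat m (J y) j
  -- Split the coordinates of `m` into those off `J`, kept in `w`, and those on `J`, kept in `u`.
  have h1 : extMat J w = cellMat m - inclMat J R * u := by
    ext z j
    simp only [extMat, Matrix.sub_apply, Matrix.mul_apply, inclMat, ite_mul, one_mul, zero_mul]
    by_cases hz : z ∈ Set.range J
    · obtain ⟨y, rfl⟩ := hz
      rw [dif_neg (by simp)]
      simp [hJ.eq_iff, u]
    · rw [dif_pos hz]
      have : ∀ y, z ≠ J y := fun y h => hz ⟨y, h.symm⟩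
      simp [this, w, cellMat]
  have : paramMat J φ w = (contrSub J φ).det • cellMat m := by
    rw [paramMat, h1, Matrix.mul_sub (contr φ), hm, zero_sub, ← Matrix.mul_assoc (contr φ),
      mul_inclMat, Matrix.mul_neg, ← Matrix.mul_assoc, Matrix.adjugate_mul, Matrix.smul_mul,
      Matrix.one_mul, Matrix.mul_neg, smul_sub, Matrix.mul_smul, sub_neg_eq_add, sub_add_cancel]
  exact (congrFun (congrFun this (x.1, x.2.2)) x.2.1).symm

/-- The functionals defining the subspace with coordinates `c` in the chart given by `I`. -/
def chartMat (I : Finset (QuadIdx a)) (σ : Fin f ≃ {t // t ∈ I})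
    (c : {t // t ∈ I} × {t // t ∉ I} → R) : Matrix (Fin f) (QuadIdx a) R :=
  fun l t => if h : t ∈ I then (if σ l = ⟨t, h⟩ then 1 else 0) else -c (σ l, ⟨t, h⟩)

theorem chartMat_map (g : R →+* S) (I : Finset (QuadIdx a)) (σ : Fin f ≃ {t // t ∈ I})
    (c : {t // t ∈ I} × {t // t ∉ I} → R) :
    (chartMat I σ c).map g = chartMat I σ fun x => g (c x) := by
  ext l t
  simp only [chartMat, Matrix.map_apply]
  split_ifs <;> simp

theorem chartMat_mulVec_eq_zero_iff (I : Finset (QuadIdx a)) (σ : Fin f ≃ {t // t ∈ I})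
    (c : {t // t ∈ I} × {t // t ∉ I} → R) (v : QuadIdx a → R) :
    (chartMat I σ c).mulVec v = 0 ↔
      ∀ i : {t // t ∈ I}, v i = ∑ j : {t // t ∉ I}, c (i, j) * v j := by
  have h : ∀ l, (chartMat I σ c).mulVec v l =
      v (σ l) - ∑ j : {t // t ∉ I}, c (σ l, j) * v j := by
    intro l
    rw [Matrix.mulVec, dotProduct, ← Fintype.sum_subtype_add_sum_subtype (· ∈ I)]
    have h1 : ∀ i : {t // t ∈ I}, chartMat I σ c l i * v i = if σ l = i then v i else 0 := by
      intro i
      simp [chartMat, i.2]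
    have h2 : ∀ i : {t // t ∉ I}, chartMat I σ c l i * v i = -(c (σ l, i) * v i) := by
      intro i
      simp [chartMat, i.2]
    rw [Finset.sum_congr rfl fun i _ => h1 i, Finset.sum_congr rfl fun i _ => h2 i]
    simp [sub_eq_add_neg]
  constructor
  · intro h0 i
    obtain ⟨l, rfl⟩ := σ.surjective i
    have := congrFun h0 l
    rw [h] at this
    exact sub_eq_zero.1 this
  · intro h0
    ext l
    rw [h, h0 (σ l), sub_self]; rfl

end Ring

/-- A matrix of functionals with invertible minor `I` is a multiple of a matrix from the chart. -/
theorem exists_eq_mul_chartMat {K : Type*} [Field K] (I : Finset (QuadIdx a))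
    (σ : Fin f ≃ {t // t ∈ I}) (φ : Matrix (Fin f) (QuadIdx a) K)
    (h : (φ.submatrix id fun l => (σ l : QuadIdx a)).det ≠ 0) :
    ∃ c : {t // t ∈ I} × {t // t ∉ I} → K,
      φ = φ.submatrix id (fun l => (σ l : QuadIdx a)) * chartMat I σ c := by
  set G := φ.submatrix id fun l => (σ l : QuadIdx a) with hG
  let c : {t // t ∈ I} × {t // t ∉ I} → K := fun x => -(G⁻¹ * φ) (σ.symm x.1) x.2
  have hu : IsUnit G.det := isUnit_iff_ne_zero.2 h
  refine ⟨c, ?_⟩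
  have h0 : chartMat I σ c = G⁻¹ * φ := by
    ext l t
    by_cases ht : t ∈ I
    · have h1 : (G⁻¹ * φ) l t = (G⁻¹ * G) l (σ.symm ⟨t, ht⟩) := by
        simp [Matrix.mul_apply, hG]
      rw [h1, Matrix.nonsing_inv_mul _ hu, chartMat, dif_pos ht, Matrix.one_apply]
      exact if_congr (Equiv.eq_symm_apply σ).symm rfl rfl
    · simp [chartMat, ht, c]
  rw [h0, ← Matrix.mul_assoc, Matrix.mul_nonsing_inv _ hu, Matrix.one_mul]

end Steiner

end

noncomputable section

namespace Steiner

variable {k : Type u} [Field k] {a b f : ℕ}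

/-! ## Generic subspaces and the universal parametrization -/

/-- The universal matrix of functionals. -/
def univPhi (k : Type u) [Field k] (a f : ℕ) (τ : Type) :
    Matrix (Fin f) (QuadIdx a) (MvPolynomial ((Fin f × QuadIdx a) ⊕ τ) k) :=
  Matrix.of fun l t => MvPolynomial.X (Sum.inl (l, t))

theorem univPhi_map {A : Type*} [CommRing A] [Algebra k A] {τ : Type}
    (φ : Matrix (Fin f) (QuadIdx a) A) (w : τ → A) :
    (univPhi k a f τ).map ((MvPolynomial.aeval (Sum.elim (fun x => φ x.1 x.2) w) :
      MvPolynomial ((Fin f × QuadIdx a) ⊕ τ) k →ₐ[k] A) : _ →+* A) = φ := by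
  ext l t
  simp [univPhi]

/-- Over an infinite field, `h` times the minor on `I` is nonzero at some point; where that minor is
nonzero, the functionals are a change of basis away from the chart `I`. -/
theorem exists_eval_ne_zero [Infinite k] {τ : Type} (I : Finset (QuadIdx a))
    (σ : Fin f ≃ {t // t ∈ I}) {h : MvPolynomial ((Fin f × QuadIdx a) ⊕ τ) k} (hh : h ≠ 0) :
    ∃ (G : Matrix (Fin f) (Fin f) k) (c : {t // t ∈ I} × {t // t ∉ I} → k) (w : τ → k),
      MvPolynomial.aeval (Sum.elim (fun x =>
        (G * chartMat I σ c : Matrix (Fin f) (QuadIdx a) k) x.1 x.2) w) h ≠ 0 := by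
  let D := ((univPhi k a f τ).submatrix id fun l => (σ l : QuadIdx a)).det
  have hDeval : ∀ (φ : Matrix (Fin f) (QuadIdx a) k) (w : τ → k),
      MvPolynomial.aeval (Sum.elim (fun x => φ x.1 x.2) w) D =
        (φ.submatrix id fun l => (σ l : QuadIdx a)).det := by
    intro φ w
    have h1 := RingHom.map_det ((MvPolynomial.aeval (Sum.elim (fun x => φ x.1 x.2) w) :
      MvPolynomial ((Fin f × QuadIdx a) ⊕ τ) k →ₐ[k] k) : _ →+* k)
      ((univPhi k a f τ).submatrix id fun l => (σ l : QuadIdx a))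
    refine h1.trans ?_
    congr 1
    rw [RingHom.mapMatrix_apply, ← Matrix.submatrix_map, univPhi_map]
  have hD : D ≠ 0 := by
    intro h0
    have := hDeval (Matrix.of fun l t => if (σ l : QuadIdx a) = t then 1 else 0) 0
    rw [h0, map_zero] at this
    have h1 : (Matrix.submatrix (Matrix.of fun l t => if (σ l : QuadIdx a) = t then 1 else 0) id
        fun l => (σ l : QuadIdx a)) = (1 : Matrix (Fin f) (Fin f) k) := by
      ext l l'
      simp [Matrix.one_apply]
    rw [h1, Matrix.det_one] at this
    exact one_ne_zero this.symm
  obtain ⟨x, hx⟩ : ∃ x, MvPolynomial.eval x (h * D) ≠ 0 := by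
    by_contra! h0
    exact mul_ne_zero hh hD (MvPolynomial.funext fun x => by rw [h0, map_zero])
  rw [map_mul] at hx
  let φ : Matrix (Fin f) (QuadIdx a) k := fun l t => x (Sum.inl (l, t))
  have hx' : x = Sum.elim (fun y => φ y.1 y.2) fun y => x (Sum.inr y) := by
    ext y
    rcases y with y | y <;> rfl
  have h1 : (φ.submatrix id fun l => (σ l : QuadIdx a)).det ≠ 0 := by
    rw [← hDeval φ fun y => x (Sum.inr y), ← hx']
    exact right_ne_zero_of_mul hx
  obtain ⟨c, hc⟩ := exists_eq_mul_chartMat I σ φ h1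
  refine ⟨φ.submatrix id fun l => (σ l : QuadIdx a), c, fun y => x (Sum.inr y), ?_⟩
  have h2 := left_ne_zero_of_mul hx
  rw [hx', hc] at h2
  exact h2

variable (J : Fin f × Fin 4 → Fin a × Fin 4)

variable (k b) in
/-- The homomorphism of the universal parametrization of the morphisms annihilated by `f`
functionals. -/
def genHom : MvPolynomial (Idx a b) k →ₐ[k] MvPolynomial ((Fin f × QuadIdx a) ⊕ Wdx J b) k :=
  MvPolynomial.aeval (param J (univPhi k a f (Wdx J b)) fun x => MvPolynomial.X (Sum.inr x))

theorem aeval_genHom {A : Type*} [CommRing A] [Algebra k A] (φ : Matrix (Fin f) (QuadIdx a) A)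
    (w : Wdx J b → A) (g : MvPolynomial (Idx a b) k) :
    MvPolynomial.aeval (Sum.elim (fun x => φ x.1 x.2) w) (genHom k b J g) =
      MvPolynomial.aeval (param J φ w) g := by
  rw [genHom, ← AlgHom.comp_apply]
  congr 1
  ext x
  rw [AlgHom.comp_apply, MvPolynomial.aeval_X, MvPolynomial.aeval_X]
  have := param_map J ((MvPolynomial.aeval (Sum.elim (fun x => φ x.1 x.2) w) :
      MvPolynomial ((Fin f × QuadIdx a) ⊕ Wdx J b) k →ₐ[k] A) : _ →+* A)
      (univPhi k a f (Wdx J b)) (fun x => MvPolynomial.X (Sum.inr x)) x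
  rw [univPhi_map] at this
  refine this.trans ?_
  congr 1
  ext y
  simp

theorem aeval_param_chartMat {A : Type*} [CommRing A] [Algebra k A] (I : Finset (QuadIdx a))
    (σ : Fin f ≃ {t // t ∈ I}) (c : {t // t ∈ I} × {t // t ∉ I} → A) (w : Wdx J b → A)
    (g : MvPolynomial (Idx a b) k) :
    MvPolynomial.aeval (param J (chartMat I σ c) w) g =
      MvPolynomial.aeval (Sum.elim c w) (MvPolynomial.aeval (param J (chartMat I σ fun x =>
        (MvPolynomial.X (Sum.inl x) : MvPolynomial (({t // t ∈ I} × {t // t ∉ I}) ⊕ Wdx J b) k))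
          fun x => MvPolynomial.X (Sum.inr x)) g) := by
  rw [← AlgHom.comp_apply]
  congr 1
  ext x
  rw [AlgHom.comp_apply, MvPolynomial.aeval_X, MvPolynomial.aeval_X]
  have := param_map J ((MvPolynomial.aeval (Sum.elim c w) :
    MvPolynomial (({t // t ∈ I} × {t // t ∉ I}) ⊕ Wdx J b) k →ₐ[k] A) : _ →+* A)
    (chartMat I σ fun x => (MvPolynomial.X (Sum.inl x) :
      MvPolynomial (({t // t ∈ I} × {t // t ∉ I}) ⊕ Wdx J b) k))
    (fun x => MvPolynomial.X (Sum.inr x)) x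
  rw [chartMat_map] at this
  refine Eq.trans ?_ this.symm
  congr 1
  · congr 1
    ext y
    simp
  · ext y
    simp

/-- The ideal of the generic morphism can be computed in any chart. -/
theorem aeval_param_eq_zero_iff [Infinite k] {A : Type*} [CommRing A] [Algebra k A]
    (I : Finset (QuadIdx a)) (σ : Fin f ≃ {t // t ∈ I}) (c : {t // t ∈ I} × {t // t ∉ I} → A)
    (w : Wdx J b → A) (hcw : AlgebraicIndependent k (Sum.elim c w))
    (g : MvPolynomial (Idx a b) k) :
    MvPolynomial.aeval (param J (chartMat I σ c) w) g = 0 ↔ genHom k b J g = 0 := by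
  constructor
  · intro h
    by_contra hg
    -- A `k`-point where the pulled-back polynomial is nonzero, moved into the chart by absorbing
    -- `G` in `w'`; but independence of `(c, w)` makes that polynomial vanish identically on the
    -- chart.
    obtain ⟨G, c', w', h'⟩ := exists_eval_ne_zero I σ hg
    rw [aeval_genHom, param_mul, aeval_param_chartMat] at h'
    apply h'
    rw [aeval_param_chartMat] at h
    rw [hcw.eq_zero_of_aeval_eq_zero _ h, map_zero]
  · intro h
    rw [← aeval_genHom, h, map_zero]

theorem aeval_det_contr_chartMat {A : Type*} [CommRing A] [Algebra k A] {n : Type*} [Fintype n]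
    [DecidableEq n] (s : n → Fin f × Fin 4) (t : n → Fin a × Fin 4) (I : Finset (QuadIdx a))
    (σ : Fin f ≃ {t // t ∈ I}) (c : {t // t ∈ I} × {t // t ∉ I} → A) :
    MvPolynomial.aeval c ((contr (chartMat I σ fun x => (MvPolynomial.X x :
        MvPolynomial ({t // t ∈ I} × {t // t ∉ I}) k))).submatrix s t).det =
      ((contr (chartMat I σ c)).submatrix s t).det := by
  have h := RingHom.map_det ((MvPolynomial.aeval c :
    MvPolynomial ({t // t ∈ I} × {t // t ∉ I}) k →ₐ[k] A) : _ →+* A)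
    ((contr (chartMat I σ fun x => (MvPolynomial.X x :
        MvPolynomial ({t // t ∈ I} × {t // t ∉ I}) k))).submatrix s t)
  refine h.trans ?_
  rw [RingHom.mapMatrix_apply, ← Matrix.submatrix_map, contr_map, chartMat_map]
  simp

/-- A polynomial that is nonzero at one `k`-point is nonzero at algebraically independent
coordinates. -/
theorem det_contr_chartMat_ne_zero {A : Type*} [CommRing A] [Algebra k A] {n : Type*} [Fintype n]
    [DecidableEq n] (s : n → Fin f × Fin 4) (t : n → Fin a × Fin 4) (I : Finset (QuadIdx a))
    (σ : Fin f ≃ {t // t ∈ I}) {c' : {t // t ∈ I} × {t // t ∉ I} → k}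
    (hc' : ((contr (chartMat I σ c')).submatrix s t).det ≠ 0)
    {c : {t // t ∈ I} × {t // t ∉ I} → A} (hc : AlgebraicIndependent k c) :
    ((contr (chartMat I σ c)).submatrix s t).det ≠ 0 := by
  intro h0
  rw [← aeval_det_contr_chartMat (k := k)] at h0
  rw [← aeval_det_contr_chartMat (k := k), hc.eq_zero_of_aeval_eq_zero _ h0, map_zero] at hc'
  exact hc' rfl

/-- If a minor of the matrix of contractions is nonzero for some functionals, then it is nonzero for
some multiple of the functionals of a point of any given chart. -/
theorem exists_det_contr_mul_chartMat_ne_zero [Infinite k] {n : Type*} [Fintype n] [DecidableEq n]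
    (s : n → Fin f × Fin 4) (t : n → Fin a × Fin 4) {φ₀ : Matrix (Fin f) (QuadIdx a) k}
    (hφ₀ : ((contr φ₀).submatrix s t).det ≠ 0) (I : Finset (QuadIdx a))
    (σ : Fin f ≃ {t // t ∈ I}) :
    ∃ (G : Matrix (Fin f) (Fin f) k) (c : {t // t ∈ I} × {t // t ∉ I} → k),
      ((contr (G * chartMat I σ c : Matrix (Fin f) (QuadIdx a) k)).submatrix s t).det ≠ 0 := by
  have key : ∀ (φ : Matrix (Fin f) (QuadIdx a) k) (w : Empty → k),
      MvPolynomial.aeval (Sum.elim (fun x => φ x.1 x.2) w)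
        ((contr (univPhi k a f Empty)).submatrix s t).det = ((contr φ).submatrix s t).det := by
    intro φ w
    have h := RingHom.map_det ((MvPolynomial.aeval (Sum.elim (fun x => φ x.1 x.2) w) :
      MvPolynomial ((Fin f × QuadIdx a) ⊕ Empty) k →ₐ[k] k) : _ →+* k)
      ((contr (univPhi k a f Empty)).submatrix s t)
    refine h.trans ?_
    rw [RingHom.mapMatrix_apply, ← Matrix.submatrix_map, contr_map, univPhi_map]
  have hD : ((contr (univPhi k a f Empty)).submatrix s t).det ≠ 0 := by
    intro h0
    rw [← key φ₀ Empty.elim, h0, map_zero] at hφ₀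
    exact hφ₀ rfl
  obtain ⟨G, c', w', h'⟩ := exists_eval_ne_zero I σ hD
  rw [key] at h'
  exact ⟨G, c', h'⟩

theorem det_contrSub_chartMat_ne_zero [Infinite k] {A : Type*} [CommRing A] [Algebra k A]
    (φ₀ : Matrix (Fin f) (QuadIdx a) k) (hφ₀ : (contrSub J φ₀).det ≠ 0)
    (I : Finset (QuadIdx a)) (σ : Fin f ≃ {t // t ∈ I}) (c : {t // t ∈ I} × {t // t ∉ I} → A)
    (hc : AlgebraicIndependent k c) : (contrSub J (chartMat I σ c)).det ≠ 0 := by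
  obtain ⟨G, c', hG⟩ := exists_det_contr_mul_chartMat_ne_zero id J hφ₀ I σ
  have h2 := det_contrSub_mul J G (chartMat I σ c')
  rw [contrSub] at h2
  rw [h2] at hG
  exact det_contr_chartMat_ne_zero id J I σ (right_ne_zero_of_mul hG) hc

/-- The matrix of contractions of generic functionals has maximal rank. -/
theorem le_rank_contr_chartMat [Infinite k] {L : Type*} [Field L] [Algebra k L]
    (I : Finset (QuadIdx a)) (σ : Fin f ≃ {t // t ∈ I}) (c : {t // t ∈ I} × {t // t ∉ I} → L)
    (hc : AlgebraicIndependent k c) : 4 * min f a ≤ (contr (chartMat I σ c)).rank := by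
  let r := min f a
  let s : Fin r × Fin 4 → Fin f × Fin 4 := Prod.map (Fin.castLE (min_le_left f a)) id
  let t : Fin r × Fin 4 → Fin a × Fin 4 := Prod.map (Fin.castLE (min_le_right f a)) id
  -- The `l`-th functional sums the coefficients of `e_l ⊗ x_p²`; its contraction by `x_q` is the
  -- coordinate `(l, q)`, so the chosen minor is the identity.
  let φ₀ : Matrix (Fin f) (QuadIdx a) k :=
    fun l x => if x.1.1 = l.1 ∧ x.2.1.1 = x.2.1.2 then 1 else 0
  have h0 : (contr φ₀).submatrix s t = 1 := by
    have hsort : ∀ p q : Fin 4, (sortPair p q).1.1 = (sortPair p q).1.2 ↔ p = q := by decide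
    ext ⟨l, q⟩ ⟨i, p⟩
    simp only [contr, Matrix.submatrix_apply, φ₀, s, t, Prod.map, id, Fin.val_castLE, hsort,
      Matrix.one_apply, Prod.mk.injEq]
    exact if_congr ⟨fun h => ⟨Fin.ext h.1.symm, h.2.symm⟩,
      fun h => ⟨congrArg Fin.val h.1.symm, h.2.symm⟩⟩ rfl rfl
  obtain ⟨G, c', h'⟩ := exists_det_contr_mul_chartMat_ne_zero s t
    (φ₀ := φ₀) (by rw [h0, Matrix.det_one]; exact one_ne_zero) I σ
  have h5 := le_rank_of_det_submatrix_ne_zero _ s t h'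
  rw [contr_mul] at h5
  have h6 := h5.trans (Matrix.rank_mul_le_right _ _)
  obtain ⟨s', t', h7⟩ := exists_det_submatrix_ne_zero_of_le_rank _ h6
  have h8 := le_rank_of_det_submatrix_ne_zero _ s' t' (det_contr_chartMat_ne_zero s' t' I σ h7 hc)
  rw [Fintype.card_prod, Fintype.card_fin, Fintype.card_fin, Fintype.card_fin] at h8
  omega

/-- Needed for the generic point of `Hom(B, Z^*)` over `L`, whose free coordinates are new
variables: `k[ι][τ] → L[τ]` is injective on coefficients. -/
theorem algebraicIndependent_sumElim_X {L : Type*} [Field L] [Algebra k L] {ι τ : Type*}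
    {c : ι → L} (hc : AlgebraicIndependent k c) :
    AlgebraicIndependent k (Sum.elim (fun i => MvPolynomial.C (c i))
      (fun x => (MvPolynomial.X x : MvPolynomial τ L))) := by
  let e₁ := MvPolynomial.renameEquiv k (Equiv.sumComm ι τ)
  let e₂ := MvPolynomial.sumAlgEquiv k τ ι
  let g : MvPolynomial τ (MvPolynomial ι k) →ₐ[k] MvPolynomial τ L :=
    MvPolynomial.mapAlgHom (MvPolynomial.aeval c)
  have hg : Function.Injective g := MvPolynomial.map_injective _ hc
  have h : (MvPolynomial.aeval (Sum.elim (fun i => MvPolynomial.C (c i))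
      (fun x => (MvPolynomial.X x : MvPolynomial τ L))) : MvPolynomial (ι ⊕ τ) k →ₐ[k] _) =
      (g.comp e₂.toAlgHom).comp e₁.toAlgHom := by
    refine MvPolynomial.algHom_ext fun x => ?_
    rw [MvPolynomial.aeval_X]
    rcases x with x | x
    · change _ = g (e₂ (MvPolynomial.rename _ (MvPolynomial.X _)))
      rw [MvPolynomial.rename_X]
      change _ = g (e₂ (MvPolynomial.X (Sum.inr x)))
      rw [MvPolynomial.sumAlgEquiv_X_inr]
      simp [g]
    · change _ = g (e₂ (MvPolynomial.rename _ (MvPolynomial.X _)))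
      rw [MvPolynomial.rename_X]
      change _ = g (e₂ (MvPolynomial.X (Sum.inl x)))
      rw [MvPolynomial.sumAlgEquiv_X_inl]
      simp [g]
  rw [AlgebraicIndependent, h]
  intro x y hxy
  exact e₁.injective (e₂.injective (hg hxy))

end Steiner

end

noncomputable section

namespace Steiner

/-! ## Generic images -/

section Matrix

variable {K : Type*} [Field K] {m n p : Type*} [Fintype m] [Fintype n]

/-- The image of `Q` lies in the kernel of `N`, and the rank bound makes the dimensions equal. -/
theorem exists_mulVec_eq_iff (N : Matrix p n K) (Q : Matrix n m K) (hNQ : N * Q = 0)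
    (hr : Fintype.card n ≤ Q.rank + N.rank) (v : n → K) :
    (∃ w, Q.mulVec w = v) ↔ N.mulVec v = 0 := by
  have h1 : LinearMap.range Q.mulVecLin ≤ LinearMap.ker N.mulVecLin := by
    rintro _ ⟨w, rfl⟩
    rw [LinearMap.mem_ker, Matrix.mulVecLin_apply, Matrix.mulVecLin_apply, Matrix.mulVec_mulVec,
      hNQ, Matrix.zero_mulVec]
  have h2 := LinearMap.finrank_range_add_finrank_ker N.mulVecLin
  rw [Module.finrank_fintype_fun_eq_card] at h2
  have h3 := Submodule.eq_of_le_of_finrank_le h1 (by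
    change Module.finrank K (LinearMap.ker N.mulVecLin) ≤ Q.rank
    change N.rank + _ = _ at h2
    omega)
  have h4 := SetLike.ext_iff.1 h3 v
  simpa using h4

end Matrix

variable {k : Type u} [Field k] {a b f : ℕ} {K : Type u} [Field K] [Algebra k K]

theorem chartMat_submatrix {R : Type*} [CommRing R] (I : Finset (QuadIdx a))
    (σ : Fin f ≃ {t // t ∈ I}) (c : {t // t ∈ I} × {t // t ∉ I} → R) :
    (chartMat I σ c).submatrix id (fun l => (σ l : QuadIdx a)) = 1 := by
  ext l l'
  simp [chartMat, Matrix.one_apply]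

theorem le_rank_chartMat (I : Finset (QuadIdx a)) (σ : Fin f ≃ {t // t ∈ I})
    (c : {t // t ∈ I} × {t // t ∉ I} → K) : f ≤ (chartMat I σ c).rank := by
  have := le_rank_of_det_submatrix_ne_zero (chartMat I σ c) id (fun l => (σ l : QuadIdx a))
    (by rw [chartMat_submatrix, Matrix.det_one]; exact one_ne_zero)
  simpa using this

theorem isGenericSubspace_iff (Z : Submodule K (Fin a → Laurent K)) :
    IsGenericSubspace k f Z ↔ Z ≤ vecSec K a ∅ 2 ∧
      ∃ (I : Finset (QuadIdx a)) (σ : Fin f ≃ {t // t ∈ I}) (c : {t // t ∈ I} × {t // t ∉ I} → K),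
        AlgebraicIndependent k c ∧
        ∀ v ∈ vecSec K a ∅ 2, v ∈ Z ↔ (chartMat I σ c).mulVec (quadCoord v) = 0 := by
  refine and_congr_right fun _ => ?_
  constructor
  · rintro ⟨I, hI, c, hc, h⟩
    exact ⟨I, (I.equivFinOfCardEq hI).symm, c, hc, fun v hv =>
      (h v hv).trans (chartMat_mulVec_eq_zero_iff _ _ _ _).symm⟩
  · rintro ⟨I, σ, c, hc, h⟩
    exact ⟨I, by simpa using (Fintype.card_congr σ).symm, c, hc, fun v hv =>
      (h v hv).trans (chartMat_mulVec_eq_zero_iff _ _ _ _)⟩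

theorem isGenericSubspace_image_iff (m : Idx a b → K) :
    IsGenericSubspace k f (image m 1) ↔
      ∃ (I : Finset (QuadIdx a)) (σ : Fin f ≃ {t // t ∈ I}) (c : {t // t ∈ I} × {t // t ∉ I} → K),
        AlgebraicIndependent k c ∧
        ∀ v, (∃ w, (quadMat m).mulVec w = v) ↔ (chartMat I σ c).mulVec v = 0 := by
  rw [isGenericSubspace_iff]
  constructor
  · rintro ⟨_, I, σ, c, hc, h⟩
    refine ⟨I, σ, c, hc, fun v => ?_⟩
    have h1 := h ((quadEquiv K a).symm v).1 ((quadEquiv K a).symm v).2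
    have h2 : quadCoord ((quadEquiv K a).symm v).1 = v := (quadEquiv K a).apply_symm_apply v
    rw [mem_image_one_iff _ ((quadEquiv K a).symm v).2, h2] at h1
    exact h1
  · rintro ⟨I, σ, c, hc, h⟩
    exact ⟨image_le m 1, I, σ, c, hc, fun v hv => (mem_image_one_iff _ hv).trans (h _)⟩

theorem isGenericSubspace_image_of_mul_eq_zero (m : Idx a b → K) (I : Finset (QuadIdx a))
    (σ : Fin f ≃ {t // t ∈ I}) (c : {t // t ∈ I} × {t // t ∉ I} → K)
    (hc : AlgebraicIndependent k c) (h : chartMat I σ c * quadMat m = 0)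
    (hr : cokerDim m 1 ≤ f) : IsGenericSubspace k f (image m 1) := by
  refine (isGenericSubspace_image_iff m).2 ⟨I, σ, c, hc, fun v => exists_mulVec_eq_iff _ _ h ?_ v⟩
  have h1 := cokerDim_one_add_rank m
  have h2 := le_rank_chartMat I σ c
  rw [rank_quadMat, card_quadIdx]
  omega

theorem mul_quadMat_eq_zero_of_forall {m : Idx a b → K} {N : Matrix (Fin f) (QuadIdx a) K}
    (h : ∀ v, (∃ w, (quadMat m).mulVec w = v) ↔ N.mulVec v = 0) : N * quadMat m = 0 := by
  classical
  refine Matrix.ext_of_mulVec_single fun y => ?_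
  rw [← Matrix.mulVec_mulVec, Matrix.zero_mulVec]
  exact (h _).1 ⟨_, rfl⟩

/-- Genericity of the image of `m(1)` is inherited by generizations along which the dimension of the
image does not jump. -/
theorem IsGenericSubspace.of_specialization {O K₁ K₂ : Type u} [CommRing O] [Field K₁] [Field K₂]
    [Algebra k O] [Algebra k K₁] [Algebra k K₂] (α : O →ₐ[k] K₁) (β : O →ₐ[k] K₂)
    (hker : ∀ u, α u = 0 → β u = 0) (hunit : ∀ u, β u ≠ 0 → IsUnit u) (m : Idx a b → O)
    (hf : f ≤ cokerDim (fun i => α (m i)) 1)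
    (hβ : IsGenericSubspace k f (image (fun i => β (m i)) 1)) :
    IsGenericSubspace k f (image (fun i => α (m i)) 1) := by
  obtain ⟨I, σ, c, hc, h⟩ := (isGenericSubspace_image_iff _).1 hβ
  have h6 : Fintype.card {t // t ∉ I} + f = 10 * a := by
    rw [← card_quadIdx (a := a), Fintype.card_subtype_compl, ← Fintype.card_congr σ,
      Fintype.card_fin]
    have := Fintype.card_subtype_le (· ∈ I)
    rw [← Fintype.card_congr σ, Fintype.card_fin] at this
    omega
  let Q := quadMat m
  have hQβ : Q.map β = quadMat fun i => β (m i) := quadMat_map (β : O →+* K₂) m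
  have hQα : Q.map α = quadMat fun i => α (m i) := quadMat_map (α : O →+* K₁) m
  rw [← hQβ] at h
  -- A subspace in the chart `I` is a graph over the coordinates off `I`, so the rows of `Q` off `I`
  -- are independent over `K₂`; a nonzero maximal minor lifts to a unit of `O`.
  obtain ⟨t, -, ht⟩ := exists_det_cols_ne_zero ((Q.map β).submatrix
      (Subtype.val : {t // t ∉ I} → QuadIdx a) id)
    (rank_eq_card_of_mulVec_surjective _ fun v => by
      let v' : QuadIdx a → K₂ := fun t =>
        if ht : t ∈ I then ∑ j : {t // t ∉ I}, c (⟨t, ht⟩, j) * v j else v ⟨t, ht⟩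
      have hv' : ∀ j : {t // t ∉ I}, v' j = v j := fun j => dif_neg j.2
      obtain ⟨w, hw⟩ := (h v').2 ((chartMat_mulVec_eq_zero_iff I σ c v').2 fun i => by
        simp only [hv']
        exact dif_pos i.2)
      refine ⟨w, funext fun j => ?_⟩
      rw [← hv' j, ← hw]
      rfl)
  let S := Q.submatrix (Subtype.val : {t // t ∉ I} → QuadIdx a) t
  let T := Q.submatrix (Subtype.val : {t // t ∈ I} → QuadIdx a) t
  have hS : IsUnit S.det := hunit _ (by
    rw [show β S.det = (S.map β).det from RingHom.map_det (β : O →+* K₂) S]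
    exact ht)
  -- The chart coordinates lifted to `O`: `β` sends them to `c`, and `α` sends them to the
  -- coordinates over `K₁`.
  let C : Matrix {t // t ∈ I} {t // t ∉ I} O := T * S⁻¹
  have hC : C * S = T := by
    rw [Matrix.mul_assoc, Matrix.nonsing_inv_mul _ hS, Matrix.mul_one]
  have hCβ : ∀ i j, β (C i j) = c (i, j) := by
    have h1 : C.map β * S.map β = T.map β := by
      rw [← hC]
      exact (Matrix.map_mul (f := (β : O →+* K₂)) (L := C) (M := S)).symm
    have h2 : (Matrix.of fun i j => c (i, j)) * S.map β = T.map β := by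
      ext i y
      have h3 := (chartMat_mulVec_eq_zero_iff I σ c ((Q.map β).mulVec (Pi.single (t y) 1))).1
        ((h _).1 ⟨_, rfl⟩) i
      simp only [Matrix.mulVec_single, MulOpposite.op_one, one_smul] at h3
      exact h3.symm
    have hu : IsUnit (S.map β).det := isUnit_iff_ne_zero.2 ht
    have h4 : C.map β = Matrix.of fun i j => c (i, j) := by
      rw [← Matrix.mul_one (C.map β), ← Matrix.mul_nonsing_inv _ hu, ← Matrix.mul_assoc, h1, ← h2,
        Matrix.mul_assoc, Matrix.mul_nonsing_inv _ hu, Matrix.mul_one]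
    exact fun i j => congrFun (congrFun h4 i) j
  let c' : {t // t ∈ I} × {t // t ∉ I} → K₁ := fun x => α (C x.1 x.2)
  have hc' : AlgebraicIndependent k c' := by
    rw [algebraicIndependent_iff] at hc ⊢
    intro P hP
    apply hc
    have h1 : ∀ {L : Type u} [Field L] [Algebra k L] (γ : O →ₐ[k] L),
        MvPolynomial.aeval (fun x : {t // t ∈ I} × {t // t ∉ I} => γ (C x.1 x.2)) P =
          γ (MvPolynomial.aeval (fun x => C x.1 x.2) P) := by
      intro L _ _ γ
      rw [← AlgHom.comp_apply]
      congr 1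
      ext x
      simp
    rw [show c = fun x => β (C x.1 x.2) from funext fun x => (hCβ x.1 x.2).symm, h1]
    -- A relation between the coordinates over `K₁` specializes to one between the `c`, hence is
    -- trivial.
    exact hker _ ((h1 α).symm.trans hP)
  have hSα : (S.map α).det ≠ 0 := by
    rw [show (S.map α).det = α S.det from (RingHom.map_det (α : O →+* K₁) S).symm]
    exact (hS.map α).ne_zero
  refine isGenericSubspace_image_of_mul_eq_zero _ I σ c' hc' ?_ ?_
  · have h1 : chartMat I σ c' * (Q.map α).submatrix id t = 0 := by
      refine Matrix.ext_of_mulVec_single fun y => ?_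
      rw [← Matrix.mulVec_mulVec, Matrix.zero_mulVec, chartMat_mulVec_eq_zero_iff]
      intro i
      simp only [Matrix.mulVec_single, MulOpposite.op_one, one_smul]
      have := congrArg α (congrFun (congrFun hC i) y)
      rw [Matrix.mul_apply, map_sum] at this
      simp only [map_mul] at this
      exact this.symm
    have h2 : Fintype.card {t // t ∉ I} ≤ ((Q.map α).submatrix id t).rank :=
      le_rank_of_det_submatrix_ne_zero _ Subtype.val id hSα
    have h3 : LinearMap.range ((Q.map α).submatrix id t).mulVecLin ≤
        LinearMap.range (Q.map α).mulVecLin := by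
      rintro _ ⟨w, rfl⟩
      let E : Matrix (Fin b × Fin 4) {t // t ∉ I} K₁ :=
        (1 : Matrix (Fin b × Fin 4) (Fin b × Fin 4) K₁).submatrix id t
      have h4 : (Q.map α).submatrix id t = Q.map α * E := by
        ext x y
        simp [E, Matrix.mul_apply, Matrix.one_apply]
      refine ⟨E.mulVec w, ?_⟩
      rw [Matrix.mulVecLin_apply, Matrix.mulVecLin_apply, h4, Matrix.mulVec_mulVec]
    have h5 := cokerDim_one_add_rank fun i => α (m i)
    rw [← rank_quadMat, ← hQα] at h5
    -- The chosen columns have rank at least `10a − f`, and by `hf` the whole matrix has rank at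
    -- most that, so they span its column space.
    have h7 := Submodule.eq_of_le_of_finrank_le h3 (by
      change (Q.map α).rank ≤ ((Q.map α).submatrix id t).rank
      omega)
    rw [← hQα]
    refine Matrix.ext_of_mulVec_single fun y => ?_
    have h8 : (Q.map α).mulVec (Pi.single y 1) ∈ LinearMap.range (Q.map α).mulVecLin := ⟨_, rfl⟩
    rw [← h7] at h8
    obtain ⟨w, hw⟩ := h8
    rw [← Matrix.mulVec_mulVec, Matrix.zero_mulVec, ← hw, Matrix.mulVecLin_apply,
      Matrix.mulVec_mulVec, h1, Matrix.zero_mulVec]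
  · have h2 := le_rank_of_det_submatrix_ne_zero (Q.map α) Subtype.val t hSα
    have h5 := cokerDim_one_add_rank fun i => α (m i)
    rw [← rank_quadMat, ← hQα] at h5
    omega

/-- Genericity of the image of `m(1)` is inherited by generizations in the same rank stratum. -/
theorem isGenericSubspace_of_specializes {x y : Space k a b} (h : x ⤳ y)
    (hf : f ≤ cokerDim (mat x) 1) (hy : IsGenericSubspace k f (image (mat y) 1)) :
    IsGenericSubspace k f (image (mat x) 1) := by
  have hle : x.asIdeal ≤ y.asIdeal := (PrimeSpectrum.le_iff_specializes x y).2 h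
  -- In this local ring, an element killed in `κ(x)` is not a unit, hence is killed in `κ(y)`, and
  -- an element nonzero in `κ(y)` is a unit: the two hypotheses of
  -- `IsGenericSubspace.of_specialization`.
  let O := Localization.AtPrime y.asIdeal
  have hu : ∀ s : y.asIdeal.primeCompl,
      IsUnit (Algebra.ofId (MvPolynomial (Idx a b) k) (kappa x) s) := fun s => by
    refine isUnit_iff_ne_zero.2 fun h0 => s.2 (hle ?_)
    exact Ideal.algebraMap_residueField_eq_zero.1 h0
  let α : O →ₐ[MvPolynomial (Idx a b) k] kappa x :=
    IsLocalization.liftAlgHom (M := y.asIdeal.primeCompl) hu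
  let β : O →ₐ[MvPolynomial (Idx a b) k] kappa y := IsScalarTower.toAlgHom _ O (kappa y)
  have hβ : ∀ u, β u = 0 ↔ ¬ IsUnit u := fun u =>
    (IsLocalRing.residue_eq_zero_iff u).trans (IsLocalRing.mem_maximalIdeal u)
  have h1 := IsGenericSubspace.of_specialization (f := f) (α.restrictScalars k)
    (β.restrictScalars k) (fun u hu0 => (hβ u).2 fun hu' => (hu'.map α).ne_zero hu0)
    (fun u hu0 => not_not.1 fun h' => hu0 ((hβ u).2 h'))
    (fun i => algebraMap (MvPolynomial (Idx a b) k) O (MvPolynomial.X i))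
  have h2 : (fun i => (α.restrictScalars k) (algebraMap (MvPolynomial (Idx a b) k) O
      (MvPolynomial.X i))) = mat x := funext fun i => α.commutes _
  have h3 : (fun i => (β.restrictScalars k) (algebraMap (MvPolynomial (Idx a b) k) O
      (MvPolynomial.X i))) = mat y := funext fun i => β.commutes _
  rw [h2, h3] at h1
  exact h1 hf hy

end Steiner

end

noncomputable section

namespace Steiner

/-! ## Coordinates of the subspaces `Z^*` and of extensions of scalars -/

section Coordinates

variable {K : Type u} [Field K] {n : ℕ} {t : ℤ} {ι : Type*}

/-- Monomial coordinates, indexed by `e`. -/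
def coordOn (e : ι ≃ Fin n × Mon t) (v : Fin n → Laurent K) : ι → K :=
  fun x => (v (e x).1).coeff (e x).2.1

theorem eq_of_coordOn_eq (e : ι ≃ Fin n × Mon t) {v w : Fin n → Laurent K}
    (hv : v ∈ vecSec K n ∅ t) (hw : w ∈ vecSec K n ∅ t) (h : coordOn e v = coordOn e w) : v = w := by
  have : (⟨v, hv⟩ : vecSec K n ∅ t) = ⟨w, hw⟩ := by
    apply (vecEquiv K n t).injective
    ext x
    have := congrFun h (e.symm x)
    simp only [coordOn, Equiv.apply_symm_apply] at this
    exact this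
  exact congrArg Subtype.val this

theorem exists_coordOn_eq (e : ι ≃ Fin n × Mon t) (g : ι → K) :
    ∃ v ∈ vecSec K n ∅ t, coordOn e v = g := by
  refine ⟨((vecEquiv K n t).symm fun x => g (e.symm x)).1, Subtype.property _, ?_⟩
  ext x
  have := congrFun ((vecEquiv K n t).apply_symm_apply fun x => g (e.symm x)) (e x)
  rw [Equiv.symm_apply_apply] at this
  exact this

theorem coordOn_sum_smul (e : ι ≃ Fin n × Mon t) {κ : Type*} (s : Finset κ) (c : κ → K)
    (v : κ → Fin n → Laurent K) :
    coordOn e (∑ x ∈ s, c x • v x) = ∑ x ∈ s, c x • coordOn e (v x) := by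
  classical
  induction s using Finset.induction_on with
  | empty => rfl
  | insert x s hx ih => rw [Finset.sum_insert hx, Finset.sum_insert hx, ← ih]; rfl

variable {L : Type u} [Field L] [Algebra K L]

theorem coordOn_mapRingHom (e : ι ≃ Fin n × Mon t) (v : Fin n → Laurent K) :
    coordOn e (fun i => AddMonoidAlgebra.mapRingHom (Fin 4 → ℤ) (algebraMap K L) (v i)) =
      fun x => algebraMap K L (coordOn e v x) := by
  ext x
  exact AddMonoidAlgebra.coeff_mapRingHom _ _ _

theorem mapRingHom_mem_vecSec {I : Finset (Fin 4)} {v : Fin n → Laurent K}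
    (hv : v ∈ vecSec K n I t) :
    (fun i => AddMonoidAlgebra.mapRingHom (Fin 4 → ℤ) (algebraMap K L) (v i)) ∈
      vecSec L n I t := by
  intro i _ e he
  refine hv i trivial e fun h => he ?_
  rw [AddMonoidAlgebra.coeff_mapRingHom, h, map_zero]

/-- The extension of scalars of the kernel of a matrix with a right inverse. -/
theorem mem_extend_iff [Fintype ι] [DecidableEq ι] {p : Type*} [Fintype p] [DecidableEq p]
    (e : ι ≃ Fin n × Mon t)
    {Z : Submodule K (Fin n → Laurent K)} (hZ : Z ≤ vecSec K n ∅ t) (N : Matrix p ι K)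
    (P : Matrix ι p K) (hNP : N * P = 1)
    (h : ∀ v ∈ vecSec K n ∅ t, v ∈ Z ↔ N.mulVec (coordOn e v) = 0) (v : Fin n → Laurent L) :
    v ∈ extend L Z ↔ v ∈ vecSec L n ∅ t ∧ (N.map (algebraMap K L)).mulVec (coordOn e v) = 0 := by
  constructor
  · intro hv
    induction hv using Submodule.span_induction with
    | mem v hv =>
      obtain ⟨v, hv, rfl⟩ := hv
      refine ⟨mapRingHom_mem_vecSec (hZ hv), ?_⟩
      rw [coordOn_mapRingHom]
      have h1 := (h v (hZ hv)).1 hv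
      ext x
      have h2 := congrFun h1 x
      have h3 := RingHom.map_mulVec (algebraMap K L) N (coordOn e v) x
      rw [h2] at h3
      exact h3.symm.trans (map_zero _)
    | zero => exact ⟨Submodule.zero_mem _, Matrix.mulVec_zero _⟩
    | add x y _ _ hx hy =>
      refine ⟨Submodule.add_mem _ hx.1 hy.1, ?_⟩
      rw [show coordOn e (x + y) = coordOn e x + coordOn e y from rfl, Matrix.mulVec_add, hx.2,
        hy.2, add_zero]
    | smul c x _ hx =>
      refine ⟨Submodule.smul_mem _ _ hx.1, ?_⟩
      rw [show coordOn e (c • x) = c • coordOn e x from rfl, Matrix.mulVec_smul, hx.2, smul_zero]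
  · rintro ⟨hv, h0⟩
    -- A projector onto the kernel of `N`, defined over `K`: its columns lie in `Z`, and over `L` it
    -- fixes every vector of the extended kernel.
    let D : Matrix ι ι K := 1 - P * N
    have hD : N * D = 0 := by
      rw [Matrix.mul_sub, ← Matrix.mul_assoc, hNP, Matrix.one_mul, Matrix.mul_one, sub_self]
    choose u hu hu' using fun z : ι => exists_coordOn_eq (K := K) e (D.col z)
    have huZ : ∀ z, u z ∈ Z := fun z => (h _ (hu z)).2 (by
      rw [hu']
      ext x
      exact congrFun (congrFun hD x) z)
    have h1 : v = ∑ z, coordOn e v z •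
        fun i => AddMonoidAlgebra.mapRingHom (Fin 4 → ℤ) (algebraMap K L) (u z i) := by
      refine eq_of_coordOn_eq e hv (Submodule.sum_mem _ fun z _ =>
        Submodule.smul_mem _ _ (mapRingHom_mem_vecSec (hu z))) ?_
      rw [coordOn_sum_smul]
      simp only [coordOn_mapRingHom, hu']
      have h2 : (D.map (algebraMap K L)).mulVec (coordOn e v) = coordOn e v := by
        have h3 : D.map (algebraMap K L) = 1 - P.map (algebraMap K L) * N.map (algebraMap K L) := by
          rw [← Matrix.map_mul, Matrix.map_sub _ (map_sub _),
            Matrix.map_one _ (map_zero _) (map_one _)]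
        rw [h3, Matrix.sub_mulVec, Matrix.one_mulVec, ← Matrix.mulVec_mulVec, h0,
          Matrix.mulVec_zero, sub_zero]
      conv_lhs => rw [← h2]
      ext x
      rw [Finset.sum_apply, Matrix.mulVec, dotProduct]
      refine Finset.sum_congr rfl fun z _ => ?_
      rw [Pi.smul_apply, smul_eq_mul, mul_comm]
      rfl
    rw [h1]
    exact Submodule.sum_mem _ fun z _ => Submodule.smul_mem _ _
      (Submodule.subset_span ⟨u z, huZ z, rfl⟩)

end Coordinates

section Star

variable {K : Type u} [Field K] {a b f : ℕ}

/-- The indexing of the monomials of degree two. -/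
abbrev quadIndex (a : ℕ) : QuadIdx a ≃ Fin a × Mon 2 :=
  Equiv.prodCongr (Equiv.refl _) (Equiv.ofBijective _ monTwo_bijective)

/-- The indexing of the monomials of degree one. -/
abbrev linIndex (a : ℕ) : Fin a × Fin 4 ≃ Fin a × Mon 1 :=
  Equiv.prodCongr (Equiv.refl _) (Equiv.ofBijective _ monOne_bijective)

theorem coordOn_quadIndex (v : Fin a → Laurent K) : coordOn (quadIndex a) v = quadCoord v := rfl

theorem coordOn_linIndex (v : Fin a → Laurent K) (i : Fin a) (p : Fin 4) :
    coordOn (linIndex a) v (i, p) = (v i).coeff (Pi.single p 1) := rfl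

/-- Views a vector `y` of `A ⊗ V` as a morphism with `b = 1`, so that the criterion for morphisms
applies to `Z^*`. -/
theorem mulMap_const {y : Fin a → Laurent K} (hy : y ∈ vecSec K a ∅ 1) (l : Laurent K) :
    mulMap (fun x : Idx a 1 => coordOn (linIndex a) y (x.1, x.2.2)) (fun _ => l) = l • y := by
  have h1 : (fun i => linForm (fun x : Idx a 1 => coordOn (linIndex a) y (x.1, x.2.2)) i 0) = y := by
    refine eq_of_coordOn_eq (linIndex a) (fun i _ => linForm_mem _ _ _ _) hy ?_
    ext ⟨i, p⟩
    rw [coordOn_linIndex, linForm, AddMonoidAlgebra.coeff_sum, Finsupp.coe_finsetSum,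
      Finset.sum_apply, Finset.sum_eq_single p]
    · simp
    · intro q _ hq
      rw [AddMonoidAlgebra.coeff_single, Finsupp.single_apply, if_neg]
      intro h
      have := congrFun h q
      simp [hq] at this
    · simp
  ext i : 1
  rw [mulMap_apply, Fin.sum_univ_one, congrFun h1 i, mul_comm]
  rfl

/-- The functionals `φ` kill `V · y` exactly when all their contractions kill `y`. -/
theorem mem_star_iff {Z : Submodule K (Fin a → Laurent K)} (φ : Matrix (Fin f) (QuadIdx a) K)
    (h : ∀ v ∈ vecSec K a ∅ 2, v ∈ Z ↔ φ.mulVec (quadCoord v) = 0) (y : Fin a → Laurent K) :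
    y ∈ star Z ↔ y ∈ vecSec K a ∅ 1 ∧ (contr φ).mulVec (coordOn (linIndex a) y) = 0 := by
  refine and_congr_right fun hy => ?_
  set m : Idx a 1 → K := fun x => coordOn (linIndex a) y (x.1, x.2.2) with hm
  have h0 : ∀ l (hl : l ∈ sec K ∅ 1), l • y ∈ Z ↔
      φ.mulVec ((quadMat m).mulVec (linEquiv K 1 ⟨fun _ => l, fun _ _ => hl⟩)) = 0 := by
    intro l hl
    rw [← quadCoord_mulMap, mulMap_const hy]
    refine h _ fun i _ => ?_
    exact mul_mem_sec hl (hy i trivial)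
  have h1 : φ * quadMat m = 0 ↔ (contr φ).mulVec (coordOn (linIndex a) y) = 0 := by
    rw [mul_quadMat_eq_zero_iff]
    have h2 : ∀ x (j : Fin 1), (contr φ * cellMat m) x j =
        (contr φ).mulVec (coordOn (linIndex a) y) x := fun x j => rfl
    constructor
    · intro h3
      ext x
      rw [← h2 x 0, h3]; rfl
    · intro h3
      ext x j
      rw [h2, h3]; rfl
  rw [← h1]
  constructor
  · intro h2
    refine Matrix.ext_of_mulVec_single fun x => ?_
    let v := (linEquiv K 1).symm (Pi.single x 1)
    have hv : (⟨fun _ => v.1 0, fun _ _ => v.2 0 trivial⟩ : vecSec K 1 ∅ 1) = v := by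
      apply Subtype.ext
      funext i
      rw [Subsingleton.elim i 0]
    have h3 := (h0 (v.1 0) (v.2 0 trivial)).1 (h2 _ (v.2 0 trivial))
    rw [hv, LinearEquiv.apply_symm_apply, Matrix.mulVec_mulVec] at h3
    rw [h3, Matrix.zero_mulVec]
  · intro h2 l hl
    rw [h0 l hl, Matrix.mulVec_mulVec, h2, Matrix.zero_mulVec]

theorem codimIn_star {Z : Submodule K (Fin a → Laurent K)} (φ : Matrix (Fin f) (QuadIdx a) K)
    (h : ∀ v ∈ vecSec K a ∅ 2, v ∈ Z ↔ φ.mulVec (quadCoord v) = 0) :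
    codimIn (star Z) (vecSec K a ∅ 1) = (contr φ).rank := by
  let g : vecSec K a ∅ 1 →ₗ[K] (Fin f × Fin 4 → K) :=
    (contr φ).mulVecLin ∘ₗ (linEquiv K a).toLinearMap
  have h1 : (star Z).submoduleOf (vecSec K a ∅ 1) = LinearMap.ker g := by
    ext y
    rw [LinearMap.mem_ker]
    exact (mem_star_iff φ h y.1).trans ⟨fun h => h.2, fun h => ⟨y.2, h⟩⟩
  have h2 : LinearMap.range g = LinearMap.range (contr φ).mulVecLin := by
    rw [LinearMap.range_comp, LinearEquiv.range, Submodule.map_top]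
  rw [codimIn, h1, (LinearMap.quotKerEquivRange g).finrank_eq, h2, Matrix.rank]

theorem coordOn_mulMap_zero (m : Idx a b → K) {w : Fin b → Laurent K} (hw : w ∈ vecSec K b ∅ 0) :
    coordOn (linIndex a) (mulMap m w) = (cellMat m).mulVec fun j => (w j).coeff 0 := by
  ext ⟨i, p⟩
  rw [coordOn_linIndex, coeff_mulMap, Matrix.mulVec, dotProduct]
  refine Finset.sum_congr rfl fun j _ => ?_
  rw [Finset.sum_eq_single p]
  · rw [sub_self]; rfl
  · intro q _ hq
    rw [coeff_eq_zero_of_mem_sec (hw j trivial), mul_zero]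
    rintro ⟨-, h⟩
    have := h q
    simp [hq] at this
  · simp

end Star

end Steiner

end

noncomputable section

namespace Steiner

variable {k : Type u} [Field k] {a b f : ℕ}

/-! ## The generic morphism -/

/-- Over a field the cleared denominator can be absorbed: apply `smul_eq_param` to `d⁻¹ • m`. -/
theorem exists_eq_param {K : Type*} [Field K] {J : Fin f × Fin 4 → Fin a × Fin 4}
    (hJ : Function.Injective J) {φ : Matrix (Fin f) (QuadIdx a) K} (hd : (contrSub J φ).det ≠ 0)
    {m : Idx a b → K} (hm : contr φ * cellMat m = 0) : ∃ w, m = param J φ w := by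
  set d := (contrSub J φ).det with hd'
  have h1 : contr φ * cellMat (d⁻¹ • m) = 0 := by
    rw [show cellMat (d⁻¹ • m) = d⁻¹ • cellMat m from rfl, Matrix.mul_smul, hm, smul_zero]
  refine ⟨_, funext fun x => Eq.trans ?_ (smul_eq_param J hJ h1 x)⟩
  rw [Pi.smul_apply, smul_eq_mul, ← hd', mul_inv_cancel_left₀ hd]

theorem aeval_mat (x : Space k a b) (g : MvPolynomial (Idx a b) k) :
    MvPolynomial.aeval (mat x) g = algebraMap _ (kappa x) g := by
  have : (MvPolynomial.aeval (mat x) : MvPolynomial (Idx a b) k →ₐ[k] kappa x) =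
      IsScalarTower.toAlgHom k (MvPolynomial (Idx a b) k) (kappa x) := by
    refine MvPolynomial.algHom_ext fun i => ?_
    rw [MvPolynomial.aeval_X]
    rfl
  rw [this]
  rfl

theorem aeval_mat_eq_zero_iff (x : Space k a b) (g : MvPolynomial (Idx a b) k) :
    MvPolynomial.aeval (mat x) g = 0 ↔ g ∈ x.asIdeal := by
  rw [aeval_mat, Ideal.algebraMap_residueField_eq_zero]

variable (k b) in
/-- The generic morphism annihilated by `f` generic functionals. -/
def genPoint (J : Fin f × Fin 4 → Fin a × Fin 4) : Space k a b :=
  ⟨RingHom.ker (genHom k b J), RingHom.ker_isPrime _⟩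

theorem mem_genPoint (J : Fin f × Fin 4 → Fin a × Fin 4) (g : MvPolynomial (Idx a b) k) :
    g ∈ (genPoint k b J).asIdeal ↔ genHom k b J g = 0 := Iff.rfl

variable {J : Fin f × Fin 4 → Fin a × Fin 4}

/-- A morphism annihilated by functionals with nonzero minor is a specialization of the generic
one. -/
theorem genPoint_le_of_contr_mul (hJ : Function.Injective J) {x : Space k a b}
    {φ : Matrix (Fin f) (QuadIdx a) (kappa x)} (hd : (contrSub J φ).det ≠ 0)
    (h : contr φ * cellMat (mat x) = 0) : genPoint k b J ≤ x := by
  intro g hg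
  obtain ⟨w, hw⟩ := exists_eq_param hJ hd h
  rw [← aeval_mat_eq_zero_iff, hw, ← aeval_genHom, (mem_genPoint J g).1 hg, map_zero]

/-- The minor that is nonzero at `φ₀` is nonzero on the functionals defining a generic image, so `x`
is a value of the parametrization. No condition on `x` beyond the generic image is needed. -/
theorem genPoint_le [Infinite k] (hJ : Function.Injective J)
    {φ₀ : Matrix (Fin f) (QuadIdx a) k} (hφ₀ : (contrSub J φ₀).det ≠ 0) {x : Space k a b}
    (hx : IsGenericSubspace k f (image (mat x) 1)) : genPoint k b J ≤ x := by
  obtain ⟨I, σ, c, hc, h⟩ := (isGenericSubspace_image_iff _).1 hx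
  exact genPoint_le_of_contr_mul hJ (det_contrSub_chartMat_ne_zero J φ₀ hφ₀ I σ c hc)
    ((mul_quadMat_eq_zero_iff _ _).1 (mul_quadMat_eq_zero_of_forall h))

theorem exists_chart (hJ : Function.Injective J) :
    ∃ I : Finset (QuadIdx a), Nonempty (Fin f ≃ {t // t ∈ I}) := by
  have h1 := Fintype.card_le_of_injective J hJ
  simp only [Fintype.card_prod, Fintype.card_fin] at h1
  obtain ⟨I, -, hI⟩ := Finset.exists_subset_card_eq (s := (Finset.univ : Finset (QuadIdx a)))
    (n := f) (by rw [Finset.card_univ, card_quadIdx]; omega)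
  exact ⟨I, ⟨(I.equivFinOfCardEq hI).symm⟩⟩

theorem exists_algebraicIndependent_sumElim (k : Type u) [Field k] (σ τ : Type) :
    ∃ (c : σ → FractionRing (MvPolynomial (σ ⊕ τ) k))
      (w : τ → FractionRing (MvPolynomial (σ ⊕ τ) k)), AlgebraicIndependent k (Sum.elim c w) := by
  let S := MvPolynomial (σ ⊕ τ) k
  let ι : S →ₐ[k] FractionRing S := IsScalarTower.toAlgHom k S (FractionRing S)
  have h1 : AlgebraicIndependent k fun x => ι (MvPolynomial.X x) :=
    (MvPolynomial.algebraicIndependent_X _ k).map' (IsFractionRing.injective S (FractionRing S))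
  refine ⟨fun x => ι (MvPolynomial.X (Sum.inl x)), fun x => ι (MvPolynomial.X (Sum.inr x)), ?_⟩
  convert h1 using 1
  ext x
  rcases x with x | x <;> rfl

/-- Chart independence embeds `κ(μ)` in the field `F` of rational functions in independent `(c, w)`.
Over `F` the image is cut out by the chart functionals with coordinates `c`; genericity then
descends to `κ(μ)`, as the case of `IsGenericSubspace.of_specialization` where `O` is the field
`κ(μ)`. -/
theorem isGenericSubspace_genPoint [Infinite k] (hJ : Function.Injective J)
    (hf : cokerDim (mat (genPoint k b J)) 1 = f) :
    IsGenericSubspace k f (image (mat (genPoint k b J)) 1) := by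
  obtain ⟨I, ⟨σ⟩⟩ := exists_chart hJ
  let F := FractionRing (MvPolynomial (({t // t ∈ I} × {t // t ∉ I}) ⊕ Wdx J b) k)
  obtain ⟨c, w, hcw⟩ := exists_algebraicIndependent_sumElim k ({t // t ∈ I} × {t // t ∉ I})
    (Wdx J b)
  have hc : AlgebraicIndependent k c := hcw.comp Sum.inl Sum.inl_injective
  let g : MvPolynomial (Idx a b) k →ₐ[k] F := MvPolynomial.aeval (param J (chartMat I σ c) w)
  have hg : ∀ x, g x = 0 ↔ x ∈ (genPoint k b J).asIdeal := fun x =>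
    aeval_param_eq_zero_iff J I σ c w hcw x
  let β : kappa (genPoint k b J) →ₐ[k] F := Ideal.ResidueField.liftₐ _ g
    (fun x hx => (hg x).2 hx) (fun x hx => isUnit_iff_ne_zero.2 fun h => hx ((hg x).1 h))
  have hβm : (fun i => β (mat (genPoint k b J) i)) = param J (chartMat I σ c) w := by
    ext i
    refine (Ideal.ResidueField.liftₐ_algebraMap _ g _ _ _).trans ?_
    exact MvPolynomial.aeval_X _ _
  refine IsGenericSubspace.of_specialization (AlgHom.id k _) β
    (fun u hu => by rw [show u = 0 from hu, map_zero])
    (fun u hu => isUnit_iff_ne_zero.2 fun h => hu (by rw [h, map_zero]))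
    (mat (genPoint k b J)) hf.ge ?_
  refine isGenericSubspace_image_of_mul_eq_zero _ I σ c hc ?_ ?_
  · rw [hβm]
    exact (mul_quadMat_eq_zero_iff _ _).2 (contr_mul_param J _ _)
  · have h1 := cokerDim_one_add_rank fun i => β (mat (genPoint k b J) i)
    have h2 := cokerDim_one_add_rank (mat (genPoint k b J))
    have h3 := rank_map_ringHom (β : kappa (genPoint k b J) →+* F)
      (degMat (mat (genPoint k b J)) 1)
    rw [degMat_map] at h3
    change (degMat (fun i => β (mat (genPoint k b J) i)) 1).rank = _ at h3
    omega

/-! ### The linear space `Hom(B, Z^*)` over an extension `L`. -/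

section BaseChange

variable {L : Type u} [Field L] [Algebra k L]

/-- The generic morphism annihilated by given functionals. -/
def fibrePoint (b : ℕ) (J : Fin f × Fin 4 → Fin a × Fin 4) (φ : Matrix (Fin f) (QuadIdx a) L) :
    Space L a b :=
  ⟨RingHom.ker (MvPolynomial.aeval (param J (φ.map MvPolynomial.C) MvPolynomial.X) :
    MvPolynomial (Idx a b) L →ₐ[L] MvPolynomial (Wdx J b) L), RingHom.ker_isPrime _⟩

theorem mem_fibrePoint (φ : Matrix (Fin f) (QuadIdx a) L) (g : MvPolynomial (Idx a b) L) :
    g ∈ (fibrePoint b J φ).asIdeal ↔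
      MvPolynomial.aeval (param J (φ.map MvPolynomial.C)
        (MvPolynomial.X : Wdx J b → MvPolynomial (Wdx J b) L)) g = 0 := Iff.rfl

variable (b) in
/-- The linear equations of the space of morphisms annihilated by `φ`. -/
def linRel (φ : Matrix (Fin f) (QuadIdx a) L) :
    Matrix (Fin f × Fin 4) (Fin b) (MvPolynomial (Idx a b) L) :=
  contr (R := MvPolynomial (Idx a b) L) (φ.map MvPolynomial.C) *
    cellMat (R := MvPolynomial (Idx a b) L) MvPolynomial.X

theorem contr_mul_cellMat_mat_eq_zero_iff (x : Space L a b) (φ : Matrix (Fin f) (QuadIdx a) L) :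
    contr (φ.map (algebraMap L (kappa x))) * cellMat (mat x) = 0 ↔
      ∀ y j, linRel b φ y j ∈ x.asIdeal := by
  have h : contr (φ.map (algebraMap L (kappa x))) * cellMat (mat x) =
      (linRel b φ).map (algebraMap (MvPolynomial (Idx a b) L) (kappa x)) := by
    rw [linRel, Matrix.map_mul]
    rfl
  rw [h]
  constructor
  · intro h0 y j
    exact Ideal.algebraMap_residueField_eq_zero.1 (congrFun (congrFun h0 y) j)
  · intro h0
    ext y j
    exact Ideal.algebraMap_residueField_eq_zero.2 (h0 y j)

/-- Every solution of the linear equations, over any residue field, is a value of the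
parametrization with `φ` fixed; hence the solution locus is the closure of one point. -/
theorem fibrePoint_le_iff (hJ : Function.Injective J) {φ : Matrix (Fin f) (QuadIdx a) L}
    (hd : (contrSub J φ).det ≠ 0) (x : Space L a b) :
    fibrePoint b J φ ≤ x ↔ contr (φ.map (algebraMap L (kappa x))) * cellMat (mat x) = 0 := by
  constructor
  · intro h
    rw [contr_mul_cellMat_mat_eq_zero_iff]
    intro y j
    apply h
    rw [mem_fibrePoint]
    set ε : MvPolynomial (Idx a b) L →ₐ[L] MvPolynomial (Wdx J b) L :=
      MvPolynomial.aeval (param J (φ.map MvPolynomial.C) MvPolynomial.X) with hε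
    have h1 : (linRel b φ).map (ε : _ →+* MvPolynomial (Wdx J b) L) =
        contr (R := MvPolynomial (Wdx J b) L) (φ.map MvPolynomial.C) *
          cellMat (R := MvPolynomial (Wdx J b) L) (param J (φ.map MvPolynomial.C)
            MvPolynomial.X) := by
      rw [linRel, Matrix.map_mul]
      congr 1
      · ext y z : 1
        exact ε.commutes _
      · ext z j : 1
        exact MvPolynomial.aeval_X _ _
    rw [contr_mul_param] at h1
    exact congrFun (congrFun h1 y) j
  · intro h g hg
    have hd' : (contrSub J (φ.map (algebraMap L (kappa x)))).det ≠ 0 := by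
      rw [← det_contrSub_map]
      exact (map_ne_zero _).2 hd
    obtain ⟨w, hw⟩ := exists_eq_param hJ hd' h
    rw [← aeval_mat_eq_zero_iff, hw]
    have h2 : (MvPolynomial.aeval (param J (φ.map (algebraMap L (kappa x))) w) :
        MvPolynomial (Idx a b) L →ₐ[L] kappa x) =
        (MvPolynomial.aeval w).comp (MvPolynomial.aeval (param J (φ.map MvPolynomial.C)
          (MvPolynomial.X : Wdx J b → MvPolynomial (Wdx J b) L))) := by
      refine MvPolynomial.algHom_ext fun i => ?_
      rw [AlgHom.comp_apply, MvPolynomial.aeval_X, MvPolynomial.aeval_X]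
      have h3 := param_map J ((MvPolynomial.aeval w :
        MvPolynomial (Wdx J b) L →ₐ[L] kappa x) : _ →+* kappa x) (φ.map MvPolynomial.C)
        MvPolynomial.X i
      refine Eq.trans ?_ h3.symm
      congr 1
      · ext l t
        simp
      · ext y
        simp
    rw [h2, AlgHom.comp_apply, (mem_fibrePoint φ g).1 hg, map_zero]

/-- The coordinates `c` and the variables over `L` are jointly independent over `k`, so the
contracted ideal is computed by `aeval_param_eq_zero_iff` with values in `L[w]`. -/
theorem toBase_fibrePoint [Infinite k] (I : Finset (QuadIdx a)) (σ : Fin f ≃ {t // t ∈ I})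
    {c : {t // t ∈ I} × {t // t ∉ I} → L} (hc : AlgebraicIndependent k c) :
    toBase k (fibrePoint b J (chartMat I σ c)) = genPoint k b J := by
  ext g
  have h1 := aeval_param_eq_zero_iff (k := k) (b := b) J I σ (fun i => MvPolynomial.C (c i)) MvPolynomial.X
    (algebraicIndependent_sumElim_X (τ := Wdx J b) hc) g
  rw [mem_genPoint, ← h1]
  change MvPolynomial.aeval _ (MvPolynomial.map (algebraMap k L) g) = 0 ↔ _
  rw [MvPolynomial.aeval_map_algebraMap, chartMat_map]

theorem le_rank_residueField_iff {R : Type*} [CommRing R] {m n : Type*} [Fintype m] [Fintype n]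
    (M : Matrix m n R) (x : PrimeSpectrum R) (r : ℕ) :
    r ≤ (M.map (algebraMap R x.asIdeal.ResidueField)).rank ↔
      ∃ (s : Fin r → m) (t : Fin r → n), (M.submatrix s t).det ∉ x.asIdeal := by
  rw [le_rank_iff]
  refine exists_congr fun s => exists_congr fun t => ?_
  rw [Matrix.submatrix_map,
    show ((M.submatrix s t).map (algebraMap R x.asIdeal.ResidueField)).det =
      algebraMap R x.asIdeal.ResidueField (M.submatrix s t).det from (RingHom.map_det _ _).symm,
    ne_eq, Ideal.algebraMap_residueField_eq_zero]

theorem degMat_mat (x : Space k a b) (t : ℤ) :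
    degMat (mat x) t = (degMat (MvPolynomial.X : Idx a b → MvPolynomial (Idx a b) k) t).map
      (algebraMap _ (kappa x)) := (degMat_map _ _ _).symm

/-- The minors of the universal matrix have coefficients in `k`, so the same minors lie in a prime
and in its contraction. -/
theorem rank_degMat_toBase (x : Space L a b) (t : ℤ) :
    (degMat (mat (toBase k x)) t).rank = (degMat (mat x) t).rank := by
  refine eq_of_forall_le_iff fun r => ?_
  rw [degMat_mat, degMat_mat, le_rank_residueField_iff, le_rank_residueField_iff]
  refine exists_congr fun s => exists_congr fun t' => not_congr ?_
  change MvPolynomial.map (algebraMap k L) _ ∈ x.asIdeal ↔ _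
  rw [RingHom.map_det, RingHom.mapMatrix_apply, ← Matrix.submatrix_map, degMat_map]
  simp only [MvPolynomial.map_X]

theorem mem_homLocus_iff {Z : Submodule L (Fin a → Laurent L)} {φ : Matrix (Fin f) (QuadIdx a) L}
    (h : ∀ v ∈ vecSec L a ∅ 2, v ∈ Z ↔ φ.mulVec (quadCoord v) = 0)
    (hd : (contrSub J φ).det ≠ 0) (x : Space L a b) :
    x ∈ homLocus b (star Z) ↔
      contr (φ.map (algebraMap L (kappa x))) * cellMat (mat x) = 0 := by
  have h1 : contr φ * (inclMat J L * (contrSub J φ)⁻¹) = 1 := by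
    rw [← Matrix.mul_assoc, mul_inclMat, Matrix.mul_nonsing_inv _ (isUnit_iff_ne_zero.2 hd)]
  have h2 := mem_extend_iff (L := kappa x) (linIndex a) (Z := star Z) (fun y hy => hy.1) (contr φ) _ h1
    (fun v hv => (mem_star_iff φ h v).trans (and_iff_right hv))
  rw [contr_map] at h2
  constructor
  · intro hx
    refine Matrix.ext_of_mulVec_single fun j => ?_
    let w : Fin b → Laurent (kappa x) := fun i => AddMonoidAlgebra.single 0 ((Pi.single j 1 : Fin b → kappa x) i)
    have hw : w ∈ vecSec (kappa x) b ∅ 0 := fun i _ => single_mem_sec _ (by simp) (by simp)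
    have h3 := ((h2 _).1 (hx ((mem_image_iff (mat x) 0 _).2 ⟨w, hw, rfl⟩))).2
    rw [coordOn_mulMap_zero _ hw, Matrix.mulVec_mulVec] at h3
    rw [Matrix.zero_mulVec, ← h3]
    congr 1
    ext i
    simp [w]
  · intro h3 v hv
    obtain ⟨w, hw, rfl⟩ := (mem_image_iff (mat x) 0 _).1 hv
    refine (h2 _).2 ⟨mulMap_mem (mat x) ∅ 0 w hw, ?_⟩
    rw [coordOn_mulMap_zero _ hw, Matrix.mulVec_mulVec, h3, Matrix.zero_mulVec]

theorem isGenericMorphism_genPoint [Infinite k] (hJ : Function.Injective J)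
    {φ₀ : Matrix (Fin f) (QuadIdx a) k} (hφ₀ : (contrSub J φ₀).det ≠ 0)
    (hf : cokerDim (mat (genPoint k b J)) 1 = f) : IsGenericMorphism f (genPoint k b J) := by
  refine ⟨isGenericSubspace_genPoint hJ hf, fun L _ _ Z hZ => ?_⟩
  obtain ⟨hZ2, I, σ, c, hc, h⟩ := (isGenericSubspace_iff Z).1 hZ
  have hd := det_contrSub_chartMat_ne_zero J φ₀ hφ₀ I σ c hc
  refine ⟨?_, fibrePoint b J (chartMat I σ c), ?_, toBase_fibrePoint I σ hc, ?_⟩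
  · rw [codimIn_star _ h]
    have h1 := le_rank_of_det_submatrix_ne_zero _ id J hd
    have h2 := Matrix.rank_le_card_height (contr (chartMat I σ c))
    simp only [Fintype.card_prod, Fintype.card_fin] at h1 h2
    omega
  · ext x
    rw [mem_homLocus_iff h hd, ← fibrePoint_le_iff hJ hd, ← specializes_iff_mem_closure,
      PrimeSpectrum.le_iff_specializes]
  · set ν := fibrePoint b J (chartMat I σ c)
    -- The corank at `ν` is the one at its image `μ`; this upgrades the inclusion of `Im ν(1)` in
    -- `Z` to an equality.
    have h1 : cokerDim (mat ν) 1 = f := by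
      have h2 := cokerDim_one_add_rank (mat ν)
      have h3 := cokerDim_one_add_rank (mat (toBase k ν))
      rw [rank_degMat_toBase, toBase_fibrePoint I σ hc, hf] at h3
      omega
    have h2 := (fibrePoint_le_iff hJ hd ν).1 le_rfl
    rw [← mul_quadMat_eq_zero_iff, chartMat_map] at h2
    let P : Matrix (QuadIdx a) (Fin f) L :=
      (1 : Matrix (QuadIdx a) (QuadIdx a) L).submatrix id fun l => (σ l : QuadIdx a)
    have hP : chartMat I σ c * P = 1 := by
      rw [← chartMat_submatrix I σ c]
      ext l l'
      simp [P, Matrix.mul_apply, Matrix.one_apply]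
    ext v
    rw [mem_extend_iff (quadIndex a) hZ2 (chartMat I σ c) P hP h, chartMat_map]
    constructor
    · intro hv
      have hv2 := image_le _ _ hv
      refine ⟨hv2, ?_⟩
      obtain ⟨w, hw⟩ := (mem_image_one_iff _ hv2).1 hv
      rw [coordOn_quadIndex, ← hw, Matrix.mulVec_mulVec, h2, Matrix.zero_mulVec]
    · rintro ⟨hv, h0⟩
      rw [mem_image_one_iff _ hv]
      refine (exists_mulVec_eq_iff _ _ h2 ?_ _).2 h0
      have h4 := cokerDim_one_add_rank (mat ν)
      have h5 := le_rank_chartMat I σ fun x => algebraMap L (kappa ν) (c x)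
      rw [rank_quadMat, card_quadIdx]
      omega

end BaseChange

end Steiner

end

noncomputable section

namespace Steiner

/-! ## Heights of prime ideals in polynomial rings over a field -/

section Height

/-- Induction on the variables: polynomial rings over a field are Jacobson, so a maximal ideal
contracts to a maximal ideal, and each variable adds one to the height. -/
theorem height_of_isMaximal {F : Type*} [Field F] {n : ℕ} (P : Ideal (MvPolynomial (Fin n) F))
    (hP : P.IsMaximal) : P.height = n := by
  induction n with
  | zero =>
    have h : IsField (MvPolynomial (Fin 0) F) :=
      (MvPolynomial.isEmptyAlgEquiv F (Fin 0)).toMulEquiv.isField (Field.toIsField F)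
    let _ := h.toField
    rw [Ideal.eq_bot_of_prime P, Ideal.height_bot]
    rfl
  | succ n ih =>
    let e := (MvPolynomial.finSuccEquiv F n).toRingEquiv
    let Q : Ideal (Polynomial (MvPolynomial (Fin n) F)) := P.map e
    have hQ : Q.IsMaximal := Ideal.map_isMaximal_of_equiv e
    have h1 : (Q.under (MvPolynomial (Fin n) F)).IsMaximal :=
      Polynomial.isMaximal_comap_C_of_isJacobsonRing Q
    have h3 : Q.LiesOver (Q.under (MvPolynomial (Fin n) F)) := ⟨rfl⟩
    have h2 := Polynomial.height_eq_height_add_one (Q.under (MvPolynomial (Fin n) F)) Q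
    rw [ih _ h1, e.height_map] at h2
    rw [h2]
    push_cast
    rfl

theorem height_of_isMaximal_of_finite {F : Type*} [Field F] {τ : Type*} [Finite τ]
    (P : Ideal (MvPolynomial τ F)) (hP : P.IsMaximal) : P.height = Nat.card τ := by
  let e := (MvPolynomial.renameEquiv F (Finite.equivFin τ)).toRingEquiv
  have h := height_of_isMaximal (P.map e) (Ideal.map_isMaximal_of_equiv e)
  rwa [e.height_map] at h

theorem height_ker_comp_of_isLocalization {A B C D : Type*} [CommRing A] [CommRing B] [CommRing C]
    [CommRing D] (e : A ≃+* B) (M : Submonoid B) [Algebra B C] [IsLocalization M C] (Ψ : C →+* D) :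
    (RingHom.ker ((Ψ.comp (algebraMap B C)).comp e.toRingHom)).height = (RingHom.ker Ψ).height := by
  rw [← IsLocalization.height_under M (RingHom.ker Ψ), ← e.height_comap]
  rfl

variable {k κ : Type*} [Field k] [Field κ] [Algebra k κ]

/-- Inverting the nonzero polynomials in `y` preserves the height, since `y` is independent. The
kernel becomes a maximal ideal in `k(y)[σ]`, because `κ` is algebraic over `k(y)`. -/
theorem height_ker_aeval_of_isTranscendenceBasis {σ τ : Type*} [Finite σ] (y : τ → κ)
    (x : σ → κ) (hy : IsTranscendenceBasis k y) :
    (RingHom.ker (MvPolynomial.aeval (Sum.elim x y) : MvPolynomial (σ ⊕ τ) k →ₐ[k] κ)).height =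
      Nat.card σ := by
  let R := MvPolynomial τ k
  let F := FractionRing R
  let g : R →ₐ[k] κ := MvPolynomial.aeval y
  have hgX : ∀ z, g (MvPolynomial.X z) = y z := fun z => MvPolynomial.aeval_X y z
  have hgC : ∀ r, g (MvPolynomial.C r) = algebraMap k κ r := fun r => MvPolynomial.aeval_C y r
  have hg : Function.Injective g := hy.1
  let _ : Algebra R κ := g.toRingHom.toAlgebra
  have _ : FaithfulSMul R κ := (faithfulSMul_iff_algebraMap_injective R κ).2 hg
  let _ : Algebra F κ := FractionRing.liftAlgebra R κ
  have _ : IsScalarTower R F κ := FractionRing.isScalarTower_liftAlgebra R κ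
  have hRalg : Algebra.IsAlgebraic R κ := by
    have h1 := hy.isAlgebraic
    refine Algebra.IsAlgebraic.of_ringHom_of_comp_eq (S := Algebra.adjoin k (Set.range y))
      (B := κ) hy.1.aevalEquiv.toRingEquiv (RingHom.id κ) ?_ Function.injective_id ?_
    · exact hy.1.aevalEquiv.surjective
    · exact RingHom.ext fun r => hy.1.algebraMap_aevalEquiv r
  have hFalg : Algebra.IsAlgebraic F κ := 
    Algebra.IsAlgebraic.extendScalars (R := R) (IsFractionRing.injective R F)
  let Ψ : MvPolynomial σ F →ₐ[F] κ := MvPolynomial.aeval x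
  have hmax : (RingHom.ker Ψ).IsMaximal := by
    apply Ideal.Quotient.maximal_of_isField
    have h1 : IsField Ψ.range := Subalgebra.isField_of_algebraic Ψ.range
    exact (Ideal.quotientKerEquivRange Ψ).toMulEquiv.isField h1
  have h1 := height_of_isMaximal_of_finite _ hmax
  let _ : Algebra (MvPolynomial σ R) (MvPolynomial σ F) := MvPolynomial.algebraMvPolynomial
  have _ : IsLocalization ((nonZeroDivisors R).map (MvPolynomial.C (σ := σ))) (MvPolynomial σ F) :=
    MvPolynomial.isLocalization _ _
  let e := (MvPolynomial.sumAlgEquiv k σ τ).toRingEquiv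
  have h3 : (MvPolynomial.aeval (Sum.elim x y) : MvPolynomial (σ ⊕ τ) k →ₐ[k] κ).toRingHom =
      (Ψ.toRingHom.comp (algebraMap (MvPolynomial σ R) (MvPolynomial σ F))).comp e.toRingHom := by
    have h4 : ∀ r : R, Ψ (algebraMap (MvPolynomial σ R) (MvPolynomial σ F) (MvPolynomial.C r)) =
        g r := by
      intro r
      rw [MvPolynomial.algebraMap_def, MvPolynomial.map_C]
      refine (Ψ.commutes _).trans ?_
      exact (IsScalarTower.algebraMap_apply R F κ r).symm
    refine MvPolynomial.ringHom_ext (fun r => ?_) fun z => ?_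
    · change MvPolynomial.aeval (Sum.elim x y) (MvPolynomial.C r) =
        Ψ (algebraMap _ _ (MvPolynomial.sumAlgEquiv k σ τ (MvPolynomial.C r)))
      rw [MvPolynomial.sumAlgEquiv_C_inl, h4, MvPolynomial.aeval_C, hgC]
    · change MvPolynomial.aeval (Sum.elim x y) (MvPolynomial.X z) =
        Ψ (algebraMap _ _ (MvPolynomial.sumAlgEquiv k σ τ (MvPolynomial.X z)))
      rcases z with z | z
      · rw [MvPolynomial.sumAlgEquiv_X_inl, MvPolynomial.algebraMap_def, MvPolynomial.map_X]
        simp [Ψ]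
      · rw [MvPolynomial.sumAlgEquiv_X_inr, h4, MvPolynomial.aeval_X, hgX]
        rfl
  have h5 := height_ker_comp_of_isLocalization e
    ((nonZeroDivisors R).map (MvPolynomial.C (σ := σ))) Ψ.toRingHom
  rw [← h3] at h5
  exact h5.trans h1

/-- Height plus transcendence degree is the number of variables: a transcendence basis can be chosen
among the `x`, and it has the cardinality of `y`. -/
theorem height_ker_aeval {ι τ : Type*} [Finite ι] [Finite τ] (x : ι → κ) (y : τ → κ)
    (hy : IsTranscendenceBasis k y)
    [Algebra.IsAlgebraic (Algebra.adjoin k (Set.range x)) κ] :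
    (RingHom.ker (MvPolynomial.aeval x : MvPolynomial ι k →ₐ[k] κ)).height + Nat.card τ =
      Nat.card ι := by
  classical
  obtain ⟨s, hs, hs'⟩ := exists_isTranscendenceBasis_subset (R := k) (A := κ) (Set.range x)
  choose i hi using fun z : s => hs z.2
  have hinj : Function.Injective i := fun z w h => Subtype.ext (by rw [← hi z, ← hi w, h])
  have hsfin : Finite s := Finite.of_injective i hinj
  have hcard : Nat.card s = Nat.card τ := by
    have := hs'.lift_cardinalMk_eq hy
    rw [Nat.card, Nat.card, ← Cardinal.toNat_lift, this, Cardinal.toNat_lift]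
  let e : ((Set.range i)ᶜ : Set ι) ⊕ s ≃ ι :=
    ((Equiv.refl _).sumCongr (Equiv.ofInjective i hinj)).trans
      ((Equiv.sumComm _ _).trans (Equiv.Set.sumCompl (Set.range i)))
  have h1 := height_ker_aeval_of_isTranscendenceBasis (k := k) (fun z : s => (z : κ))
    (fun z : ((Set.range i)ᶜ : Set ι) => x z) hs'
  have h2 : Sum.elim (fun z : ((Set.range i)ᶜ : Set ι) => x z) (fun z : s => (z : κ)) = x ∘ e := by
    ext z
    rcases z with z | z
    · rfl
    · exact (hi z).symm
  have h3 := Nat.card_congr e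
  rw [Nat.card_sum, hcard] at h3
  rw [← h3, Nat.cast_add, ← h1, h2]
  congr 1
  rw [← (MvPolynomial.renameEquiv k e).toRingEquiv.height_comap]
  congr 1
  ext z
  rw [RingHom.mem_ker, Ideal.mem_comap, RingHom.mem_ker, ← MvPolynomial.aeval_rename]
  rfl

theorem isAlgebraic_of_forall_exists_mul_eq (B : Subalgebra k κ)
    (h : ∀ z : κ, ∃ u ∈ B, ∃ v ∈ B, v ≠ 0 ∧ v * z = u) : Algebra.IsAlgebraic B κ := by
  refine ⟨fun z => ?_⟩
  obtain ⟨u, hu, v, hv, hv0, huv⟩ := h z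
  refine ⟨Polynomial.C ⟨v, hv⟩ * Polynomial.X - Polynomial.C ⟨u, hu⟩, fun h0 => hv0 ?_, ?_⟩
  · have := congrArg (fun p => Polynomial.coeff p 1) h0
    simp [Polynomial.coeff_C] at this
    simpa using congrArg Subtype.val this
  · simp only [map_sub, map_mul, Polynomial.aeval_C, Polynomial.aeval_X]
    exact sub_eq_zero.2 huv

end Height

/-! ### The codimension of the generic morphism. -/

section GenericPoint

variable {k : Type u} [Field k] {a b f : ℕ}

theorem chartMat_coord_unique {K : Type*} [Field K] {I : Finset (QuadIdx a)}
    {σ : Fin f ≃ {t // t ∈ I}} {c c' : {t // t ∈ I} × {t // t ∉ I} → K}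
    (h : ∀ v, (chartMat I σ c).mulVec v = 0 → (chartMat I σ c').mulVec v = 0) : c = c' := by
  ext ⟨i, j⟩
  -- The point of the graph of `c` over the `j`-th basis vector; its `I`-part is column `j` of the
  -- coordinates.
  let v : QuadIdx a → K := fun t => if ht : t ∈ I then c (⟨t, ht⟩, j) else if t = j then 1 else 0
  have hv : ∀ j' : {t // t ∉ I}, v j' = if j' = j then 1 else 0 := fun j' => by
    simp [v, j'.2, Subtype.ext_iff]
  have hv' : ∀ i' : {t // t ∈ I}, v i' = c (i', j) := fun i' => dif_pos i'.2
  have h1 := (chartMat_mulVec_eq_zero_iff I σ c' v).1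
    (h v ((chartMat_mulVec_eq_zero_iff I σ c v).2 fun i' => by simp [hv, hv'])) i
  simpa [hv, hv'] using h1

theorem exists_mul_eq_kappa (x : Space k a b) (z : kappa x) :
    ∃ u ∈ Algebra.adjoin k (Set.range (mat x)), ∃ v ∈ Algebra.adjoin k (Set.range (mat x)),
      v ≠ 0 ∧ v * z = u := by
  have hmem : ∀ p : MvPolynomial (Idx a b) k,
      algebraMap _ (kappa x) p ∈ Algebra.adjoin k (Set.range (mat x)) := fun p => by
    rw [← aeval_mat, Algebra.adjoin_range_eq_range_aeval]
    exact ⟨p, rfl⟩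
  obtain ⟨p, q, hq, rfl⟩ := IsFractionRing.div_surjective
    (A := MvPolynomial (Idx a b) k ⧸ x.asIdeal) z
  obtain ⟨p, rfl⟩ := Ideal.Quotient.mk_surjective p
  obtain ⟨q, rfl⟩ := Ideal.Quotient.mk_surjective q
  have hq0 : algebraMap _ (kappa x) (Ideal.Quotient.mk x.asIdeal q) ≠ 0 :=
    IsFractionRing.to_map_ne_zero_of_mem_nonZeroDivisors hq
  exact ⟨_, hmem p, _, hmem q, hq0, mul_div_cancel₀ _ hq0⟩

theorem card_chart (I : Finset (QuadIdx a)) (σ : Fin f ≃ {t // t ∈ I}) :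
    Nat.card ({t // t ∈ I} × {t // t ∉ I}) = f * (10 * a - f) := by
  rw [Nat.card_prod, Nat.card_eq_fintype_card, Nat.card_eq_fintype_card, Fintype.card_subtype_compl,
    ← Fintype.card_congr σ, Fintype.card_fin, card_quadIdx]

theorem card_wdx {J : Fin f × Fin 4 → Fin a × Fin 4} (hJ : Function.Injective J) :
    Nat.card (Wdx J b) = (4 * a - 4 * f) * b := by
  classical
  rw [Nat.card_prod, Nat.card_eq_fintype_card, Nat.card_eq_fintype_card, Fintype.card_fin,
    Fintype.card_subtype_compl, Set.card_range_of_injective hJ]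
  simp only [Fintype.card_prod, Fintype.card_fin]
  rw [mul_comm a, mul_comm f]

/-- The height of the ideal of the generic morphism. -/
theorem height_genPoint [Infinite k] {J : Fin f × Fin 4 → Fin a × Fin 4}
    (hJ : Function.Injective J) {φ₀ : Matrix (Fin f) (QuadIdx a) k}
    (hφ₀ : (contrSub J φ₀).det ≠ 0) (hf : cokerDim (mat (genPoint k b J)) 1 = f) :
    (genPoint k b J).asIdeal.height + ((f * (10 * a - f) + (4 * a - 4 * f) * b : ℕ) : ℕ∞) =
      ((4 * a * b : ℕ) : ℕ∞) := by
  set μ := genPoint k b J with hμ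
  obtain ⟨I, σ, c, hc, h⟩ := (isGenericSubspace_image_iff _).1 (isGenericSubspace_genPoint hJ hf)
  have h0 := mul_quadMat_eq_zero_of_forall h
  have hd := det_contrSub_chartMat_ne_zero J φ₀ hφ₀ I σ c hc
  obtain ⟨w, hw⟩ := exists_eq_param hJ hd ((mul_quadMat_eq_zero_iff _ _).1 h0)
  let F := FractionRing (MvPolynomial (({t // t ∈ I} × {t // t ∉ I}) ⊕ Wdx J b) k)
  obtain ⟨C, W, hCW⟩ := exists_algebraicIndependent_sumElim k ({t // t ∈ I} × {t // t ∉ I})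
    (Wdx J b)
  have hC : AlgebraicIndependent k C := hCW.comp Sum.inl Sum.inl_injective
  let g : MvPolynomial (Idx a b) k →ₐ[k] F := MvPolynomial.aeval (param J (chartMat I σ C) W)
  have hg : ∀ x, g x = 0 ↔ x ∈ μ.asIdeal := fun x =>
    aeval_param_eq_zero_iff J I σ C W hCW x
  let β : kappa μ →ₐ[k] F := Ideal.ResidueField.liftₐ _ g
    (fun x hx => (hg x).2 hx) (fun x hx => isUnit_iff_ne_zero.2 fun h => hx ((hg x).1 h))
  have hβm : ∀ i, β (mat μ i) = param J (chartMat I σ C) W i := by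
    intro i
    refine (Ideal.ResidueField.liftₐ_algebraMap _ g _ _ _).trans ?_
    exact MvPolynomial.aeval_X _ _
  have hβQ : (quadMat (mat μ)).map β = quadMat (param J (chartMat I σ C) W) := by
    rw [← funext hβm]
    exact quadMat_map (β : kappa μ →+* F) (mat μ)
  -- Over `F`, both families are coordinates in the chart `I` of the same image of codimension `f`.
  have hβc : (fun x => β (c x)) = C := by
    refine chartMat_coord_unique (σ := σ) fun v hv => ?_
    have h1 : chartMat I σ (fun x => β (c x)) * (quadMat (mat μ)).map β = 0 := by
      have h2 := congrArg (fun M => M.map (β : kappa μ →+* F)) h0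
      simp only [Matrix.map_mul, chartMat_map] at h2
      rw [Matrix.map_zero _ (map_zero _)] at h2
      exact h2
    have h2 : chartMat I σ C * (quadMat (mat μ)).map β = 0 := by
      rw [hβQ]
      exact (mul_quadMat_eq_zero_iff _ _).2 (contr_mul_param J _ _)
    have h3 := cokerDim_one_add_rank (mat μ)
    rw [hf, ← rank_quadMat, ← rank_map_ringHom (β : kappa μ →+* F)] at h3
    change f + ((quadMat (mat μ)).map β).rank = _ at h3
    obtain ⟨u, rfl⟩ := (exists_mulVec_eq_iff _ _ h1 (by
      have := le_rank_chartMat I σ fun x => β (c x)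
      rw [card_quadIdx]
      omega) v).2 hv
    rw [Matrix.mulVec_mulVec, h2, Matrix.zero_mulVec]
  have hβw : (fun x => β (w x)) = W := by
    have h1 : param J (chartMat I σ C) (fun x => β (w x)) = param J (chartMat I σ C) W := by
      ext i
      rw [← hβm, hw]
      have := param_map J (β : kappa μ →+* F) (chartMat I σ c) w i
      rw [chartMat_map] at this
      refine Eq.trans ?_ this.symm
      rw [← hβc]
      rfl
    have hd' := det_contrSub_chartMat_ne_zero J φ₀ hφ₀ I σ C hC
    ext ⟨z, j⟩
    have h2 := congrFun h1 (z.1.1, j, z.1.2)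
    rw [param_apply_of_notMem J _ _ z.1 z.2 j, param_apply_of_notMem J _ _ z.1 z.2 j] at h2
    exact mul_left_cancel₀ hd' h2
  -- Independence is reflected by `β`, which sends `(c, w)` to independent elements.
  have hind : AlgebraicIndependent k (Sum.elim c w) := by
    refine AlgebraicIndependent.of_comp β ?_
    convert hCW using 1
    rw [Sum.comp_elim]
    exact congrArg₂ Sum.elim hβc hβw
  have hle : Algebra.adjoin k (Set.range (mat μ)) ≤
      Algebra.adjoin k (Set.range (Sum.elim c w)) := by
    refine Algebra.adjoin_le ?_
    rintro _ ⟨i, rfl⟩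
    rw [hw]
    set B := Algebra.adjoin k (Set.range (Sum.elim c w))
    let c' : {t // t ∈ I} × {t // t ∉ I} → B := fun x =>
      ⟨c x, Algebra.subset_adjoin ⟨Sum.inl x, rfl⟩⟩
    let w' : Wdx J b → B := fun x => ⟨w x, Algebra.subset_adjoin ⟨Sum.inr x, rfl⟩⟩
    have := param_map J (B.val : B →+* kappa μ) (chartMat I σ c') w' i
    rw [chartMat_map] at this
    change _ = param J (chartMat I σ c) w i at this
    rw [← this]
    exact Subtype.property _
  have halg : Algebra.IsAlgebraic (Algebra.adjoin k (Set.range (mat μ))) (kappa μ) :=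
    isAlgebraic_of_forall_exists_mul_eq _ (exists_mul_eq_kappa μ)
  -- The entries of `μ` are polynomials in `c` and `w`, so every element of `κ(μ)` is a quotient of
  -- such polynomials.
  have hbasis : IsTranscendenceBasis k (Sum.elim c w) := by
    rw [isTranscendenceBasis_iff_algebraicIndependent_isAlgebraic]
    refine ⟨hind, isAlgebraic_of_forall_exists_mul_eq _ fun z => ?_⟩
    obtain ⟨u, hu, v, hv, h1⟩ := exists_mul_eq_kappa μ z
    exact ⟨u, hle hu, v, hle hv, h1⟩
  have hmain := height_ker_aeval (mat μ) (Sum.elim c w) hbasis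
  have hker : RingHom.ker (MvPolynomial.aeval (mat μ) : MvPolynomial (Idx a b) k →ₐ[k] kappa μ) =
      μ.asIdeal := by
    ext p
    exact aeval_mat_eq_zero_iff μ p
  rw [hker, Nat.card_sum, card_chart I σ, card_wdx hJ] at hmain
  rw [hmain]
  simp only [Nat.card_eq_fintype_card, Fintype.card_prod, Fintype.card_fin]
  congr 1
  ring

end GenericPoint

end Steiner

end

noncomputable section

namespace Steiner

/-! ## Components of the Brill–Noether loci -/

section Topology

variable {X : Type u} [TopologicalSpace X]

/-- Zorn's lemma: the union of a chain of irreducible subsets is irreducible. -/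
theorem exists_isComponent_mem {S : Set X} {x : X} (hx : x ∈ S) :
    ∃ C, IsComponent C S ∧ x ∈ C := by
  obtain ⟨C, hxC, hC⟩ := zorn_subset_nonempty {T : Set X | IsIrreducible T ∧ T ⊆ S}
    (fun c hc hcc hne => by
      refine ⟨⋃₀ c, ⟨⟨?_, ?_⟩, Set.sUnion_subset fun T hT => (hc hT).2⟩,
        fun T hT => Set.subset_sUnion_of_mem hT⟩
      · obtain ⟨T, hT⟩ := hne
        exact (hc hT).1.1.mono (Set.subset_sUnion_of_mem hT)
      · rintro u v hu hv ⟨y, ⟨p, hpc, hyp⟩, hyu⟩ ⟨z, ⟨q, hqc, hzq⟩, hzv⟩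
        rcases hcc.total hpc hqc with h | h
        · obtain ⟨w, hw, hw'⟩ := (hc hqc).1.2 u v hu hv ⟨y, h hyp, hyu⟩ ⟨z, hzq, hzv⟩
          exact ⟨w, ⟨q, hqc, hw⟩, hw'⟩
        · obtain ⟨w, hw, hw'⟩ := (hc hpc).1.2 u v hu hv ⟨y, hyp, hyu⟩ ⟨z, h hzq, hzv⟩
          exact ⟨w, ⟨p, hpc, hw⟩, hw'⟩)
    {x} ⟨isIrreducible_singleton, Set.singleton_subset_iff.2 hx⟩
  exact ⟨C, hC, hxC rfl⟩

theorem isIrreducible_of_subset_closure {S : Set X} {x : X} (hx : x ∈ S) (hS : S ⊆ closure {x}) :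
    IsIrreducible S := by
  rw [← isIrreducible_iff_closure, subset_antisymm (closure_minimal hS isClosed_closure)
    (closure_mono (Set.singleton_subset_iff.2 hx)), isIrreducible_iff_closure]
  exact isIrreducible_singleton

theorem IsIrreducible.exists_specializes [QuasiSober X] {T : Set X} (hT : IsIrreducible T) :
    ∃ η ∈ closure T, ∀ x ∈ T, η ⤳ x := by
  have h := hT.isGenericPoint_genericPoint_closure
  exact ⟨_, h.mem, fun x hx => h.specializes (subset_closure hx)⟩

end Topology

/-! ### Generizations within `W`, and part (I). -/

section Loci

variable {k : Type u} [Field k] {a b f : ℕ}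

theorem rank_degMat_le_of_specializes {x y : Space k a b} (h : x ⤳ y) (t : ℤ) :
    (degMat (mat y) t).rank ≤ (degMat (mat x) t).rank := by
  rw [degMat_mat, degMat_mat]
  exact rank_le_of_specializes _ h

theorem surjective_of_specializes {x y : Space k a b} (h : x ⤳ y) {t : ℤ}
    (hy : Function.Surjective (mulOn (mat y) ∅ t)) : Function.Surjective (mulOn (mat x) ∅ t) := by
  rw [surjective_mulOn_iff] at hy ⊢
  exact le_antisymm (Matrix.rank_le_card_height _) (hy ▸ rank_degMat_le_of_specializes h t)

/-- Some `m(d)` is surjective at `y`, hence at `x` by semicontinuity; one surjective `m(d)`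
suffices. -/
theorem mem_locusM_of_specializes {x y : Space k a b} (h : x ⤳ y) (hy : y ∈ locusM k a b) :
    x ∈ locusM k a b := by
  obtain ⟨d, hd⟩ := SheafSurjective.exists_surjective hy
  exact sheafSurjective_of_surjective (surjective_of_specializes h hd)

theorem isClosed_le_cokerDim (f d : ℕ) : IsClosed {x : Space k a b | f ≤ cokerDim (mat x) d} := by
  rw [← isOpen_compl_iff]
  have : {x : Space k a b | f ≤ cokerDim (mat x) d}ᶜ =
      {x : Space k a b | a * Fintype.card (Mon ((d : ℤ) + 1)) + 1 ≤ f +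
        ((degMat (MvPolynomial.X : Idx a b → MvPolynomial (Idx a b) k) d).map
          (algebraMap _ (kappa x))).rank} := by
    ext x
    have h1 := cokerDim_add_rank (mat x) d
    rw [Set.mem_compl_iff, Set.mem_ofPred_eq, Set.mem_ofPred_eq, ← degMat_mat]
    omega
  rw [this]
  convert isOpen_le_rank (degMat (MvPolynomial.X : Idx a b → MvPolynomial (Idx a b) k) d)
    (a * Fintype.card (Mon ((d : ℤ) + 1)) + 1 - f) using 1
  ext x
  exact (Nat.sub_le_iff_le_add' (b := f)).symm

theorem mem_corankLocus_one_iff (hab : 5 * a ≤ 2 * b) (x : Space k a b) :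
    x ∈ corankLocus k a b f 1 ↔ x ∈ locusM k a b ∧ f ≤ cokerDim (mat x) 1 := by
  rw [← corank_one_eq hab]
  rfl

theorem mem_locusExact_iff (hab : 5 * a ≤ 2 * b) (x : Space k a b) :
    x ∈ locusExact k a b f ↔ x ∈ locusM k a b ∧ cokerDim (mat x) 1 = f := by
  change x ∈ corankLocus k a b f 1 ∧ _ ↔ _
  rw [mem_corankLocus_one_iff hab]
  constructor
  · exact fun h => ⟨h.1.1, h.2⟩
  · exact fun h => ⟨⟨h.1, h.2.ge⟩, h.2⟩

/-- The generic point of the closure of an irreducible subset of `W` is in `W`. -/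
theorem exists_generic_mem_corankLocus (hab : 5 * a ≤ 2 * b) {T : Set (Space k a b)}
    (hT : IsIrreducible T) (hTS : T ⊆ corankLocus k a b f 1) :
    ∃ η ∈ corankLocus k a b f 1, η ∈ closure T ∧ ∀ x ∈ T, η ⤳ x := by
  obtain ⟨η, hη, hη'⟩ := IsIrreducible.exists_specializes hT
  obtain ⟨y, hy⟩ := hT.1
  refine ⟨η, (mem_corankLocus_one_iff hab η).2 ⟨mem_locusM_of_specializes (hη' y hy) (hTS hy).1, ?_⟩,
    hη, hη'⟩
  exact closure_minimal (fun x hx => ((mem_corankLocus_one_iff hab x).1 (hTS hx)).2)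
    (isClosed_le_cokerDim f 1) hη

/-- A point of `W_P` is a specialization of a point with generic image. -/
theorem exists_specializes_of_mem_locusWP (hab : 5 * a ≤ 2 * b) {x : Space k a b}
    (hx : x ∈ locusWP k a b f) :
    ∃ η : Space k a b, η ⤳ x ∧ IsGenericSubspace k f (image (mat η) 1) := by
  obtain ⟨C, hC, hxC⟩ := exists_isComponent_mem hx.1
  obtain ⟨y, hyC, hy⟩ := hx.2 C hC hxC
  obtain ⟨η, hη, -, hη'⟩ := exists_generic_mem_corankLocus hab hC.prop.1
    (fun z hz => (hC.prop.2 hz).1)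
  exact ⟨η, hη' x hxC, isGenericSubspace_of_specializes (hη' y hyC)
    ((mem_corankLocus_one_iff hab η).1 hη).2 hy⟩

theorem rank_cellMat {K : Type u} [Field K] (m : Idx a b → K) :
    (cellMat m).rank = (degMat m 0).rank := by
  let e : Fin b ≃ Fin b × Mon 0 := (Equiv.prodUnique _ _).symm
  have : cellMat m = (degMat m 0).submatrix (linIndex a) e := by
    ext z j
    change m (z.1, j, z.2) = ∑ p : Fin 4, if (monOne z.2).1 = 0 + Pi.single p 1 then m (z.1, j, p) else 0
    rw [Finset.sum_eq_single z.2]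
    · rw [zero_add, if_pos (show (monOne z.2).1 = Pi.single z.2 1 from rfl)]
    · intro p _ hp
      rw [zero_add, if_neg]
      intro h
      exact hp (monOne_bijective.1 (Subtype.ext h)).symm
    · simp
  rw [this, Matrix.rank_submatrix]

/-- `Im m(0)` lies in the kernel of the contractions, whose rank is at least `4 min(f, a)`. The
minimum lets the bound cover `f > a`. -/
theorem four_mul_min_add_rank_le [Infinite k] {η : Space k a b}
    (hη : IsGenericSubspace k f (image (mat η) 1)) :
    4 * min f a + (degMat (mat η) 0).rank ≤ 4 * a := by
  obtain ⟨I, σ, c, hc, h⟩ := (isGenericSubspace_image_iff _).1 hη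
  have h1 := le_rank_contr_chartMat I σ c hc
  have h2 := (mul_quadMat_eq_zero_iff _ _).1 (mul_quadMat_eq_zero_of_forall h)
  have h3 : LinearMap.range (cellMat (mat η)).mulVecLin ≤
      LinearMap.ker (contr (chartMat I σ c)).mulVecLin := by
    rintro _ ⟨w, rfl⟩
    rw [LinearMap.mem_ker, Matrix.mulVecLin_apply, Matrix.mulVecLin_apply, Matrix.mulVec_mulVec,
      h2, Matrix.zero_mulVec]
  have h4 := LinearMap.finrank_range_add_finrank_ker (contr (chartMat I σ c)).mulVecLin
  rw [Module.finrank_fintype_fun_eq_card, Fintype.card_prod, Fintype.card_fin, Fintype.card_fin] at h4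
  have h5 := Submodule.finrank_mono h3
  change (cellMat (mat η)).rank ≤ _ at h5
  change (contr (chartMat I σ c)).rank + _ = _ at h4
  rw [rank_cellMat] at h5
  omega

/-- If `f` is large, then the points of `W_P` have constants in the kernel. -/
theorem rank_lt_of_mem_locusWP [Infinite k] (hab : 5 * a ≤ 2 * b) (hf : 0 < f)
    (hfa : 4 * a < 4 * f + b) {x : Space k a b} (hx : x ∈ locusWP k a b f) :
    (degMat (mat x) 0).rank < b := by
  obtain ⟨η, hηx, hη⟩ := exists_specializes_of_mem_locusWP hab hx
  have h1 := four_mul_min_add_rank_le hη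
  have h2 := rank_degMat_le_of_specializes hηx 0
  -- Needed when `f > a`: then the rank is zero, and `0 < f ≤ 10a` gives `a > 0`, hence `b > 0`.
  have h3 := ((mem_locusExact_iff hab x).1 hx.1).2
  have h4 := cokerDim_one_add_rank (mat x)
  omega

theorem locusWP_subset_corankLocus_zero [Infinite k] (hab : 5 * a ≤ 2 * b) (hba : b ≤ 4 * a)
    (hf : 0 < f) (hfa : 4 * a < 4 * f + b) : locusWP k a b f ⊆ corankLocus k a b 1 0 := by
  intro x hx
  have h1 := rank_lt_of_mem_locusWP hab hf hfa hx
  have h2 := finrank_ker_zero_add_rank (mat x)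
  have h3 := cokerDim_zero_add_rank (mat x)
  refine ⟨hx.1.1.1, ?_⟩
  rw [corank, le_min_iff]
  omega

theorem hasTrivialSummand_of_mem_locusWP [Infinite k] (hab : 5 * a ≤ 2 * b) (hf : 0 < f)
    (hfa : 4 * a < 4 * f + b) {x : Space k a b} (hx : x ∈ locusWP k a b f) :
    HasTrivialSummand (mat x) := by
  refine hasTrivialSummand_of_not_injective fun h => ?_
  have h1 := rank_lt_of_mem_locusWP hab hf hfa hx
  rw [injective_mulOn_iff, Fintype.card_prod, Fintype.card_fin, card_mon_zero] at h
  omega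

end Loci

/-! ### Natural cohomology away from the twist `1`. -/

section Cohomology

variable {K : Type u} [Field K] {a b f : ℕ} {m : Idx a b → K}

theorem injective_mulOn_of_neg {t : ℤ} (ht : t < 0) : Function.Injective (mulOn m ∅ t) := by
  have := isEmpty_mon ht
  have : Subsingleton (vecSec K b ∅ t) := (vecEquiv K b t).toEquiv.subsingleton
  exact Function.injective_of_subsingleton _

theorem surjective_mulOn_of_neg {t : ℤ} (ht : t + 1 < 0) : Function.Surjective (mulOn m ∅ t) := by
  have := isEmpty_mon ht
  have : Subsingleton (vecSec K a ∅ (t + 1)) := (vecEquiv K a (t + 1)).toEquiv.subsingleton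
  exact Function.surjective_to_subsingleton _

/-- If `m(2)` is surjective and `m(0)` injective, then `E_m(t)` has natural cohomology for
`t ≠ 1`. -/
theorem subsingleton_H_or (h0 : Function.Injective (mulOn m ∅ 0))
    (h2 : Function.Surjective (mDeg m 2)) {t : ℤ} (ht : t ≠ 1) {i j : ℕ} (hij : i ≠ j) :
    Subsingleton (H m t i) ∨ Subsingleton (H m t j) := by
  have hm : SheafSurjective m := sheafSurjective_of_surjective h2
  -- The only degree that can survive: `3` for `t ≤ -2`, `1` for `t = -1` and `t = 0`, and `0` for
  -- `t ≥ 2`.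
  obtain ⟨r, hr⟩ : ∃ r : ℕ, ∀ i, i ≠ r → Subsingleton (H m t i) := by
    rcases lt_or_ge t (-1) with h | h
    · refine ⟨3, fun i hi => ?_⟩
      match i, hi with
      | 0, _ => exact subsingleton_H_zero (injective_mulOn_of_neg (by omega))
      | 1, _ => exact subsingleton_H_one (surjective_mulOn_of_neg (by omega))
      | 2, _ => exact subsingleton_H_add_two hm t 0 (Or.inl rfl)
      | i + 4, _ => exact subsingleton_H_of_four_le m t (by omega)
    rcases lt_or_ge t 1 with h' | h'
    · refine ⟨1, fun i hi => ?_⟩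
      match i, hi with
      | 0, _ =>
        rcases lt_or_ge t 0 with h'' | h''
        · exact subsingleton_H_zero (injective_mulOn_of_neg h'')
        · obtain rfl : t = 0 := by omega
          exact subsingleton_H_zero h0
      | i + 2, _ => exact subsingleton_H_add_two hm t i (Or.inr (by omega))
    · refine ⟨0, fun i hi => ?_⟩
      match i, hi with
      | 1, _ =>
        obtain ⟨d, rfl⟩ := Int.eq_ofNat_of_zero_le (by omega : 0 ≤ t)
        exact subsingleton_H_one (surjective_mDeg_of_le (by omega) h2)
      | i + 2, _ => exact subsingleton_H_add_two hm t i (Or.inr (by omega))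
  by_cases hi : i = r
  · exact Or.inr (hr j fun hj => hij (hi.trans hj.symm))
  · exact Or.inl (hr i hi)

end Cohomology

/-! ### The generic morphism as the generic point of a component. -/

section Main

variable {k : Type u} [Field k] {a b f : ℕ}

theorem rank_degMat_of_mem_iff {K : Type*} [Field K] [Algebra k K] {x : Space k a b}
    {m : Idx a b → K} (h : ∀ p, p ∈ x.asIdeal ↔ MvPolynomial.aeval m p = 0) (t : ℤ) :
    (degMat (mat x) t).rank = (degMat m t).rank := by
  refine eq_of_forall_le_iff fun r => ?_
  rw [degMat_mat, le_rank_residueField_iff, le_rank_iff]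
  refine exists_congr fun s => exists_congr fun t' => not_congr ?_
  rw [h]
  have h1 := RingHom.map_det ((MvPolynomial.aeval m :
    MvPolynomial (Idx a b) k →ₐ[k] K) : _ →+* K)
    ((degMat (MvPolynomial.X : Idx a b → MvPolynomial (Idx a b) k) t).submatrix s t')
  rw [RingHom.mapMatrix_apply, ← Matrix.submatrix_map, degMat_map] at h1
  refine Eq.congr_left (h1.trans ?_)
  congr 2
  congr 1
  ext i
  simp

/-- In a chart, `f` independent functionals annihilate the image, so the corank is never below `f`;
the content is the reverse inequality. -/
theorem le_cokerDim_genPoint [Infinite k] {J : Fin f × Fin 4 → Fin a × Fin 4}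
    (hJ : Function.Injective J) : f ≤ cokerDim (mat (genPoint k b J)) 1 := by
  obtain ⟨I, ⟨σ⟩⟩ := exists_chart hJ
  obtain ⟨c, w, hcw⟩ := exists_algebraicIndependent_sumElim k ({t // t ∈ I} × {t // t ∉ I})
    (Wdx J b)
  have h1 := rank_degMat_of_mem_iff (x := genPoint k b J)
    (fun p => (aeval_param_eq_zero_iff J I σ c w hcw p).symm) 1
  have h2 : chartMat I σ c * quadMat (param J (chartMat I σ c) w) = 0 :=
    (mul_quadMat_eq_zero_iff _ _).2 (contr_mul_param J _ _)
  have h3 : LinearMap.range (quadMat (param J (chartMat I σ c) w)).mulVecLin ≤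
      LinearMap.ker (chartMat I σ c).mulVecLin := by
    rintro _ ⟨w, rfl⟩
    rw [LinearMap.mem_ker, Matrix.mulVecLin_apply, Matrix.mulVecLin_apply, Matrix.mulVec_mulVec,
      h2, Matrix.zero_mulVec]
  have h4 := LinearMap.finrank_range_add_finrank_ker (chartMat I σ c).mulVecLin
  rw [Module.finrank_fintype_fun_eq_card, card_quadIdx] at h4
  have h5 := Submodule.finrank_mono h3
  have h6 := le_rank_chartMat I σ c
  have h7 := cokerDim_one_add_rank (mat (genPoint k b J))
  change (quadMat (param J (chartMat I σ c) w)).rank ≤ _ at h5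
  change (chartMat I σ c).rank + _ = _ at h4
  rw [rank_quadMat] at h5
  omega

/-- A good morphism annihilated by `f` functionals is a specialization of the generic one. -/
theorem rank_degMat_le_genPoint {J : Fin f × Fin 4 → Fin a × Fin 4}
    (hJ : Function.Injective J) {φ₀ : Matrix (Fin f) (QuadIdx a) k}
    (hφ₀ : (contrSub J φ₀).det ≠ 0) {m₀ : Idx a b → k} (hm₀ : contr φ₀ * cellMat m₀ = 0) (t : ℤ) :
    (degMat m₀ t).rank ≤ (degMat (mat (genPoint k b J)) t).rank := by
  let x₀ : Space k a b :=
    ⟨RingHom.ker (MvPolynomial.aeval m₀ : MvPolynomial (Idx a b) k →ₐ[k] k), RingHom.ker_isPrime _⟩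
  rw [← rank_degMat_of_mem_iff (x := x₀) (fun p => Iff.rfl) t]
  refine rank_degMat_le_of_specializes ((PrimeSpectrum.le_iff_specializes _ _).1 fun p hp => ?_) t
  obtain ⟨w, rfl⟩ := exists_eq_param hJ hφ₀ hm₀
  change MvPolynomial.aeval _ p = 0
  rw [← aeval_genHom, (mem_genPoint J p).1 hp, map_zero]

variable [Infinite k] {J : Fin f × Fin 4 → Fin a × Fin 4}

/-- A point of `W` specializing to the generic morphism is the generic morphism. -/
theorem subset_closure_genPoint (hab : 5 * a ≤ 2 * b) (hJ : Function.Injective J)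
    {φ₀ : Matrix (Fin f) (QuadIdx a) k} (hφ₀ : (contrSub J φ₀).det ≠ 0)
    (hf : cokerDim (mat (genPoint k b J)) 1 = f) {T : Set (Space k a b)} (hT : IsIrreducible T)
    (hTS : T ⊆ corankLocus k a b f 1) (hμ : genPoint k b J ∈ T) :
    T ⊆ closure {genPoint k b J} := by
  obtain ⟨η, hη, -, hη'⟩ := exists_generic_mem_corankLocus hab hT hTS
  have h1 := isGenericSubspace_of_specializes (hη' _ hμ) ((mem_corankLocus_one_iff hab η).1 hη).2
    (isGenericSubspace_genPoint hJ hf)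
  have h2 := (PrimeSpectrum.le_iff_specializes _ _).1 (genPoint_le hJ hφ₀ h1)
  exact fun x hx => specializes_iff_mem_closure.1 (h2.trans (hη' x hx))

theorem locusWP_subset_closure (hab : 5 * a ≤ 2 * b) (hJ : Function.Injective J)
    {φ₀ : Matrix (Fin f) (QuadIdx a) k} (hφ₀ : (contrSub J φ₀).det ≠ 0) :
    locusWP k a b f ⊆ closure {genPoint k b J} := by
  intro x hx
  obtain ⟨η, hηx, hη⟩ := exists_specializes_of_mem_locusWP hab hx
  have h2 := (PrimeSpectrum.le_iff_specializes _ _).1 (genPoint_le hJ hφ₀ hη)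
  exact specializes_iff_mem_closure.1 (h2.trans hηx)

end Main

end Steiner

end

noncomputable section

namespace Steiner

/-! ## Combinatorial patterns -/

/-- A pattern: a labelling of some of the cells `(i, p)` by labels of two kinds. It describes a
subspace of the dual of `A ⊗ V`, spanned by the sums of the coordinates with the same label. The
labels `(l, q)` give the contractions of functionals on `A ⊗ S² V`, by the symmetry, and there are no
other functionals whose contractions are in this subspace, by the rigidity. -/
structure IsPattern (k : Type u) [Zero k] {A F E : Type}
    (s : A → Fin 4 → Option ((F × Fin 4) ⊕ E)) : Prop where
  symm : ∀ i p q l, s i p = some (Sum.inl (l, q)) → s i q = some (Sum.inl (l, p))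
  surj : ∀ x, ∃ i p, s i p = some x
  rigid : ∀ w : Fin 4 → (F × Fin 4) ⊕ E → k,
    (∀ i p q, (s i p).elim 0 (w q) = (s i q).elim 0 (w p)) →
    (∀ q l r, q ≠ r → w q (Sum.inl (l, r)) = 0) ∧
    (∀ q q' l, w q (Sum.inl (l, q)) = w q' (Sum.inl (l, q'))) ∧ ∀ q x, w q (Sum.inr x) = 0

section Operations

variable {k : Type u} [Zero k] {A F E A' F' E' : Type}

theorem IsPattern.reindex {s : A → Fin 4 → Option ((F × Fin 4) ⊕ E)} (hs : IsPattern k s)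
    (eA : A' ≃ A) (eF : F ≃ F') (eE : E ≃ E') :
    IsPattern k fun i p => (s (eA i) p).map (Sum.map (Prod.map eF id) eE) := by
  have key : ∀ i p (y : (F' × Fin 4) ⊕ E'), (s i p).map (Sum.map (Prod.map eF id) eE) = some y ↔
      s i p = some (Sum.map (Prod.map eF.symm id) eE.symm y) := by
    intro i p y
    rw [Option.map_eq_some_iff]
    constructor
    · rintro ⟨x, hx, rfl⟩
      rw [hx, Sum.map_map, Prod.map_comp_map]
      simp
    · intro h
      refine ⟨_, h, ?_⟩
      rw [Sum.map_map, Prod.map_comp_map]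
      simp
  refine ⟨fun i p q l h => ?_, fun y => ?_, fun w h => ?_⟩
  · rw [key] at h ⊢
    exact hs.symm _ _ _ _ h
  · obtain ⟨i, p, h⟩ := hs.surj (Sum.map (Prod.map eF.symm id) eE.symm y)
    exact ⟨eA.symm i, p, by rw [key, Equiv.apply_symm_apply, h]⟩
  · have h1 := hs.rigid (fun q x => w q (Sum.map (Prod.map eF id) eE x)) fun i p q => by
      have h2 := h (eA.symm i) p q
      simp only [Equiv.apply_symm_apply, Option.elim_map] at h2
      exact h2
    refine ⟨fun q l r hqr => ?_, fun q q' l => ?_, fun q x => ?_⟩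
    · simpa using h1.1 q (eF.symm l) r hqr
    · simpa using h1.2.1 q q' (eF.symm l)
    · simpa using h1.2.2 q (eE.symm x)

/-- Each condition involves one row at a time and the two summands share no label, so the conditions
separate. -/
theorem IsPattern.sum {s : A → Fin 4 → Option ((F × Fin 4) ⊕ E)} (hs : IsPattern k s)
    {s' : A' → Fin 4 → Option ((F' × Fin 4) ⊕ E')} (hs' : IsPattern k s') :
    IsPattern k (A := A ⊕ A') (F := F ⊕ F') (E := E ⊕ E') (Sum.elim
      (fun i p => (s i p).map (Sum.map (Prod.map Sum.inl id) Sum.inl))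
      (fun i p => (s' i p).map (Sum.map (Prod.map Sum.inr id) Sum.inr))) := by
  refine ⟨?_, ?_, fun w h => ?_⟩
  · rintro (i | i) p q (l | l) h
    · simp only [Sum.elim_inl, Option.map_eq_some_iff] at h ⊢
      obtain ⟨x | x, hx, hx'⟩ := h
      · obtain ⟨l', q'⟩ := x
        simp at hx'
        obtain ⟨rfl, rfl⟩ := hx'
        exact ⟨_, hs.symm _ _ _ _ hx, rfl⟩
      · simp at hx'
    · simp only [Sum.elim_inl, Option.map_eq_some_iff] at h
      obtain ⟨⟨l', q'⟩ | x, hx, hx'⟩ := h <;> simp at hx'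
    · simp only [Sum.elim_inr, Option.map_eq_some_iff] at h
      obtain ⟨⟨l', q'⟩ | x, hx, hx'⟩ := h <;> simp at hx'
    · simp only [Sum.elim_inr, Option.map_eq_some_iff] at h ⊢
      obtain ⟨x | x, hx, hx'⟩ := h
      · obtain ⟨l', q'⟩ := x
        simp at hx'
        obtain ⟨rfl, rfl⟩ := hx'
        exact ⟨_, hs'.symm _ _ _ _ hx, rfl⟩
      · simp at hx'
  · rintro (⟨l | l, q⟩ | x | x)
    · obtain ⟨i, p, h⟩ := hs.surj (Sum.inl (l, q))
      exact ⟨Sum.inl i, p, by simp [h]⟩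
    · obtain ⟨i, p, h⟩ := hs'.surj (Sum.inl (l, q))
      exact ⟨Sum.inr i, p, by simp [h]⟩
    · obtain ⟨i, p, h⟩ := hs.surj (Sum.inr x)
      exact ⟨Sum.inl i, p, by simp [h]⟩
    · obtain ⟨i, p, h⟩ := hs'.surj (Sum.inr x)
      exact ⟨Sum.inr i, p, by simp [h]⟩
  · have h1 := hs.rigid (fun q x => w q (Sum.map (Prod.map Sum.inl id) Sum.inl x)) fun i p q => by
      have h2 := h (Sum.inl i) p q
      simp only [Sum.elim_inl, Option.elim_map] at h2
      exact h2
    have hr := hs'.rigid (fun q x => w q (Sum.map (Prod.map Sum.inr id) Sum.inr x)) fun i p q => by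
      have h2 := h (Sum.inr i) p q
      simp only [Sum.elim_inr, Option.elim_map] at h2
      exact h2
    refine ⟨?_, ?_, ?_⟩
    · rintro q (l | l) r hqr
      · exact h1.1 q l r hqr
      · exact hr.1 q l r hqr
    · rintro q q' (l | l)
      · exact h1.2.1 q q' l
      · exact hr.2.1 q q' l
    · rintro q (x | x)
      · exact h1.2.2 q x
      · exact hr.2.2 q x

/-- A label of the second kind can be dropped. -/
theorem IsPattern.drop {s : A → Fin 4 → Option ((F × Fin 4) ⊕ Option E)} (hs : IsPattern k s) :
    IsPattern k fun i p => (s i p).bind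
      (Sum.elim (fun x => some (Sum.inl x)) fun x => x.map Sum.inr) := by
  have key : ∀ i p (y : (F × Fin 4) ⊕ E), ((s i p).bind
      (Sum.elim (fun x => some (Sum.inl x)) fun x => x.map Sum.inr)) = some y ↔
      s i p = some (Sum.map id some y) := by
    intro i p y
    rcases s i p with _ | x | _ | x <;> rcases y with y | y <;> simp
  refine ⟨fun i p q l h => ?_, fun y => ?_, fun w h => ?_⟩
  · rw [key] at h ⊢
    exact hs.symm _ _ _ _ h
  · obtain ⟨i, p, h⟩ := hs.surj (Sum.map id some y)
    exact ⟨i, p, by rw [key, h]⟩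
  · let w' : Fin 4 → (F × Fin 4) ⊕ Option E → k := fun q =>
      Sum.elim (fun x => w q (Sum.inl x)) fun x => x.elim 0 fun x => w q (Sum.inr x)
    have h0 : ∀ i p q, (s i p).elim 0 (w' q) = ((s i p).bind
        (Sum.elim (fun x => some (Sum.inl x)) fun x => x.map Sum.inr)).elim 0 (w q) := by
      intro i p q
      rcases s i p with _ | x | _ | x <;> rfl
    have h1 := hs.rigid w' fun i p q => by
      rw [h0, h0]
      exact h i p q
    exact ⟨h1.1, h1.2.1, fun q x => h1.2.2 q (some x)⟩

end Operations

/-- There is a pattern for `A` of dimension `a`, with `f` functionals and `e` other labels. -/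
def HasPattern (k : Type u) [Zero k] (a f e : ℕ) : Prop :=
  ∃ s : Fin a → Fin 4 → Option ((Fin f × Fin 4) ⊕ Fin e), IsPattern k s

/-! ### Five explicit patterns and the induction. -/

section Existence

variable {k : Type u} [Zero k] {a a' f f' e e' : ℕ}

theorem HasPattern.add (h : HasPattern k a f e) (h' : HasPattern k a' f' e') :
    HasPattern k (a + a') (f + f') (e + e') := by
  obtain ⟨s, hs⟩ := h
  obtain ⟨s', hs'⟩ := h'
  exact ⟨_, (hs.sum hs').reindex finSumFinEquiv.symm finSumFinEquiv finSumFinEquiv⟩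

theorem HasPattern.of_le (h : HasPattern k a f e) (he : e' ≤ e) : HasPattern k a f e' := by
  induction e, he using Nat.le_induction with
  | base => exact h
  | succ n _ ih =>
    obtain ⟨s, hs⟩ := h
    exact ih ⟨_, (hs.reindex (Equiv.refl _) (Equiv.refl _) (finSuccEquivLast (n := n))).drop⟩

/-- The label with a given number: the number `4 l + q` stands for the label `(l, q)`, for
`l < f`, the next `e` numbers for the labels of the second kind. -/
def label (f e n : ℕ) : Option ((Fin f × Fin 4) ⊕ Fin e) :=
  if h : n / 4 < f then some (Sum.inl (⟨n / 4, h⟩, ⟨n % 4, Nat.mod_lt _ (by norm_num)⟩))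
  else if h : n - 4 * f < e then some (Sum.inr ⟨n - 4 * f, h⟩) else none

/-- In the tables a number is decoded by `label`, and `9` is an unlabelled cell. Rigidity is a
finite system of equations between two unknowns or an unknown and zero, so it holds whatever the
characteristic. This block has `2(4f + e) = 3a`, so adding it raises `a` without loss. -/
theorem hasPattern_two_zero : HasPattern k 2 0 3 := by
  refine ⟨fun i p => label 0 3 ((![![0, 1, 2, 9], ![9, 0, 1, 2]] : Fin 2 → Fin 4 → ℕ) i p),
    by decide, by decide, fun w h => ?_⟩
  simp only [Fin.forall_fin_succ, label] at h ⊢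
  simp at h ⊢
  grind

theorem hasPattern_three_one : HasPattern k 3 1 0 := by
  refine ⟨fun i p => label 1 0 ((![![3, 1, 9, 0], ![3, 2, 1, 0], ![1, 0, 2, 3]] :
    Fin 3 → Fin 4 → ℕ) i p), by decide, by decide, fun w h => ?_⟩
  simp only [Fin.forall_fin_succ, label] at h ⊢
  simp at h ⊢
  grind

theorem hasPattern_four_one : HasPattern k 4 1 2 := by
  refine ⟨fun i p => label 1 2 ((![![9, 2, 1, 5], ![4, 1, 2, 4], ![3, 4, 5, 0], ![2, 5, 0, 3]] :
    Fin 4 → Fin 4 → ℕ) i p), by decide, by decide, fun w h => ?_⟩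
  simp only [Fin.forall_fin_succ, label] at h ⊢
  simp at h ⊢
  grind

/-- Here `2(4f + e) = 16` exceeds `3a = 15`. This makes up for the `8` against `9` of
`hasPattern_three_one`, so the sum, with `a = 8` and `f = 3`, attains equality. -/
theorem hasPattern_five_two : HasPattern k 5 2 0 := by
  refine ⟨fun i p => label 2 0 ((![![0, 9, 7, 6], ![2, 3, 0, 1], ![6, 7, 4, 5], ![4, 1, 2, 9],
    ![0, 5, 3, 2]] : Fin 5 → Fin 4 → ℕ) i p), by decide, by decide, fun w h => ?_⟩
  simp only [Fin.forall_fin_succ, label] at h ⊢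
  simp at h ⊢
  grind

theorem hasPattern_six_two : HasPattern k 6 2 1 := by
  refine ⟨fun i p => label 2 1 ((![![3, 6, 5, 0], ![0, 1, 3, 2], ![4, 3, 2, 1], ![6, 8, 4, 9],
    ![0, 7, 2, 5], ![8, 9, 6, 7]] : Fin 6 → Fin 4 → ℕ) i p), by decide, by decide, fun w h => ?_⟩
  simp only [Fin.forall_fin_succ, label] at h ⊢
  simp at h ⊢
  grind

/-- The last inequality says that `4f + e` is at least `⌊3a/2⌋`; smaller `e` then follow by dropping
labels. -/
theorem exists_hasPattern_of_le_three (hf : 0 < f) (hf3 : f ≤ 3) (hfa : 8 * f ≤ 3 * a) :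
    ∃ e, HasPattern k a f e ∧ 3 * a ≤ 2 * (4 * f + e) + 1 := by
  induction a using Nat.strong_induction_on with
  | _ a ih =>
    by_cases h : 8 * f + 6 ≤ 3 * a
    · obtain ⟨e, he, he'⟩ := ih (a - 2) (by omega) (by omega)
      have h1 := he.add (hasPattern_two_zero (k := k))
      rw [Nat.sub_add_cancel (by omega)] at h1
      exact ⟨e + 3, h1, by omega⟩
    -- Now `8f ≤ 3a < 8f + 6`, which leaves two values of `a` for each `f`.
    · interval_cases f
      · obtain rfl | rfl : a = 3 ∨ a = 4 := by omega
        · exact ⟨0, hasPattern_three_one, by norm_num⟩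
        · exact ⟨2, hasPattern_four_one, by norm_num⟩
      · obtain rfl | rfl : a = 6 ∨ a = 7 := by omega
        · exact ⟨1, hasPattern_six_two, by norm_num⟩
        · exact ⟨3, hasPattern_five_two.add hasPattern_two_zero, by norm_num⟩
      · obtain rfl | rfl : a = 8 ∨ a = 9 := by omega
        · exact ⟨0, hasPattern_five_two.add hasPattern_three_one, by norm_num⟩
        · exact ⟨2, hasPattern_five_two.add hasPattern_four_one, by norm_num⟩

theorem exists_hasPattern (hf : 0 < f) (hfa : 8 * f ≤ 3 * a) :
    ∃ e, HasPattern k a f e ∧ 3 * a ≤ 2 * (4 * f + e) + 1 := by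
  induction f using Nat.strong_induction_on generalizing a with
  | _ f ih =>
    by_cases h : f ≤ 3
    · exact exists_hasPattern_of_le_three hf h hfa
    · obtain ⟨e, he, he'⟩ := ih (f - 3) (by omega) (a := a - 8) (by omega) (by omega)
      have h1 := he.add ((hasPattern_five_two (k := k)).add hasPattern_three_one)
      rw [show a - 8 + (5 + 3) = a by omega, show f - 3 + (2 + 1) = f by omega] at h1
      exact ⟨e, h1, by omega⟩

theorem hasPattern (hf : 0 < f) (h : 2 * (4 * f + e) ≤ 3 * a) : HasPattern k a f e := by
  obtain ⟨e', he, he'⟩ := exists_hasPattern (k := k) (a := a) hf (by omega)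
  exact he.of_le (by omega)

end Existence

end Steiner

end

noncomputable section

namespace Steiner

/-! ## The morphism defined by a pattern -/

section PatternMor

variable {k : Type u} [Field k] {a b f e : ℕ} {s : Fin a → Fin 4 → Option ((Fin f × Fin 4) ⊕ Fin e)}
  {c : (Fin f × Fin 4) ⊕ Fin e → Fin a × Fin 4} {τ : Fin b → Fin a × Fin 4}

variable (k s c τ) in
/-- The morphism from `B` onto the subspace of `A ⊗ V` annihilated by the sums of the coordinates
with the same label, where `c` chooses a cell for each label and `τ` enumerates the other cells. -/
def patternMor : Idx a b → k := fun x =>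
  (if (x.1, x.2.2) = τ x.2.1 then 1 else 0) -
    (s (τ x.2.1).1 (τ x.2.1).2).elim 0 fun y => if (x.1, x.2.2) = c y then 1 else 0

variable (k s) in
/-- The functionals on `A ⊗ S² V` defined by a pattern. -/
def patternForm : Matrix (Fin f) (QuadIdx a) k := fun l t =>
  if s t.1 t.2.1.1 = some (Sum.inl (l, t.2.1.2)) then 1 else 0

theorem vecMul_cellMat_patternMor (v : Fin a × Fin 4 → k) (j : Fin b) :
    Matrix.vecMul v (cellMat (patternMor k s c τ)) j =
      v (τ j) - (s (τ j).1 (τ j).2).elim 0 (v ∘ c) := by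
  simp only [Matrix.vecMul, dotProduct, cellMat, patternMor, Prod.mk.eta, mul_sub,
    Finset.sum_sub_distrib]
  rcases s (τ j).1 (τ j).2 with _ | y <;> simp

/-- The functionals on `A ⊗ V` that annihilate the image of the morphism. -/
theorem apply_eq_of_vecMul_cellMat_eq_zero (hc : ∀ x, s (c x).1 (c x).2 = some x)
    (hτ : ∀ z, (∃ x, c x = z) ∨ ∃ j, τ j = z) {v : Fin a × Fin 4 → k}
    (hv : Matrix.vecMul v (cellMat (patternMor k s c τ)) = 0) (z : Fin a × Fin 4) :
    v z = (s z.1 z.2).elim 0 (v ∘ c) := by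
  obtain ⟨x, rfl⟩ | ⟨j, rfl⟩ := hτ z
  · rw [hc]; rfl
  · have := congrFun hv j
    rw [vecMul_cellMat_patternMor] at this
    exact sub_eq_zero.1 this

/-- A pattern's functional is read from the ordered pair of variables only; the symmetry of the
pattern gives the value for the other order. -/
theorem contr_patternForm (hs : IsPattern k s) (x : Fin f × Fin 4) (z : Fin a × Fin 4) :
    contr (patternForm k s) x z = if s z.1 z.2 = some (Sum.inl x) then 1 else 0 := by
  obtain ⟨l, q⟩ := x
  obtain ⟨i, p⟩ := z
  have h : s i p = some (Sum.inl (l, q)) ↔ s i q = some (Sum.inl (l, p)) :=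
    ⟨hs.symm _ _ _ _, hs.symm _ _ _ _⟩
  rw [contr, patternForm, sortPair]
  by_cases h1 : p ≤ q
  · rw [dif_pos h1]
  · rw [dif_neg h1]
    exact if_congr h.symm rfl rfl

theorem contr_patternForm_mul_cellMat (hs : IsPattern k s)
    (hc : ∀ x, s (c x).1 (c x).2 = some x) :
    contr (patternForm k s) * cellMat (patternMor k s c τ) = 0 := by
  ext x j
  have h := vecMul_cellMat_patternMor (s := s) (c := c) (τ := τ) (contr (patternForm k s) x) j
  rw [Matrix.mul_apply]
  refine h.trans ?_
  rw [contr_patternForm hs, Matrix.zero_apply]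
  rcases s (τ j).1 (τ j).2 with _ | y
  · simp
  · simp [contr_patternForm hs, hc]

theorem contrSub_patternForm (hs : IsPattern k s) (hc : ∀ x, s (c x).1 (c x).2 = some x) :
    contrSub (fun x => c (Sum.inl x)) (patternForm k s) = 1 := by
  ext x y
  refine (contr_patternForm hs x (c (Sum.inl y))).trans ?_
  rw [hc, Matrix.one_apply]
  simp [eq_comm]

/-- If `θ` annihilates `Im m(1)`, its contraction by `x_q` annihilates `Im m(0)`, hence is a
combination `w q` of label sums. The symmetry of `θ` in the two variables is exactly the system in
`IsPattern.rigid`. -/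
theorem ker_quadMat_patternMor_le (hs : IsPattern k s) (hc : ∀ x, s (c x).1 (c x).2 = some x)
    (hτ : ∀ z, (∃ x, c x = z) ∨ ∃ j, τ j = z) :
    LinearMap.ker (quadMat (patternMor k s c τ)).transpose.mulVecLin ≤
      LinearMap.range (patternForm k s).transpose.mulVecLin := by
  intro θ hθ
  rw [LinearMap.mem_ker, Matrix.mulVecLin_apply, Matrix.mulVec_transpose] at hθ
  let φ : Matrix (Fin 1) (QuadIdx a) k := Matrix.of fun _ => θ
  have h0 : φ * quadMat (patternMor k s c τ) = 0 := by
    ext l y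
    exact congrFun hθ y
  rw [mul_quadMat_eq_zero_iff] at h0
  let v : Fin 4 → Fin a × Fin 4 → k := fun q z => θ (z.1, sortPair z.2 q)
  have h1 : ∀ q i p, θ (i, sortPair p q) = (s i p).elim 0 (v q ∘ c) := fun q i p =>
    apply_eq_of_vecMul_cellMat_eq_zero hc hτ (v := v q)
      (funext fun j => congrFun (congrFun h0 (0, q)) j) (i, p)
  obtain ⟨h2, h3, h4⟩ := hs.rigid (fun q => v q ∘ c) fun i p q => by
    rw [← h1, ← h1, sortPair_comm]
  refine ⟨fun l => v 0 (c (Sum.inl (l, 0))), ?_⟩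
  rw [Matrix.mulVecLin_apply, Matrix.mulVec_transpose]
  ext ⟨i, x⟩
  have h5 := h1 x.1.2 i x.1.1
  rw [sortPair_of_le] at h5
  rw [h5]
  simp only [Matrix.vecMul, dotProduct, patternForm]
  rcases s i x.1.1 with _ | ⟨l', r⟩ | y
  · simp
  · by_cases hr : r = x.1.2
    · subst hr
      simp only [Option.some.injEq, Sum.inl.injEq, Prod.mk.injEq, and_true, mul_ite, mul_one,
        mul_zero, Finset.sum_ite_eq, Finset.mem_univ, if_true]
      exact h3 _ _ _
    · simp only [Option.some.injEq, Sum.inl.injEq, Prod.mk.injEq, hr, and_false, if_false,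
        mul_zero, Finset.sum_const_zero]
      exact (h2 _ _ _ (Ne.symm hr)).symm
  · simpa using (h4 x.1.2 y).symm

theorem cokerDim_patternMor_le (hs : IsPattern k s) (hc : ∀ x, s (c x).1 (c x).2 = some x)
    (hτ : ∀ z, (∃ x, c x = z) ∨ ∃ j, τ j = z) : cokerDim (patternMor k s c τ) 1 ≤ f := by
  have h1 := cokerDim_one_add_rank (patternMor k s c τ)
  have h2 := LinearMap.finrank_range_add_finrank_ker
    (quadMat (patternMor k s c τ)).transpose.mulVecLin
  have h3 := Submodule.finrank_mono (ker_quadMat_patternMor_le hs hc hτ)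
  have h4 : (patternForm k s).transpose.rank ≤ Fintype.card (Fin f) :=
    Matrix.rank_le_card_width _
  rw [Module.finrank_fintype_fun_eq_card, card_quadIdx] at h2
  change (quadMat (patternMor k s c τ)).transpose.rank + _ = _ at h2
  rw [Matrix.rank_transpose, rank_quadMat] at h2
  change _ ≤ (patternForm k s).transpose.rank at h3
  rw [Fintype.card_fin] at h4
  omega

/-- The product of a monomial with a variable. -/
def Mon.mulVar {t : ℤ} (e : Mon t) (p : Fin 4) : Mon (t + 1) :=
  ⟨e.1 + Pi.single p 1, by simp [Finset.sum_add_distrib, e.2.1],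
    fun q => add_nonneg (e.2.2 q) ((monOne p).2.2 q)⟩

theorem vecMul_degMat_apply {t : ℤ} (m : Idx a b → k) (ψ : Fin a × Mon (t + 1) → k) (j : Fin b)
    (d : Mon t) : Matrix.vecMul ψ (degMat m t) (j, d) =
      Matrix.vecMul (fun z : Fin a × Fin 4 => ψ (z.1, d.mulVar z.2)) (cellMat m) j := by
  simp only [Matrix.vecMul, dotProduct, degMat, cellMat, Fintype.sum_prod_type, Finset.mul_sum]
  refine Finset.sum_congr rfl fun i _ => ?_
  rw [Finset.sum_comm]
  refine Finset.sum_congr rfl fun p _ => ?_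
  rw [Finset.sum_eq_single (d.mulVar p)]
  · rw [if_pos (show (d.mulVar p).1 = d.1 + Pi.single p 1 from rfl)]
  · intro d' _ hd'
    rw [if_neg fun h : d'.1 = d.1 + Pi.single p 1 => hd' (Subtype.ext h), mul_zero]
  · simp

/-- Contract a cubic functional that annihilates `Im m(2)` by `x_r`: rigidity makes the result a
combination of the `f` quadratic functionals. The symmetry between `r` and a second variable then
kills all its coefficients. -/
theorem surjective_patternMor (hs : IsPattern k s) (hc : ∀ x, s (c x).1 (c x).2 = some x)
    (hτ : ∀ z, (∃ x, c x = z) ∨ ∃ j, τ j = z) :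
    Function.Surjective (mulOn (patternMor k s c τ) ∅ 2) := by
  rw [surjective_mulOn_iff, ← Matrix.rank_transpose]
  suffices h : LinearMap.ker (degMat (patternMor k s c τ) 2).transpose.mulVecLin = ⊥ by
    have h2 := LinearMap.finrank_range_add_finrank_ker
      (degMat (patternMor k s c τ) 2).transpose.mulVecLin
    rw [h, finrank_bot, Module.finrank_fintype_fun_eq_card] at h2
    exact h2
  rw [LinearMap.ker_eq_bot']
  intro ψ hψ
  rw [Matrix.mulVecLin_apply, Matrix.mulVec_transpose] at hψ
  let v : Mon 2 → Fin a × Fin 4 → k := fun d z => ψ (z.1, d.mulVar z.2)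
  have h1 : ∀ d i p, ψ (i, d.mulVar p) = (s i p).elim 0 (v d ∘ c) := fun d i p =>
    apply_eq_of_vecMul_cellMat_eq_zero hc hτ (v := v d)
      (funext fun j => by rw [← vecMul_degMat_apply, hψ]; rfl) (i, p)
  let w : Fin 4 → Fin 4 → (Fin f × Fin 4) ⊕ Fin e → k := fun r q => v (monTwo (sortPair q r)) ∘ c
  have hw : ∀ r q, w r q = w q r := fun r q => by
    simp only [w, sortPair_comm]
  have h2 := fun r => hs.rigid (w r) fun i p q => by
    rw [← h1, ← h1]
    congr 2
    refine Subtype.ext ?_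
    change (monTwo _).1 + _ = (monTwo _).1 + _
    rw [monTwo_sortPair, monTwo_sortPair]
    abel
  -- After exchanging `r` and `q` the label `(l, q)` is off-diagonal, so it vanishes; by `h2` the
  -- diagonal values do not depend on `q`, so they vanish for `q = r` too.
  have h3 : ∀ r q, q ≠ r → ∀ l, w r q (Sum.inl (l, q)) = 0 := fun r q hqr l => by
    rw [hw]
    exact (h2 q).1 r l q hqr.symm
  have h4 : ∀ r q x, w r q x = 0 := by
    rintro r q (⟨l, p⟩ | x)
    · by_cases hqp : q = p
      · subst hqp
        obtain ⟨q', hq'⟩ := exists_ne r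
        rw [(h2 r).2.1 q q' l]
        exact h3 r q' hq' l
      · exact (h2 r).1 q l p hqp
    · exact (h2 r).2.2 q x
  ext ⟨i, d⟩
  obtain ⟨p, d', hd⟩ := exists_eq_add_single d zero_le_two
  obtain ⟨x, rfl⟩ := monTwo_bijective.2 d'
  obtain rfl : d = (monTwo x).mulVar p := Subtype.ext hd
  have h5 : v (monTwo x) ∘ c = fun _ => 0 := funext fun y => by
    have := h4 x.1.2 x.1.1 y
    simp only [w, sortPair_of_le] at this
    exact this
  rw [h1, h5]
  rcases s i p with _ | y <;> rfl

/-- The rows indexed by the unchosen cells form an identity matrix. -/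
theorem injective_patternMor (hτ : Function.Injective τ) (hcτ : ∀ x j, c x ≠ τ j) :
    Function.Injective (mulOn (patternMor k s c τ) ∅ 0) := by
  have h1 : (cellMat (patternMor k s c τ)).submatrix τ id = 1 := by
    ext j j'
    simp only [Matrix.submatrix_apply, cellMat, patternMor, Prod.mk.eta, id, hτ.eq_iff,
      Matrix.one_apply]
    rcases s (τ j').1 (τ j').2 with _ | y
    · simp
    · simp [(hcτ y j).symm]
  have h2 := le_rank_of_det_submatrix_ne_zero (cellMat (patternMor k s c τ)) τ id
    (by rw [h1, Matrix.det_one]; exact one_ne_zero)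
  rw [injective_mulOn_iff, ← rank_cellMat, Fintype.card_prod, card_mon_zero, mul_one]
  exact le_antisymm (Matrix.rank_le_card_width _) h2

end PatternMor

/-- There are `f` functionals on `A ⊗ S² V` with linearly independent contractions, and an injective
morphism whose image is annihilated by these contractions, such that the functionals span the
annihilator of the image of `m(1)` and `m(2)` is surjective. -/
theorem exists_good_morphism (k : Type u) [Field k] {a b f : ℕ} (hab : 5 * a ≤ 2 * b)
    (hf : 0 < f) (hfa : 4 * f + b ≤ 4 * a) :
    ∃ (J : Fin f × Fin 4 → Fin a × Fin 4) (φ : Matrix (Fin f) (QuadIdx a) k) (m : Idx a b → k),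
      Function.Injective J ∧ (contrSub J φ).det ≠ 0 ∧ contr φ * cellMat m = 0 ∧
      cokerDim m 1 ≤ f ∧ Function.Surjective (mDeg m 2) ∧ Function.Injective (mulOn m ∅ 0) := by
  classical
  -- The total number of labels `4f + e = 4a − b` leaves exactly `b` cells for a basis of `B`; `hab`
  -- becomes `2(4f + e) ≤ 3a`.
  obtain ⟨s, hs⟩ := hasPattern (k := k) (a := a) (e := 4 * a - b - 4 * f) hf (by omega)
  have hsurj : ∀ x, ∃ z : Fin a × Fin 4, s z.1 z.2 = some x := fun x => by
    obtain ⟨i, p, h⟩ := hs.surj x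
    exact ⟨(i, p), h⟩
  choose c hc using hsurj
  have hc' : Function.Injective c := fun x y h => by
    have := hc x
    rw [h, hc y] at this
    exact (Option.some.inj this).symm
  have hcard : Fintype.card {z // z ∉ Set.range c} = b := by
    rw [Fintype.card_subtype_compl, Set.card_range_of_injective hc']
    simp only [Fintype.card_prod, Fintype.card_sum, Fintype.card_fin]
    omega
  let τ' := (Fintype.equivFinOfCardEq hcard).symm
  have hτ : ∀ z, (∃ x, c x = z) ∨ ∃ j, (τ' j).1 = z := fun z => by
    by_cases hz : z ∈ Set.range c
    · exact Or.inl hz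
    · exact Or.inr ⟨τ'.symm ⟨z, hz⟩, by simp⟩
  refine ⟨fun x => c (Sum.inl x), patternForm k s, patternMor k s c fun j => (τ' j).1,
    hc'.comp Sum.inl_injective, ?_, contr_patternForm_mul_cellMat hs hc,
    cokerDim_patternMor_le hs hc hτ, surjective_patternMor hs hc hτ,
    injective_patternMor (Subtype.val_injective.comp τ'.injective) fun x j h => ?_⟩
  · rw [contrSub_patternForm hs hc, Matrix.det_one]
    exact one_ne_zero
  · exact (τ' j).2 ⟨x, h⟩

end Steiner

end

/-! ### The theorem. -/

theorem mainTheorem1 (k : Type u) [Field k] [IsAlgClosed k] [CharZero k] (a b f : ℕ)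
    (hab : (5 * a / 2 : ℚ) ≤ b) (hba : b ≤ 4 * a) (hf : 0 < f) :
    ((a - b / 4 : ℚ) < f →
      Steiner.locusWP k a b f ⊆ Steiner.corankLocus k a b 1 0 ∧
      ∀ x ∈ Steiner.locusWP k a b f, Steiner.HasTrivialSummand (Steiner.mat x)) ∧
    ((f : ℚ) ≤ a - b / 4 →
      IsIrreducible (Steiner.locusWP k a b f) ∧
      ¬ Steiner.locusWP k a b f ⊆ Steiner.corankLocus k a b 1 0 ∧
      ∃ PW : Set (Steiner.Space k a b),
        (Steiner.IsComponent PW (Steiner.corankLocus k a b f 1) ∧ Steiner.locusWP k a b f ⊆ PW) ∧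
        (∀ C : Set (Steiner.Space k a b), Steiner.IsComponent C (Steiner.corankLocus k a b f 1) →
          Steiner.locusWP k a b f ⊆ C → C = PW) ∧
        ∃ μ ∈ PW, PW = closure {μ} ∩ Steiner.corankLocus k a b f 1 ∧
          -- the codimension of `PW` in `M`
          μ.asIdeal.height = ((f * (4 * b - 10 * a + f) : ℕ) : ℕ∞) ∧
          Steiner.IsGenericMorphism f μ ∧
          (∀ d : ℕ, 1 < d → Function.Surjective (Steiner.mDeg (Steiner.mat μ) d)) ∧
          Steiner.SheafSurjective (Steiner.mat μ) ∧
          Steiner.LocallyFreeOfRank (Steiner.mat μ) (b - a) ∧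
          (∀ t : ℤ, t ≠ 1 → ∀ i j : ℕ, i ≠ j →
            Subsingleton (Steiner.H (Steiner.mat μ) t i) ∨
            Subsingleton (Steiner.H (Steiner.mat μ) t j)) ∧
          Module.finrank (Steiner.kappa μ) (Steiner.H (Steiner.mat μ) 1 1) = f ∧
          Module.finrank (Steiner.kappa μ) (Steiner.H (Steiner.mat μ) 1 0) = 4 * b - 10 * a + f ∧
          Subsingleton (Steiner.H (Steiner.mat μ) 1 2) ∧
          Subsingleton (Steiner.H (Steiner.mat μ) 1 3)) := by
  have hinf : Infinite k := IsAlgClosed.instInfinite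
  have hab' : 5 * a ≤ 2 * b := by
    have : (5 * a : ℚ) ≤ 2 * b := by linarith
    exact_mod_cast this
  refine ⟨fun hfa => ?_, fun hfa => ?_⟩
  · have hfa' : 4 * a < 4 * f + b := by
      have : (4 * a : ℚ) < 4 * f + b := by linarith
      exact_mod_cast this
    exact ⟨Steiner.locusWP_subset_corankLocus_zero hab' hba hf hfa',
      fun x hx => Steiner.hasTrivialSummand_of_mem_locusWP hab' hf hfa' hx⟩
  have hfa' : 4 * f + b ≤ 4 * a := by
    have : (4 * f + b : ℚ) ≤ 4 * a := by linarith
    exact_mod_cast this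
  obtain ⟨J, φ, m, hJ, hφ, hm, hm1, hm2, hm0⟩ := Steiner.exists_good_morphism k hab' hf hfa'
  -- The explicit morphism is a specialization of `μ`, so `μ` inherits its rank bounds in every
  -- degree.
  have hrank := Steiner.rank_degMat_le_genPoint hJ hφ hm
  set μ := Steiner.genPoint k b J
  have h1 : Steiner.cokerDim (Steiner.mat μ) 1 = f := by
    refine le_antisymm ?_ (Steiner.le_cokerDim_genPoint hJ)
    have h3 := hrank 1
    have h4 := Steiner.cokerDim_one_add_rank m
    have h5 := Steiner.cokerDim_one_add_rank (Steiner.mat μ)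
    omega
  have h2 : Function.Surjective (Steiner.mDeg (Steiner.mat μ) 2) := by
    rw [Steiner.surjective_mulOn_iff] at hm2 ⊢
    exact le_antisymm (Matrix.rank_le_card_height _) (hm2 ▸ hrank 2)
  have h0 : Function.Injective (Steiner.mulOn (Steiner.mat μ) ∅ 0) := by
    rw [Steiner.injective_mulOn_iff] at hm0 ⊢
    exact le_antisymm (Matrix.rank_le_card_width _) (hm0 ▸ hrank 0)
  have hsurj : Steiner.SheafSurjective (Steiner.mat μ) := Steiner.sheafSurjective_of_surjective h2
  have hE : μ ∈ Steiner.locusExact k a b f := (Steiner.mem_locusExact_iff hab' μ).2 ⟨hsurj, h1⟩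
  have hgen := Steiner.isGenericSubspace_genPoint hJ h1
  -- Any component of `W°` through `μ` dominates the Grassmannian, with `μ` itself as witness.
  have hWP : μ ∈ Steiner.locusWP k a b f := ⟨hE, fun C _ hC => ⟨μ, hC, hgen⟩⟩
  have hcl := Steiner.locusWP_subset_closure (b := b) hab' hJ hφ
  have hirr : IsIrreducible (closure {μ} ∩ Steiner.corankLocus k a b f 1) :=
    Steiner.isIrreducible_of_subset_closure ⟨subset_closure rfl, hE.1⟩ Set.inter_subset_left
  refine ⟨Steiner.isIrreducible_of_subset_closure hWP hcl, fun h => ?_,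
    closure {μ} ∩ Steiner.corankLocus k a b f 1, ⟨⟨⟨hirr, Set.inter_subset_right⟩, ?_⟩,
      Set.subset_inter hcl fun x hx => hx.1.1⟩, fun C hC hsub => ?_, μ, ⟨subset_closure rfl, hE.1⟩,
    rfl, ?_, Steiner.isGenericMorphism_genPoint hJ hφ h1,
    fun d hd => Steiner.surjective_mDeg_of_le hd h2, hsurj, hsurj.locallyFreeOfRank,
    fun t ht i j hij => Steiner.subsingleton_H_or h0 h2 ht hij, ?_, ?_,
    Steiner.subsingleton_H_add_two hsurj 1 0 (Or.inl rfl),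
    Steiner.subsingleton_H_add_two hsurj 1 1 (Or.inr (by norm_num))⟩
  · have h3 : 1 ≤ Steiner.corank (Steiner.mat μ) 0 := (h hWP).2
    have h4 : Module.finrank (Steiner.kappa μ)
        (LinearMap.ker (Steiner.mDeg (Steiner.mat μ) 0)) = 0 := by
      have : LinearMap.ker (Steiner.mDeg (Steiner.mat μ) 0) = ⊥ := LinearMap.ker_eq_bot.2 h0
      rw [this, finrank_bot]
    rw [Steiner.corank, h4, Nat.zero_min] at h3
    omega
  · intro T hT hle
    exact Set.subset_inter (Steiner.subset_closure_genPoint hab' hJ hφ h1 hT.1 hT.2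
      (hle ⟨subset_closure rfl, hE.1⟩)) hT.2
  · refine subset_antisymm ?_ ?_
    · exact Set.subset_inter (Steiner.subset_closure_genPoint hab' hJ hφ h1 hC.prop.1
        hC.prop.2 (hsub hWP)) hC.prop.2
    · refine hC.le_of_ge ⟨hirr, Set.inter_subset_right⟩ ?_
      exact Set.subset_inter (Steiner.subset_closure_genPoint hab' hJ hφ h1 hC.prop.1
        hC.prop.2 (hsub hWP)) hC.prop.2
  · have h3 := Steiner.height_genPoint hJ hφ h1
    refine (ENat.addLECancellable_natCast _).inj_left.1 (h3.trans ?_)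
    norm_cast
    -- Since `10a ≤ 4b` and `f ≤ a`, the natural-number subtractions in the formula are genuine.
    obtain ⟨n, hn⟩ : ∃ n, 4 * b = 10 * a + n := ⟨4 * b - 10 * a, by omega⟩
    obtain ⟨r, hr⟩ : ∃ r, a = f + r := ⟨a - f, by omega⟩
    have h4 : 4 * b - 10 * a = n := by omega
    have h5 : 10 * a - f = 9 * f + 10 * r := by omega
    have h6 : 4 * a - 4 * f = 4 * r := by omega
    rw [h4, h5, h6]
    have h7 : f * (4 * b) = f * (10 * a + n) := by rw [hn]
    subst hr
    linarith
  · rw [Steiner.finrank_H_one hsurj 1]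
    exact h1
  · rw [Steiner.finrank_H_zero]
    have h3 := Steiner.finrank_ker_one_add_rank (Steiner.mat μ)
    have h4 := Steiner.cokerDim_one_add_rank (Steiner.mat μ)
    have h5 : Module.finrank (Steiner.kappa μ) (LinearMap.ker (Steiner.mulOn (Steiner.mat μ) ∅ 1)) =
      Module.finrank (Steiner.kappa μ) (LinearMap.ker (Steiner.mDeg (Steiner.mat μ) 1)) := rfl
    omega
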